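/- **Setting.** Let $N\ge 1$ and let $\lambda,\mu,k,t>0$. For a non-empty bounded open set $\Omega\subset\mathbb R^N$ put $\mathcal V(\Omega)=(H^1_0(\Omega))^N\times H^1_0(\Omega)$, where $H^1_0(\Omega)$ is the closure of $C_c^\infty(\Omega)$ in $H^1(\Omega)$. A number $\gamma\in\mathbb R$ is an eigenvalue of the Reissner--Mindlin system if there is $(\beta,w)\in\mathcal V(\Omega)$, $(\beta,w)\neq 0$, such that $$\frac{\mu}{12}\int_\Omega\nabla\beta:\nabla\eta\,dx+\frac{\mu+\lambda}{12}\int_\Omega \operatorname{div}\beta\,\operatorname{div}\eta\,dx+\frac{\mu k}{t^2}\int_\Omega(\nabla w-\beta)\cdot(\nabla v-\eta)\,dx=\gamma\int_\Omega\Big(wv+\frac{t^2}{12}\beta\cdot\eta\Big)dx$$ for all $(\eta,v)\in\mathcal V(\Omega)$. The eigenvalues form a divergent sequence $0<\gamma_{1,t}[\Omega]\le\gamma_{2,t}[\Omega]\le\cdots$, each one repeated according to its (finite) multiplicity. **Atlases.** A *cuboid* is an isometric image of a set $\prod_{i=1}^N\,]a_i,b_i[$. An *atlas* in $\mathbb R^N$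 is a tuple $\mathcal A=(\rho,s,s',\{V_j\}_{j=1}^s,\{r_j\}_{j=1}^s)$ with $\rho>0$, integers $s\ge 1$ and $0\le s'\le s$, bounded open cuboids $V_j$ and isometries $r_j$ of $\mathbb R^N$. Write $V_\delta=\{x\in V: d(x,\partial V)>\delta\}$ and $x=(\bar x,x_N)$ with $\bar x\in\mathbb R^{N-1}$. The class $C(\mathcal A)$ consists of the open sets $\Omega\subset\mathbb R^N$ such that (i) $\Omega\subset\bigcup_{j=1}^s (V_j)_\rho$, and $(V_j)_\rho\cap\Omega\ne\emptyset$ for all $j$; (ii) $V_j\cap\partial\Omega\neq\emptyset$ for $j\le s'$, and $V_j\cap\partial\Omega=\emptyset$ for $s'<j\le s$; (iii) for every $j$, $r_j(V_j)=\{x: a_{ij}<x_i<b_{ij},\ i=1,\dots,N\}$ and $r_j(\Omega\cap V_j)=\{x: a_{Nj}<x_N<g_j(\bar x),\ \bar x\in W_j\}$, where $W_j=\{\bar x: a_{ij}<x_i<b_{ij},\ i=1,\dots,N-1\}$ and $g_j$ is a continuous function on $\overline W_j$; moreover $a_{Nj}+\rho\le g_j\le b_{Nj}-\rho$ on $\overline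 W_j$ if $j\le s'$, and $g_j=b_{Nj}$ on $\overline W_j$ if $s'<j\le s$. For $\Omega_1,\Omega_2\in C(\mathcal A)$ with describing functions $g_{1j},g_{2j}$, the *atlas distance* is $$d_{\mathcal A}(\Omega_1,\Omega_2)=\max_{j=1,\dots,s}\ \sup_{(\bar x,x_N)\in r_j(V_j)}|g_{1j}(\bar x)-g_{2j}(\bar x)|.$$ **Theorem.** Let $\mathcal A$ be an atlas in $\mathbb R^N$ and let $\lambda,\mu>0$. Then there is $c>0$, depending only on $\mathcal A,\lambda,\mu$ (in particular not on $k$, $n$, $t$), such that $$|\gamma_{n,t}[\Omega_1]-\gamma_{n,t}[\Omega_2]|\le c\,\max\{\gamma_{n,t}[\Omega_1],\gamma_{n,t}[\Omega_2]\}\,d_{\mathcal A}(\Omega_1,\Omega_2)$$ for all $k>0$, all integers $n\ge1$, all $t>0$ and all $\Omega_1,\Omega_2\in C(\mathcal A)$ with $d_{\mathcal A}(\Omega_1,\Omega_2)<c^{-1}$. -/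

import Mathlib

open MeasureTheory Set
open scoped ContDiff

noncomputable section

namespace ReissnerMindlin

/-- The Euclidean space `ℝ^N`. -/
abbrev Eucl (N : ℕ) : Type := EuclideanSpace ℝ (Fin N)

/-! ### Atlases, the atlas class and the atlas distance

The dimension is `N = d + 1`, so that `x = (x̄, x_N)` with `x̄ ∈ ℝ^d`. -/

/-- `x̄ = (x_1, …, x_{N-1})`. -/
def bar {d : ℕ} (x : Eucl (d + 1)) : Eucl d := WithLp.toLp 2 (fun i : Fin d => x i.castSucc)

/-- The open box `∏ ]a_i, b_i[`. -/
def box {N : ℕ} (a b : Fin N → ℝ) : Set (Eucl N) := {x | ∀ i, a i < x i ∧ x i < b i}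

/-- A bounded open cuboid: an isometric image of an open box. -/
def IsCuboid {N : ℕ} (V : Set (Eucl N)) : Prop :=
  ∃ (e : Eucl N ≃ᵢ Eucl N) (a b : Fin N → ℝ), V = e '' box a b

/-- `V_δ = {x ∈ V : d(x, ∂V) > δ}`. -/
def shrink {N : ℕ} (V : Set (Eucl N)) (δ : ℝ) : Set (Eucl N) :=
  {x | x ∈ V ∧ δ < Metric.infDist x (frontier V)}

/-- An atlas `(ρ, s, s', {V_j}, {r_j})` in `ℝ^(d+1)`; the indices `j = 1, …, s` are the elements
of `Fin s`, and `j ≤ s'` becomes `(j : ℕ) < s'`. -/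
structure Atlas (d : ℕ) where
  ρ : ℝ
  s : ℕ
  s' : ℕ
  V : Fin s → Set (Eucl (d + 1))
  r : Fin s → (Eucl (d + 1) ≃ᵢ Eucl (d + 1))
  ρ_pos : 0 < ρ
  one_le_s : 1 ≤ s
  s'_le_s : s' ≤ s
  isCuboid : ∀ j, IsCuboid (V j)

namespace Atlas

variable {d : ℕ}

/-- The base `W_j ⊆ ℝ^(N-1)` of a box with sides `]a_i, b_i[`, `i = 1, …, N`. -/
def base (a b : Fin (d + 1) → ℝ) : Set (Eucl d) :=
  box (fun i => a i.castSucc) (fun i => b i.castSucc)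

/-- The functions `g_j` describe the boundary of `Ω` in the charts of the atlas. -/
def IsGraphFamily (A : Atlas d) (Ω : Set (Eucl (d + 1))) (g : Fin A.s → Eucl d → ℝ) : Prop :=
  ∃ a b : Fin A.s → Fin (d + 1) → ℝ, ∀ j : Fin A.s,
    A.r j '' A.V j = box (a j) (b j) ∧
    A.r j '' (Ω ∩ A.V j) =
      {x | a j (Fin.last d) < x (Fin.last d) ∧ x (Fin.last d) < g j (bar x) ∧
        bar x ∈ base (a j) (b j)} ∧
    ContinuousOn (g j) (closure (base (a j) (b j))) ∧
    (A.s' ≤ (j : ℕ) → ∀ z ∈ closure (base (a j) (b j)), g j z = b j (Fin.last d)) ∧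
    ((j : ℕ) < A.s' → ∀ z ∈ closure (base (a j) (b j)),
      a j (Fin.last d) + A.ρ ≤ g j z ∧ g j z ≤ b j (Fin.last d) - A.ρ)

/-- The atlas class `C(𝒜)`. -/
def Class (A : Atlas d) : Set (Set (Eucl (d + 1))) :=
  {Ω | IsOpen Ω ∧
    Ω ⊆ ⋃ j, shrink (A.V j) A.ρ ∧
    (∀ j, (shrink (A.V j) A.ρ ∩ Ω).Nonempty) ∧
    (∀ j : Fin A.s, (j : ℕ) < A.s' → (A.V j ∩ frontier Ω).Nonempty) ∧
    (∀ j : Fin A.s, A.s' ≤ (j : ℕ) → A.V j ∩ frontier Ω = ∅) ∧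
    ∃ g, A.IsGraphFamily Ω g}

open Classical in
/-- The functions `g_j` describing the boundary of `Ω` (for `Ω ∈ C(𝒜)`). -/
def graphFun (A : Atlas d) (Ω : Set (Eucl (d + 1))) : Fin A.s → Eucl d → ℝ :=
  if h : ∃ g, A.IsGraphFamily Ω g then h.choose else fun _ _ => 0

/-- The atlas distance
`d_𝒜(Ω₁, Ω₂) = max_j sup_{(x̄, x_N) ∈ r_j(V_j)} |g_{1j}(x̄) - g_{2j}(x̄)|`. -/
def dist (A : Atlas d) (Ω₁ Ω₂ : Set (Eucl (d + 1))) : ℝ :=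
  ⨆ j : Fin A.s, ⨆ x : (A.r j '' A.V j : Set (Eucl (d + 1))),
    |A.graphFun Ω₁ j (bar x.1) - A.graphFun Ω₂ j (bar x.1)|

theorem graphFun_spec (A : Atlas d) {Ω : Set (Eucl (d + 1))} (h : ∃ g, A.IsGraphFamily Ω g) :
    A.IsGraphFamily Ω (A.graphFun Ω) := by
  unfold graphFun
  rw [dif_pos h]
  exact h.choose_spec

/-- The functions describing the boundary are determined by `Ω`. -/
theorem IsGraphFamily.eq {A : Atlas d} {Ω : Set (Eucl (d + 1))} {g g' : Fin A.s → Eucl d → ℝ}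
    (hg : A.IsGraphFamily Ω g) (hg' : A.IsGraphFamily Ω g') (j : Fin A.s) {x : Eucl (d + 1)}
    (hx : x ∈ A.r j '' A.V j) : g j (bar x) = g' j (bar x) := by
  have key : ∀ g : Fin A.s → Eucl d → ℝ, A.IsGraphFamily Ω g → ∃ a : ℝ, a < g j (bar x) ∧
      {y : ℝ | WithLp.toLp 2 (Fin.snoc (α := fun _ => ℝ) (bar x).ofLp y) ∈
        A.r j '' (Ω ∩ A.V j)} = Ioo a (g j (bar x)) := by
    rintro g ⟨a, b, h⟩
    obtain ⟨h1, h2, -, h4, h5⟩ := h j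
    have hx' := hx
    rw [h1] at hx'
    have hb : bar x ∈ base (a j) (b j) := fun i => hx' i.castSucc
    refine ⟨a j (Fin.last d), ?_, ?_⟩
    · rcases lt_or_ge (j : ℕ) A.s' with hj | hj
      · have := h5 hj _ (subset_closure hb)
        have := A.ρ_pos
        linarith
      · rw [h4 hj _ (subset_closure hb)]
        exact (hx' _).1.trans (hx' _).2
    · ext y
      have e : bar (WithLp.toLp 2 (Fin.snoc (α := fun _ => ℝ) (bar x).ofLp y)) = bar x := by
        ext i
        simp [bar]
      rw [mem_ofPred_eq, h2, mem_ofPred_eq, e]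
      simp [hb]
  obtain ⟨a, ha, h⟩ := key g hg
  obtain ⟨a', ha', h'⟩ := key g' hg'
  rw [← csSup_Ioo ha, ← csSup_Ioo ha', ← h, ← h']

/-- The atlas distance does not depend on the choice of the describing functions. -/
theorem dist_eq {A : Atlas d} {Ω₁ Ω₂ : Set (Eucl (d + 1))} {g₁ g₂ : Fin A.s → Eucl d → ℝ}
    (h₁ : A.IsGraphFamily Ω₁ g₁) (h₂ : A.IsGraphFamily Ω₂ g₂) :
    A.dist Ω₁ Ω₂ = ⨆ j : Fin A.s, ⨆ x : (A.r j '' A.V j : Set (Eucl (d + 1))),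
      |g₁ j (bar x.1) - g₂ j (bar x.1)| := by
  unfold dist
  congr 1; funext j; congr 1; funext x
  rw [(A.graphFun_spec ⟨_, h₁⟩).eq h₁ j x.2, (A.graphFun_spec ⟨_, h₂⟩).eq h₂ j x.2]

end Atlas

/-! ### Sobolev spaces

An element of `H¹(Ω)` is represented by the pair `(w, ∇w)` of the function and its weak gradient,
so that the topology of `H¹(Ω)` is the product topology of `L²(Ω) × L²(Ω)^N`. -/

/-- The real space `L²(Ω)`. -/
abbrev L2 {N : ℕ} (Ω : Set (Eucl N)) : Type := Lp ℝ 2 ((volume : Measure (Eucl N)).restrict Ω)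

/-- The space `L²(Ω) × L²(Ω)^N`. -/
abbrev L2Pair {N : ℕ} (Ω : Set (Eucl N)) : Type := L2 Ω × (Fin N → L2 Ω)

/-- The partial derivative `∂φ/∂x_i`. -/
def partialDeriv {N : ℕ} (i : Fin N) (φ : Eucl N → ℝ) (x : Eucl N) : ℝ :=
  fderiv ℝ φ x (EuclideanSpace.single i 1)

/-- `φ ∈ C_c^∞(Ω)`. -/
structure IsTest {N : ℕ} (Ω : Set (Eucl N)) (φ : Eucl N → ℝ) : Prop where
  smooth : ContDiff ℝ ∞ φ
  compact : HasCompactSupport φ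
  support : tsupport φ ⊆ Ω

/-- `G` is the weak gradient of `w` in `Ω`, for `p = (w, G)`. -/
def IsWeakGradient {N : ℕ} {Ω : Set (Eucl N)} (p : L2Pair Ω) : Prop :=
  ∀ φ, IsTest Ω φ → ∀ i,
    ∫ x in Ω, p.1 x * partialDeriv i φ x = -∫ x in Ω, p.2 i x * φ x

/-- The pair `(φ, ∇φ)` comes from a test function `φ ∈ C_c^∞(Ω)`. -/
def IsTestPair {N : ℕ} {Ω : Set (Eucl N)} (p : L2Pair Ω) : Prop :=
  ∃ φ, IsTest Ω φ ∧ p.1 =ᵐ[volume.restrict Ω] φ ∧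
    ∀ i, p.2 i =ᵐ[volume.restrict Ω] partialDeriv i φ

/-- `H¹₀(Ω)`: the closure of `C_c^∞(Ω)` for the norm of `H¹(Ω)`. Its elements are pairs
`(w, ∇w)` with `w ∈ H¹(Ω)`, see `isWeakGradient_of_mem_H10`. -/
def H10 {N : ℕ} (Ω : Set (Eucl N)) : Submodule ℝ (L2Pair Ω) :=
  (Submodule.span ℝ {p | IsTestPair p}).topologicalClosure

theorem IsTest.continuous_partialDeriv {N : ℕ} {Ω : Set (Eucl N)} {φ : Eucl N → ℝ}
    (h : IsTest Ω φ) (i : Fin N) : Continuous (partialDeriv i φ) :=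
  (h.smooth.continuous_fderiv (by simp)).clm_apply continuous_const

theorem IsTest.hasCompactSupport_partialDeriv {N : ℕ} {Ω : Set (Eucl N)} {φ : Eucl N → ℝ}
    (h : IsTest Ω φ) (i : Fin N) : HasCompactSupport (partialDeriv i φ) :=
  h.compact.fderiv_apply (𝕜 := ℝ) _

theorem isWeakGradient_of_isTestPair {N : ℕ} {Ω : Set (Eucl N)} {p : L2Pair Ω}
    (hp : IsTestPair p) : IsWeakGradient p := by
  obtain ⟨ψ, hψ, h1, h2⟩ := hp
  intro φ hφ i
  have e1 : ∫ x in Ω, p.1 x * partialDeriv i φ x = ∫ x in Ω, ψ x * partialDeriv i φ x :=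
    integral_congr_ae (by filter_upwards [h1] with x hx; rw [hx])
  have e2 : ∫ x in Ω, p.2 i x * φ x = ∫ x in Ω, partialDeriv i ψ x * φ x :=
    integral_congr_ae (by filter_upwards [h2 i] with x hx; rw [hx])
  have s1 : Function.support (fun x => ψ x * partialDeriv i φ x) ⊆ Ω := fun x hx =>
    hψ.support (subset_tsupport _ (left_ne_zero_of_mul hx))
  have s2 : Function.support (fun x => partialDeriv i ψ x * φ x) ⊆ Ω := fun x hx =>
    hφ.support (subset_tsupport _ (right_ne_zero_of_mul hx))
  rw [e1, e2, setIntegral_eq_integral_of_forall_compl_eq_zero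
      (fun x hx => by_contra fun h => hx (s1 h)),
    setIntegral_eq_integral_of_forall_compl_eq_zero (fun x hx => by_contra fun h => hx (s2 h))]
  have i1 : Integrable (fun x => ψ x * partialDeriv i φ x) :=
    (hψ.smooth.continuous.mul (hφ.continuous_partialDeriv i)).integrable_of_hasCompactSupport
      hψ.compact.mul_right
  have i2 : Integrable (fun x => partialDeriv i ψ x * φ x) :=
    ((hψ.continuous_partialDeriv i).mul hφ.smooth.continuous).integrable_of_hasCompactSupport
      hφ.compact.mul_left
  have i3 : Integrable (fun x => ψ x * φ x) :=
    (hψ.smooth.continuous.mul hφ.smooth.continuous).integrable_of_hasCompactSupport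
      hψ.compact.mul_right
  exact integral_mul_fderiv_eq_neg_fderiv_mul_of_integrable i2 i1 i3
    (fun x _ => hψ.smooth.differentiable (by simp) x)
    (fun x _ => hφ.smooth.differentiable (by simp) x)

/-- The second component of an element of `H¹₀(Ω)` is the weak gradient of the first one. -/
theorem isWeakGradient_of_mem_H10 {N : ℕ} {Ω : Set (Eucl N)} {p : L2Pair Ω} (hp : p ∈ H10 Ω) :
    IsWeakGradient p := by
  intro φ hφ i
  have m0 : MemLp φ 2 (volume.restrict Ω) :=
    (hφ.smooth.continuous.memLp_of_hasCompactSupport hφ.compact).restrict Ω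
  have m1 : MemLp (partialDeriv i φ) 2 (volume.restrict Ω) :=
    ((hφ.continuous_partialDeriv i).memLp_of_hasCompactSupport
      (hφ.hasCompactSupport_partialDeriv i)).restrict Ω
  let L : L2Pair Ω →L[ℝ] ℝ :=
    (innerSL ℝ m1.toLp).comp (ContinuousLinearMap.fst ℝ _ _) +
      (innerSL ℝ m0.toLp).comp
        ((ContinuousLinearMap.proj i).comp (ContinuousLinearMap.snd ℝ _ _))
  have hL : ∀ q : L2Pair Ω,
      L q = (∫ x in Ω, q.1 x * partialDeriv i φ x) + ∫ x in Ω, q.2 i x * φ x := by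
    intro q
    change inner ℝ m1.toLp q.1 + inner ℝ m0.toLp (q.2 i) = _
    rw [L2.inner_def, L2.inner_def]
    congr 1
    · refine integral_congr_ae ?_
      filter_upwards [m1.coeFn_toLp] with x hx
      simp [hx]
    · refine integral_congr_ae ?_
      filter_upwards [m0.coeFn_toLp] with x hx
      simp [hx]
  have hle : H10 Ω ≤ LinearMap.ker (L : L2Pair Ω →ₗ[ℝ] ℝ) := by
    refine Submodule.topologicalClosure_minimal _ (Submodule.span_le.2 ?_) L.isClosed_ker
    intro q hq
    have := isWeakGradient_of_isTestPair hq φ hφ i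
    change L q = 0
    rw [hL, this]
    ring
  have h0 : L p = 0 := hle hp
  rw [hL] at h0
  linarith

/-! ### The Reissner–Mindlin eigenvalue problem -/

/-- The ambient space of the elements `(β, w)`: the components `β_1, …, β_N` of `β`, and `w`,
each one together with its gradient. For `u = (β, w)`, the entries are `β_i = (u.1 i).1`,
`∂β_i/∂x_j = (u.1 i).2 j`, `w = u.2.1`, `∂w/∂x_j = u.2.2 j`. -/
abbrev State {N : ℕ} (Ω : Set (Eucl N)) : Type := (Fin N → L2Pair Ω) × L2Pair Ω

/-- The energy space `𝒱(Ω) = H¹₀(Ω)^N × H¹₀(Ω)`. -/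
def energySpace {N : ℕ} (Ω : Set (Eucl N)) : Submodule ℝ (State Ω) :=
  (Submodule.pi univ fun _ => H10 Ω).prod (H10 Ω)

/-- The bilinear form `Q_{Ω,t}((β, w), (η, v)) = μ/12 ∫ ∇β : ∇η + (μ+λ)/12 ∫ div β div η
+ μk/t² ∫ (∇w - β)·(∇v - η)`, written with the scalar product of `L²(Ω)`. -/
def form {N : ℕ} {Ω : Set (Eucl N)} (lam μ k t : ℝ) (u v : State Ω) : ℝ :=
  μ / 12 * ∑ i, ∑ j, inner ℝ ((u.1 i).2 j) ((v.1 i).2 j)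
  + (μ + lam) / 12 * inner ℝ (∑ i, (u.1 i).2 i) (∑ i, (v.1 i).2 i)
  + μ * k / t ^ 2 * ∑ i, inner ℝ (u.2.2 i - (u.1 i).1) (v.2.2 i - (v.1 i).1)

/-- The scalar product `⟨(β, w), (η, v)⟩_{Ω,t} = ∫ (w v + t²/12 β·η)`. -/
def massForm {N : ℕ} {Ω : Set (Eucl N)} (t : ℝ) (u v : State Ω) : ℝ :=
  inner ℝ u.2.1 v.2.1 + t ^ 2 / 12 * ∑ i, inner ℝ (u.1 i).1 (v.1 i).1

/-- `u = (β, w)` is an eigenvector associated with the eigenvalue `γ`. -/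
def IsEigenvector {N : ℕ} {Ω : Set (Eucl N)} (lam μ k t γ : ℝ) (u : State Ω) : Prop :=
  u ∈ energySpace Ω ∧ u ≠ 0 ∧
    ∀ v ∈ energySpace Ω, form lam μ k t u v = γ * massForm t u v

/-- The `n`-th eigenvalue `γ_{n,t}[Ω]` (`n = 1, 2, …`), eigenvalues being arranged in
non-decreasing order and repeated according to multiplicity: the least `Λ` such that the
eigenvectors with eigenvalue at most `Λ` span a space of dimension at least `n`. -/
def eigenvalue {N : ℕ} (lam μ k : ℝ) (n : ℕ) (t : ℝ) (Ω : Set (Eucl N)) : ℝ :=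
  sInf {Λ : ℝ | (n : Cardinal) ≤
    Module.rank ℝ (Submodule.span ℝ {u : State Ω | ∃ γ ≤ Λ, IsEigenvector lam μ k t γ u})}

end ReissnerMindlin

end

/-!
The eigenvalues are compared through the min-max principle. The idea is to transplant functions
from `Ω₁` to `Ω₂` by a diffeomorphism `S` of the whole space with `S = id + ε Ψ`, where `ε` is any
number above the atlas distance.

*Geometry.* `Ψ` is the sum of the vertical directions of the charts, cut off near the boundaries of
the cuboids `V_j`; it depends on the atlas only. A point `y` with `S y ∈ Ω₁` arises from `S y` by
moving downwards in the charts, which does not leave `Ω₁`, and in one chart it moves downwards by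
`ε`, which is more than the distance of the two graphs. Hence `y ∈ Ω₂` (`Atlas.exists_field`), and
composition with `S` maps functions supported in `Ω₁` to functions supported in `Ω₂`.

*Energy.* The displacement is transplanted as `w ∘ S`, and the rotation is pulled back as a
differential form, that is by `(DS)ᵀ (β ∘ S)`. Then `∇w - β` is pulled back as a differential form
as well, so that the shear energy changes by a factor `1 + O(ε)` whatever its coefficient
`μ k / t²` is; this is why the constant does not depend on `k` and `t`. The remaining error terms
are multiples of `ε ∫ (|∇β|² + |β|²)` and are absorbed in the energy by the Poincaré inequality.
Energy and mass of test functions therefore change at most by factors `1 ± C ε`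
(`exists_transplant_bound`), and this extends to the energy space by density.

*Spectrum.* The energy and the mass are squared norms of images under bounded operators `J` and `K`
into Hilbert spaces, where `J` is bounded from below and `K` is compact by Rellich's theorem
(`isCompactOperator_embL2`, proved by piecewise constant approximation on a fine grid). On the span
of the eigenvectors on `Ω₁` with eigenvalues at most `Λ` the Rayleigh quotient is at most `Λ`, and
on its image at most `(1 + C ε) / (1 - C ε) Λ`. By the spectral theorem for compact operators, the
eigenvectors on `Ω₂` up to that level span a space of at least the same dimension
(`le_rank_span_eigenvectorSet_of_map`). This gives one half of the estimate, the other half follows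
by exchanging `Ω₁` and `Ω₂`, and `ε` may then tend to the atlas distance.
-/

noncomputable section

namespace ReissnerMindlin

/-! ### Variational comparison of eigenvalues in Hilbert space -/

section Spectral

variable {H G : Type*} [NormedAddCommGroup H] [InnerProductSpace ℝ H] [CompleteSpace H]
  [NormedAddCommGroup G] [InnerProductSpace ℝ G] [CompleteSpace G]

open ContinuousLinearMap in
/-- The norm of a non-zero compact positive operator is an eigenvalue. -/
theorem hasEigenvalue_norm_of_isPositive {T : H →L[ℝ] H} (hT : IsCompactOperator T)
    (hpos : T.IsPositive) (h0 : T ≠ 0) :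
    Module.End.HasEigenvalue (T : Module.End ℝ H) ‖T‖ := by
  have hn : ‖T‖ ≠ 0 := by simpa using h0
  have : Nontrivial H := by
    by_contra h
    rw [not_nontrivial_iff_subsingleton] at h
    exact h0 (Subsingleton.elim _ _)
  rw [hT.hasEigenvalue_iff_mem_spectrum hn]
  by_contra h
  obtain ⟨ε, hε, hr⟩ := T.rayleighQuotient_le_of_norm_mem_resolventSet (𝕜 := ℝ)
    (by simpa [spectrum] using h)
  have hsup : ‖T‖ = ⨆ x, |T.rayleighQuotient x| := norm_eq_iSup_rayleighQuotient T hpos.isSymmetric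
  have : (⨆ x, |T.rayleighQuotient x|) ≤ ‖T‖ - ε := by
    refine ciSup_le fun x => ?_
    rw [abs_of_nonneg]
    · exact hr x
    · exact div_nonneg (hpos.re_inner_nonneg_left x) (by positivity)
  linarith

/-- For a compact operator `K`, a subspace on which `‖x‖² ≤ Λ ‖K x‖²` has at most the dimension
of the span of the eigenvectors of `⟨x, y⟩ = γ ⟨K x, K y⟩` with `γ ≤ Λ`: otherwise the subspace
would contain a non-zero vector orthogonal to all of these eigenvectors, and the largest
eigenvalue of the positive operator `K† K` on their orthogonal complement would give one more. -/
theorem le_rank_span_eigenvectors {K : H →L[ℝ] G} (hK : IsCompactOperator K)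
    {L : Submodule ℝ H} {Λ : ℝ} (hL : ∀ x ∈ L, ‖x‖ ^ 2 ≤ Λ * ‖K x‖ ^ 2) {n : ℕ}
    (hn : (n : Cardinal) ≤ Module.rank ℝ L) :
    (n : Cardinal) ≤ Module.rank ℝ (Submodule.span ℝ
      {x : H | x ≠ 0 ∧ ∃ γ ≤ Λ, ∀ y, inner ℝ x y = γ * inner ℝ (K x) (K y)}) := by
  set E := Submodule.span ℝ
      {x : H | x ≠ 0 ∧ ∃ γ ≤ Λ, ∀ y, inner ℝ x y = γ * inner ℝ (K x) (K y)} with hE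
  by_contra! hlt
  have hfin : FiniteDimensional ℝ E :=
    Module.rank_lt_aleph0_iff.1 (hlt.trans (Cardinal.natCast_lt_aleph0))
  -- a non-zero vector of `L` orthogonal to `E`
  obtain ⟨v, hvL, hvE, hv0⟩ : ∃ v ∈ L, v ∈ Eᗮ ∧ v ≠ 0 := by
    let P : L →ₗ[ℝ] E := (E.orthogonalProjectionOnto : H →ₗ[ℝ] E) ∘ₗ L.subtype
    have : ¬ Function.Injective P := fun h =>
      absurd (LinearMap.rank_le_of_injective P h) (not_le.2 (hlt.trans_le hn))
    rw [← LinearMap.ker_eq_bot, Submodule.eq_bot_iff] at this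
    push Not at this
    obtain ⟨x, hx, hx0⟩ := this
    refine ⟨x, x.2, ?_, by simpa using hx0⟩
    exact Submodule.orthogonalProjectionOnto_eq_zero_iff.1 hx
  let T : H →L[ℝ] H := (ContinuousLinearMap.adjoint K).comp K
  have hTi : ∀ x y, inner ℝ (T x) y = inner ℝ (K x) (K y) := fun x y =>
    ContinuousLinearMap.adjoint_inner_left K y (K x)
  have hTi' : ∀ x y, inner ℝ x (T y) = inner ℝ (K x) (K y) := fun x y =>
    ContinuousLinearMap.adjoint_inner_right K x (K y)
  have hTc : IsCompactOperator T := hK.clm_comp (ContinuousLinearMap.adjoint K)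
  -- the orthogonal complement of `E` is invariant under `T`
  have hinv : ∀ x ∈ Eᗮ, T x ∈ Eᗮ := by
    intro x hx
    rw [Submodule.mem_orthogonal] at hx ⊢
    intro u hu
    induction hu using Submodule.span_induction with
    | mem u hu =>
      obtain ⟨hu0, γ, hγ, h⟩ := hu
      have h1 := h x
      rw [hx u (Submodule.subset_span ⟨hu0, γ, hγ, h⟩)] at h1
      have hγ0 : γ ≠ 0 := by
        rintro rfl
        have := h u
        rw [zero_mul, inner_self_eq_zero] at this
        exact hu0 this
      rw [hTi']
      exact (mul_eq_zero.1 h1.symm).resolve_left hγ0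
    | zero => simp
    | add a b _ _ ha hb => rw [inner_add_left, ha, hb, add_zero]
    | smul c a _ ha => rw [inner_smul_left, ha, mul_zero]
  let S : Eᗮ →L[ℝ] Eᗮ := T.restrict hinv
  have hSc : IsCompactOperator S := hTc.restrict' hinv
  have hSi : ∀ x y : Eᗮ, inner ℝ (S x) y = inner ℝ (K x) (K y) := fun x y => hTi x y
  have hSpos : S.IsPositive := by
    refine ⟨fun x y => ?_, fun x => ?_⟩
    · change inner ℝ (S x) y = inner ℝ x (S y)
      rw [hSi, real_inner_comm, real_inner_comm (S y), hSi]
    · change 0 ≤ inner ℝ (S x) x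
      rw [hSi]
      exact real_inner_self_nonneg
  have hvpos : 0 < ‖v‖ ^ 2 := by positivity
  have hKv : 0 < ‖K v‖ ^ 2 := by
    rcases (sq_nonneg ‖K v‖).eq_or_lt with h | h
    · have := hL v hvL
      rw [← h] at this
      linarith
    · exact h
  have hΛ : 0 < Λ := by
    by_contra! h
    have := hL v hvL
    nlinarith
  have hSv : ‖K v‖ ^ 2 ≤ ‖S‖ * ‖v‖ ^ 2 := by
    have h1 := hSi ⟨v, hvE⟩ ⟨v, hvE⟩
    rw [real_inner_self_eq_norm_sq] at h1
    rw [← h1, pow_two, ← mul_assoc]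
    exact (real_inner_le_norm _ _).trans
      (mul_le_mul_of_nonneg_right (S.le_opNorm ⟨v, hvE⟩) (norm_nonneg _))
  have hSΛ : 1 ≤ Λ * ‖S‖ := by
    have h2 : ‖v‖ ^ 2 ≤ Λ * ‖S‖ * ‖v‖ ^ 2 := by
      rw [mul_assoc]
      exact (hL v hvL).trans (mul_le_mul_of_nonneg_left hSv hΛ.le)
    nlinarith
  have hS0 : 0 < ‖S‖ := by
    by_contra! h
    nlinarith [norm_nonneg S]
  obtain ⟨x, hx⟩ := (hasEigenvalue_norm_of_isPositive hSc hSpos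
    (norm_pos_iff.1 hS0)).exists_hasEigenvector
  have hSx : S x = ‖S‖ • x := hx.apply_eq_smul
  have hTx : T (x : H) = ‖S‖ • (x : H) := congrArg Subtype.val hSx
  have hxE : (x : H) ∈ E := by
    refine Submodule.subset_span ⟨by simpa using hx.2, ‖S‖⁻¹, ?_, fun y => ?_⟩
    · rw [inv_le_iff_one_le_mul₀ hS0]
      exact hSΛ
    · rw [← hTi, hTx, inner_smul_left]
      simp [hS0.ne']
  have h0 : inner ℝ (x : H) (x : H) = 0 := Submodule.inner_right_of_mem_orthogonal hxE x.2
  exact hx.2 (by simpa using h0)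

end Spectral

section Comparison

universe u

variable {V H : Type u} {G : Type*} [NormedAddCommGroup V] [NormedSpace ℝ V]
  [NormedAddCommGroup H] [InnerProductSpace ℝ H] [NormedAddCommGroup G] [InnerProductSpace ℝ G]

/-- The eigenvectors with eigenvalue at most `Λ` of the problem `⟨J u, J v⟩ = γ ⟨K u, K v⟩`. -/
def eigenvectorSet (J : V →L[ℝ] H) (K : V →L[ℝ] G) (Λ : ℝ) : Set V :=
  {u | u ≠ 0 ∧ ∃ γ ≤ Λ, ∀ v, inner ℝ (J u) (J v) = γ * inner ℝ (K u) (K v)}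

/-- On the span of the eigenvectors with eigenvalue at most `Λ`, the Rayleigh quotient is at
most `Λ`. -/
theorem norm_sq_le_of_mem_span_eigenvectorSet {J : V →L[ℝ] H} {K : V →L[ℝ] G} {Λ : ℝ} {u : V}
    (hu : u ∈ Submodule.span ℝ (eigenvectorSet J K Λ)) :
    ‖J u‖ ^ 2 ≤ Λ * ‖K u‖ ^ 2 := by
  let S : {γ : ℝ // γ ≤ Λ} → Submodule ℝ V := fun γ =>
    { carrier := {u | ∀ v, inner ℝ (J u) (J v) = γ.1 * inner ℝ (K u) (K v)}
      add_mem' := by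
        intro a b ha hb v
        rw [map_add, map_add, inner_add_left, inner_add_left, ha v, hb v, mul_add]
      zero_mem' := by intro v; simp
      smul_mem' := by
        intro c a ha v
        rw [map_smul, map_smul, inner_smul_left, inner_smul_left, ha v]
        simp only [conj_trivial]
        ring }
  have hle : Submodule.span ℝ (eigenvectorSet J K Λ) ≤ ⨆ γ, S γ := by
    refine Submodule.span_le.2 ?_
    rintro u ⟨-, γ, hγ, h⟩
    exact Submodule.mem_iSup_of_mem ⟨γ, hγ⟩ h
  obtain ⟨f, hf, rfl⟩ := (Submodule.mem_iSup_iff_exists_finsupp _ _).1 (hle hu)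
  -- eigenvectors with distinct eigenvalues are orthogonal for both forms
  have hK : ∀ γ γ', γ ≠ γ' → inner ℝ (K (f γ)) (K (f γ')) = 0 := by
    intro γ γ' hne
    have h1 := hf γ (f γ')
    have h2 := hf γ' (f γ)
    rw [real_inner_comm, real_inner_comm (K (f γ))] at h2
    have h3 : (γ.1 - γ'.1) * inner ℝ (K (f γ)) (K (f γ')) = 0 := by linarith
    exact (mul_eq_zero.1 h3).resolve_left (sub_ne_zero.2 fun h => hne (Subtype.ext h))
  have hJ : ∀ γ γ', γ ≠ γ' → inner ℝ (J (f γ)) (J (f γ')) = 0 := by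
    intro γ γ' hne
    rw [hf γ (f γ'), hK γ γ' hne, mul_zero]
  have e1 : ‖J (f.sum fun _ x => x)‖ ^ 2 = ∑ γ ∈ f.support, ‖J (f γ)‖ ^ 2 := by
    rw [← real_inner_self_eq_norm_sq, Finsupp.sum, map_sum, sum_inner]
    refine Finset.sum_congr rfl fun γ hγ => ?_
    rw [inner_sum, Finset.sum_eq_single_of_mem γ hγ fun γ' _ h => hJ _ _ h.symm,
      real_inner_self_eq_norm_sq]
  have e2 : ‖K (f.sum fun _ x => x)‖ ^ 2 = ∑ γ ∈ f.support, ‖K (f γ)‖ ^ 2 := by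
    rw [← real_inner_self_eq_norm_sq, Finsupp.sum, map_sum, sum_inner]
    refine Finset.sum_congr rfl fun γ hγ => ?_
    rw [inner_sum, Finset.sum_eq_single_of_mem γ hγ fun γ' _ h => hK _ _ h.symm,
      real_inner_self_eq_norm_sq]
  rw [e1, e2, Finset.mul_sum]
  refine Finset.sum_le_sum fun γ _ => ?_
  have h := hf γ (f γ)
  rw [real_inner_self_eq_norm_sq, real_inner_self_eq_norm_sq] at h
  rw [h]
  exact mul_le_mul_of_nonneg_right γ.2 (sq_nonneg _)

/-- The half of the min-max principle that rests on compactness, for the forms `⟨J u, J v⟩`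
(coercive) and `⟨K u, K v⟩` (compact). -/
theorem le_rank_span_eigenvectorSet [CompleteSpace V] [CompleteSpace H] [CompleteSpace G]
    {J : V →L[ℝ] H} {K : V →L[ℝ] G} {C : NNReal} (hJ : AntilipschitzWith C J)
    (hK : IsCompactOperator K) {L : Submodule ℝ V} {Λ : ℝ}
    (hL : ∀ u ∈ L, ‖J u‖ ^ 2 ≤ Λ * ‖K u‖ ^ 2) {n : ℕ} (hn : (n : Cardinal) ≤ Module.rank ℝ L) :
    (n : Cardinal) ≤ Module.rank ℝ (Submodule.span ℝ (eigenvectorSet J K Λ)) := by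
  have hcl : IsClosed (Set.range J) := hJ.isClosed_range J.uniformContinuous
  let e := J.equivRange hJ.injective hcl
  have he : ∀ u, ((e u : LinearMap.range J.toLinearMap) : H) = J u := fun u => rfl
  have : CompleteSpace (LinearMap.range J.toLinearMap) := by
    refine IsComplete.completeSpace_coe (IsClosed.isComplete ?_)
    rw [LinearMap.coe_range]
    exact hcl
  let K' : LinearMap.range J.toLinearMap →L[ℝ] G :=
    K.comp (e.symm : LinearMap.range J.toLinearMap →L[ℝ] V)
  have hK' : IsCompactOperator K' :=
    hK.comp_clm (e.symm : LinearMap.range J.toLinearMap →L[ℝ] V)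
  have h1 := le_rank_span_eigenvectors hK' (L := L.map (e.toLinearEquiv : V →ₗ[ℝ] _))
    (Λ := Λ) (n := n) ?_ ?_
  · have h2 : Submodule.span ℝ {x : LinearMap.range J.toLinearMap |
        x ≠ 0 ∧ ∃ γ ≤ Λ, ∀ y, inner ℝ x y = γ * inner ℝ (K' x) (K' y)} ≤
        (Submodule.span ℝ (eigenvectorSet J K Λ)).map (e.toLinearEquiv : V →ₗ[ℝ] _) := by
      refine Submodule.span_le.2 ?_
      rintro x ⟨hx, γ, hγ, h⟩
      refine ⟨e.symm x, Submodule.subset_span ⟨by simpa using hx, γ, hγ, fun v => ?_⟩, by simp⟩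
      have h3 := h (e v)
      rw [Submodule.coe_inner, he] at h3
      rw [← he (e.symm x)]
      simpa [K'] using h3
    refine h1.trans ((Submodule.rank_mono h2).trans ?_)
    exact rank_map_le _ _
  · rintro _ ⟨u, hu, rfl⟩
    have := hL u hu
    simpa [K', Submodule.coe_norm, he] using this
  · exact hn.trans (e.toLinearEquiv.submoduleMap L).rank_eq.le

variable {V₂ H₂ : Type u} {G₂ : Type*} [NormedAddCommGroup V₂] [NormedSpace ℝ V₂] [CompleteSpace V₂]
  [NormedAddCommGroup H₂] [InnerProductSpace ℝ H₂] [CompleteSpace H₂]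
  [NormedAddCommGroup G₂] [InnerProductSpace ℝ G₂] [CompleteSpace G₂]

/-- A linear map that multiplies the energy by at most `a` and the mass by at least `b`
transplants eigenvalue counts from level `Λ` to level `a Λ / b`. -/
theorem le_rank_span_eigenvectorSet_of_map {J : V →L[ℝ] H} {K : V →L[ℝ] G}
    (hJi : Function.Injective J) {J₂ : V₂ →L[ℝ] H₂} {K₂ : V₂ →L[ℝ] G₂}
    {C : NNReal} (hJ : AntilipschitzWith C J₂) (hK : IsCompactOperator K₂)
    (Φ : V →ₗ[ℝ] V₂) {a b : ℝ} (ha : 0 < a) (hb : 0 < b)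
    (hΦJ : ∀ u, ‖J₂ (Φ u)‖ ^ 2 ≤ a * ‖J u‖ ^ 2) (hΦK : ∀ u, b * ‖K u‖ ^ 2 ≤ ‖K₂ (Φ u)‖ ^ 2)
    {Λ : ℝ} (hΛ : 0 < Λ) {n : ℕ}
    (hn : (n : Cardinal) ≤ Module.rank ℝ (Submodule.span ℝ (eigenvectorSet J K Λ))) :
    (n : Cardinal) ≤ Module.rank ℝ (Submodule.span ℝ (eigenvectorSet J₂ K₂ (a / b * Λ))) := by
  set L := Submodule.span ℝ (eigenvectorSet J K Λ)
  have hinj : Function.Injective (Φ ∘ₗ L.subtype) := by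
    rw [← LinearMap.ker_eq_bot, Submodule.eq_bot_iff]
    intro u hu
    have h0 : Φ u = 0 := hu
    have h1 := norm_sq_le_of_mem_span_eigenvectorSet u.2
    have h2 := hΦK u
    rw [h0, map_zero, norm_zero] at h2
    have h3 : ‖K u‖ ^ 2 ≤ 0 := by
      by_contra! h
      nlinarith [mul_pos hb h]
    have h4 : ‖J u‖ ^ 2 ≤ 0 := h1.trans (mul_nonpos_of_nonneg_of_nonpos hΛ.le h3)
    have h5 : J u = 0 := by
      rw [← norm_eq_zero]
      exact pow_eq_zero_iff (two_ne_zero) |>.1 (le_antisymm h4 (sq_nonneg _))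
    exact Subtype.ext (hJi (by rw [h5]; simp))
  refine le_rank_span_eigenvectorSet hJ hK (L := L.map Φ) ?_ ?_
  · rintro _ ⟨u, hu, rfl⟩
    have h1 := norm_sq_le_of_mem_span_eigenvectorSet hu
    calc ‖J₂ (Φ u)‖ ^ 2 ≤ a * ‖J u‖ ^ 2 := hΦJ u
      _ ≤ a * (Λ * ‖K u‖ ^ 2) := by gcongr
      _ = a / b * Λ * (b * ‖K u‖ ^ 2) := by field_simp
      _ ≤ a / b * Λ * ‖K₂ (Φ u)‖ ^ 2 := by
        have := hΦK u
        gcongr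
  · have h := LinearMap.rank_le_of_injective ((Φ ∘ₗ L.subtype).codRestrict (L.map Φ)
      fun u => ⟨u, u.2, rfl⟩) fun u v h => hinj (congrArg Subtype.val h)
    exact hn.trans h

end Comparison

/-! ### Test functions and their images in the energy space -/

section TestFunctions

variable {N : ℕ} {Ω : Set (Eucl N)}

/-- The space `C_c(Ω)` of continuous functions with compact support in `Ω`. -/
def CcFun (Ω : Set (Eucl N)) : Submodule ℝ (Eucl N → ℝ) where
  carrier := {f | Continuous f ∧ HasCompactSupport f ∧ tsupport f ⊆ Ω}
  add_mem' := fun ⟨a1, a2, a3⟩ ⟨b1, b2, b3⟩ =>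
    ⟨a1.add b1, a2.add b2, (tsupport_add _ _).trans (union_subset a3 b3)⟩
  zero_mem' := ⟨continuous_zero, HasCompactSupport.zero, by simp [tsupport]⟩
  smul_mem' := fun c f ⟨a1, a2, a3⟩ =>
    ⟨a1.const_smul c, a2.mono (Function.support_const_smul_subset c f),
      (closure_mono (Function.support_const_smul_subset c f)).trans a3⟩

/-- The space `C_c^∞(Ω)` of test functions. -/
def TestFun (Ω : Set (Eucl N)) : Submodule ℝ (Eucl N → ℝ) where
  carrier := {f | IsTest Ω f}
  add_mem' := fun a b =>
    ⟨a.smooth.add b.smooth, a.compact.add b.compact,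
      (tsupport_add _ _).trans (union_subset a.support b.support)⟩
  zero_mem' := ⟨contDiff_const, HasCompactSupport.zero, by simp [tsupport]⟩
  smul_mem' := fun c f a =>
    ⟨contDiff_const.smul a.smooth, a.compact.mono (Function.support_const_smul_subset c f),
      (closure_mono (Function.support_const_smul_subset c f)).trans a.support⟩

theorem IsTest.differentiable {φ : Eucl N → ℝ} (h : IsTest Ω φ) : Differentiable ℝ φ :=
  h.smooth.differentiable (by simp)

/-- The inclusion of `C_c^∞(Ω)` in `C_c(Ω)`. -/
def testToCc (Ω : Set (Eucl N)) : TestFun Ω →ₗ[ℝ] CcFun Ω where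
  toFun φ := ⟨φ, φ.2.smooth.continuous, φ.2.compact, φ.2.support⟩
  map_add' _ _ := rfl
  map_smul' _ _ := rfl

/-- The partial derivative `C_c^∞(Ω) → C_c(Ω)`. -/
def testPartial (Ω : Set (Eucl N)) (i : Fin N) : TestFun Ω →ₗ[ℝ] CcFun Ω where
  toFun φ := ⟨partialDeriv i φ, IsTest.continuous_partialDeriv φ.2 i,
    IsTest.hasCompactSupport_partialDeriv φ.2 i,
    (tsupport_fderiv_apply_subset ℝ (EuclideanSpace.single i 1)).trans φ.2.support⟩
  map_add' φ ψ := by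
    ext x
    have h1 := (IsTest.differentiable φ.2) x
    have h2 := (IsTest.differentiable ψ.2) x
    simp [partialDeriv, fderiv_add h1 h2]
  map_smul' c φ := by
    ext x
    have h1 := (IsTest.differentiable φ.2) x
    simp [partialDeriv, fderiv_const_smul h1]

@[simp] theorem testToCc_apply (φ : TestFun Ω) (x : Eucl N) : (testToCc Ω φ).1 x = φ.1 x := rfl

@[simp] theorem testPartial_apply (i : Fin N) (φ : TestFun Ω) (x : Eucl N) :
    (testPartial Ω i φ).1 x = partialDeriv i φ.1 x := rfl

theorem CcFun.memLp (f : CcFun Ω) : MemLp f.1 2 (volume.restrict Ω) :=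
  (f.2.1.memLp_of_hasCompactSupport f.2.2.1).restrict Ω

theorem CcFun.eq_zero (f : CcFun Ω) {x : Eucl N} (hx : x ∉ Ω) : f.1 x = 0 :=
  image_eq_zero_of_notMem_tsupport fun h => hx (f.2.2.2 h)

theorem CcFun.integrable_mul (f g : CcFun Ω) : Integrable fun x => f.1 x * g.1 x :=
  (f.2.1.mul g.2.1).integrable_of_hasCompactSupport f.2.2.1.mul_right

theorem CcFun.integrable_sq (f : CcFun Ω) : Integrable fun x => f.1 x ^ 2 := by
  simpa only [sq] using CcFun.integrable_mul f f

/-- The map `C_c(Ω) → L²(Ω)`. -/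
def toL2 (Ω : Set (Eucl N)) : CcFun Ω →ₗ[ℝ] L2 Ω where
  toFun f := (CcFun.memLp f).toLp
  map_add' _ _ := rfl
  map_smul' _ _ := rfl

theorem inner_toL2 (f g : CcFun Ω) : inner ℝ (toL2 Ω f) (toL2 Ω g) = ∫ x, f.1 x * g.1 x := by
  have h : ∫ x in Ω, f.1 x * g.1 x = ∫ x, f.1 x * g.1 x :=
    setIntegral_eq_integral_of_forall_compl_eq_zero
      fun x hx => by rw [CcFun.eq_zero f hx, zero_mul]
  rw [L2.inner_def, ← h]
  refine integral_congr_ae ?_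
  filter_upwards [(CcFun.memLp f).coeFn_toLp, (CcFun.memLp g).coeFn_toLp] with x h1 h2
  change inner ℝ ((CcFun.memLp f).toLp _ x) ((CcFun.memLp g).toLp _ x) = _
  rw [h1, h2]
  simp [mul_comm]

theorem norm_sq_toL2 (f : CcFun Ω) : ‖toL2 Ω f‖ ^ 2 = ∫ x, f.1 x ^ 2 := by
  rw [← real_inner_self_eq_norm_sq, inner_toL2]
  simp only [sq]

/-- The map `φ ↦ (φ, ∇φ)` from `C_c^∞(Ω)` to `H¹₀(Ω)`. -/
def testPair (Ω : Set (Eucl N)) : TestFun Ω →ₗ[ℝ] L2Pair Ω :=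
  (toL2 Ω ∘ₗ testToCc Ω).prod (LinearMap.pi fun i => toL2 Ω ∘ₗ testPartial Ω i)

theorem range_testPair :
    (LinearMap.range (testPair Ω) : Set (L2Pair Ω)) = {p | IsTestPair p} := by
  ext p
  constructor
  · rintro ⟨φ, rfl⟩
    exact ⟨φ, φ.2, (CcFun.memLp (testToCc Ω φ)).coeFn_toLp,
      fun i => (CcFun.memLp (testPartial Ω i φ)).coeFn_toLp⟩
  · rintro ⟨φ, hφ, h1, h2⟩
    refine ⟨⟨φ, hφ⟩, ?_⟩
    refine Prod.ext (Lp.ext ?_) (funext fun i => Lp.ext ?_)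
    · exact (CcFun.memLp (testToCc Ω ⟨φ, hφ⟩)).coeFn_toLp.trans h1.symm
    · exact (CcFun.memLp (testPartial Ω i ⟨φ, hφ⟩)).coeFn_toLp.trans (h2 i).symm

theorem coe_H10 : (H10 Ω : Set (L2Pair Ω)) = closure (LinearMap.range (testPair Ω)) := by
  rw [H10, Submodule.topologicalClosure_coe, ← range_testPair, Submodule.span_eq]

/-- Pairs `(β, w)` of test functions. -/
abbrev TestState (Ω : Set (Eucl N)) : Type := (Fin N → TestFun Ω) × TestFun Ω

/-- The map `(β, w) ↦ ((β, ∇β), (w, ∇w))` from test functions to the ambient space. -/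
def testStateAux (Ω : Set (Eucl N)) : TestState Ω →ₗ[ℝ] State Ω :=
  LinearMap.prodMap (LinearMap.pi fun i => testPair Ω ∘ₗ LinearMap.proj i) (testPair Ω)

theorem coe_energySpace :
    (energySpace Ω : Set (State Ω)) = closure (LinearMap.range (testStateAux Ω)) := by
  have h : (LinearMap.range (testStateAux Ω) : Set (State Ω)) =
      (univ.pi fun _ => (LinearMap.range (testPair Ω) : Set (L2Pair Ω))) ×ˢ
        (LinearMap.range (testPair Ω) : Set (L2Pair Ω)) := by
    ext u
    constructor
    · rintro ⟨v, rfl⟩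
      exact ⟨fun i _ => ⟨v.1 i, rfl⟩, ⟨v.2, rfl⟩⟩
    · rintro ⟨h1, h2⟩
      choose f hf using fun i => h1 i (mem_univ i)
      obtain ⟨g, hg⟩ := h2
      exact ⟨(f, g), Prod.ext (funext hf) hg⟩
  rw [h, closure_prod_eq, closure_pi_set, ← coe_H10]
  rfl

/-- The map `(β, w) ↦ ((β, ∇β), (w, ∇w))` from test functions to the energy space. -/
def testState (Ω : Set (Eucl N)) : TestState Ω →ₗ[ℝ] energySpace Ω :=
  (testStateAux Ω).codRestrict (energySpace Ω) fun u => by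
    have : testStateAux Ω u ∈ (energySpace Ω : Set (State Ω)) := by
      rw [coe_energySpace]
      exact subset_closure ⟨u, rfl⟩
    exact this

theorem denseRange_testState : DenseRange (testState Ω) := by
  intro u
  have hu : (u : State Ω) ∈ closure (LinearMap.range (testStateAux Ω) : Set (State Ω)) := by
    rw [← coe_energySpace]
    exact u.2
  rw [closure_subtype]
  convert hu using 2
  ext v
  constructor
  · rintro ⟨_, ⟨w, rfl⟩, rfl⟩
    exact ⟨w, rfl⟩
  · rintro ⟨w, rfl⟩
    exact ⟨_, ⟨w, rfl⟩, rfl⟩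

/-- The Poincaré inequality in a slab `|x_i| ≤ R`, obtained by integrating `x_i ∂_i(φ²)` by
parts. -/
theorem integral_sq_le_of_slab {i : Fin N} {R : ℝ} (hΩ : ∀ x ∈ Ω, |x i| ≤ R) (φ : TestFun Ω) :
    ∫ x, φ.1 x ^ 2 ≤ 4 * R ^ 2 * ∫ x, partialDeriv i φ.1 x ^ 2 := by
  have hφ : IsTest Ω φ.1 := φ.2
  have hd : ∀ x, partialDeriv i (fun y => φ.1 y ^ 2) x = 2 * φ.1 x * partialDeriv i φ.1 x := by
    intro x
    have := (hφ.differentiable x).hasFDerivAt.pow 2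
    unfold partialDeriv
    rw [this.fderiv]
    simp
  have hx : ∀ x : Eucl N, partialDeriv i (fun y : Eucl N => y i) x = 1 := by
    intro x
    have : HasFDerivAt (fun y : Eucl N => y i)
      (EuclideanSpace.proj i : Eucl N →L[ℝ] ℝ) x :=
      (EuclideanSpace.proj i : Eucl N →L[ℝ] ℝ).hasFDerivAt
    unfold partialDeriv
    rw [this.fderiv]
    simp
  have hci : Continuous fun y : Eucl N => y i := by fun_prop
  have hcφ := hφ.smooth.continuous
  have hcd := hφ.continuous_partialDeriv i
  have i1 : Integrable fun x : Eucl N => φ.1 x ^ 2 := (CcFun.integrable_sq (testToCc Ω φ))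
  have i2 : Integrable fun x : Eucl N => partialDeriv i φ.1 x ^ 2 :=
    (CcFun.integrable_sq (testPartial Ω i φ))
  have i3 : Integrable fun x : Eucl N => x i * (2 * φ.1 x * partialDeriv i φ.1 x) :=
    (by fun_prop : Continuous _).integrable_of_hasCompactSupport
      ((hφ.compact.mul_left (f := fun _ => (2 : ℝ))).mul_right.mul_left)
  have i4 : Integrable fun x : Eucl N => x i * φ.1 x ^ 2 := by
    refine (by fun_prop : Continuous _).integrable_of_hasCompactSupport ?_
    simp only [sq]
    exact hφ.compact.mul_left.mul_left
  have key : ∫ x : Eucl N, x i * (2 * φ.1 x * partialDeriv i φ.1 x) = -∫ x, φ.1 x ^ 2 := by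
    have := integral_mul_fderiv_eq_neg_fderiv_mul_of_integrable (μ := (volume : Measure (Eucl N)))
      (f := fun y : Eucl N => y i) (g := fun y => φ.1 y ^ 2) (v := EuclideanSpace.single i 1)
      ?_ ?_ i4 (fun x _ => by fun_prop) (fun x _ => (hφ.differentiable x).pow 2)
    · change ∫ x : Eucl N, x i * partialDeriv i (fun y => φ.1 y ^ 2) x =
        -∫ x : Eucl N, partialDeriv i (fun y : Eucl N => y i) x * φ.1 x ^ 2 at this
      simpa only [hd, hx, one_mul] using this
    · change Integrable fun x : Eucl N => partialDeriv i (fun y : Eucl N => y i) x * φ.1 x ^ 2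
      simpa only [hx, one_mul] using i1
    · change Integrable fun x : Eucl N => x i * partialDeriv i (fun y => φ.1 y ^ 2) x
      simpa only [hd] using i3
  have hle : ∫ x : Eucl N, -(x i * (2 * φ.1 x * partialDeriv i φ.1 x)) ≤
      ∫ x, (1 / 2 * φ.1 x ^ 2 + 2 * R ^ 2 * partialDeriv i φ.1 x ^ 2) := by
    refine integral_mono i3.neg ((i1.const_mul _).add (i2.const_mul _)) fun x => ?_
    by_cases h : x ∈ Ω
    · have h2 : (x i) ^ 2 ≤ R ^ 2 := sq_le_sq' (abs_le.1 (hΩ x h)).1 (abs_le.1 (hΩ x h)).2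
      nlinarith [sq_nonneg (φ.1 x + 2 * (x i * partialDeriv i φ.1 x)),
        mul_le_mul_of_nonneg_right h2 (sq_nonneg (partialDeriv i φ.1 x))]
    · have := (CcFun.eq_zero (testToCc Ω φ)) h
      rw [testToCc_apply] at this
      rw [this]
      simp only [mul_zero, zero_mul, neg_zero]
      positivity
  rw [integral_neg, key, neg_neg, integral_add (i1.const_mul _) (i2.const_mul _),
    integral_const_mul, integral_const_mul] at hle
  linarith

end TestFunctions

/-! ### Compactness of the embedding of `H¹₀` in `L²` -/

section Rellich

/-- Jensen's inequality for the square. -/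
theorem sq_integral_le {α : Type*} [MeasurableSpace α] {μ : Measure α} [IsFiniteMeasure μ]
    {f : α → ℝ} (h1 : Integrable f μ) (h2 : Integrable (fun x => f x ^ 2) μ) :
    (∫ x, f x ∂μ) ^ 2 ≤ μ.real univ * ∫ x, f x ^ 2 ∂μ := by
  set m := μ.real univ
  set I := ∫ x, f x ∂μ
  have hm : 0 ≤ m := measureReal_nonneg
  have e : ∫ x, (m * f x - I) ^ 2 ∂μ = m ^ 2 * ∫ x, f x ^ 2 ∂μ - m * I ^ 2 := by
    have : ∀ x, (m * f x - I) ^ 2 = m ^ 2 * f x ^ 2 - 2 * m * I * f x + I ^ 2 := fun x => by ring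
    have i1 : Integrable (fun x => m ^ 2 * f x ^ 2 - 2 * m * I * f x) μ :=
      (h2.const_mul _).sub (h1.const_mul _)
    simp only [this]
    rw [integral_add i1 (integrable_const _), integral_sub (h2.const_mul _) (h1.const_mul _),
      integral_const_mul, integral_const_mul,
      integral_const]
    change m ^ 2 * ∫ x, f x ^ 2 ∂μ - 2 * m * I * I + m * I ^ 2 = _
    ring
  have h0 : 0 ≤ ∫ x, (m * f x - I) ^ 2 ∂μ := integral_nonneg fun x => sq_nonneg _
  rw [e] at h0
  rcases hm.eq_or_lt with h | h
  · have : μ = 0 := by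
      rw [← Measure.measure_univ_eq_zero]
      exact (measureReal_eq_zero_iff).1 h.symm
    have hI : I = 0 := by simp [I, this]
    rw [hI, ← h]
    simp
  · have : 0 ≤ m * (m * ∫ x, f x ^ 2 ∂μ - I ^ 2) := by linarith
    have := nonneg_of_mul_nonneg_right this h
    linarith

variable {N : ℕ} {Ω : Set (Eucl N)}

theorem fderiv_apply_eq_sum (φ : Eucl N → ℝ) (x z : Eucl N) :
    fderiv ℝ φ x z = ∑ i, z i * partialDeriv i φ x := by
  conv_lhs => rw [← (EuclideanSpace.basisFun (Fin N) ℝ).sum_repr z]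
  simp [partialDeriv]

theorem sq_fderiv_apply_le (φ : Eucl N → ℝ) (x z : Eucl N) :
    (fderiv ℝ φ x z) ^ 2 ≤ ‖z‖ ^ 2 * ∑ i, partialDeriv i φ x ^ 2 := by
  rw [fderiv_apply_eq_sum, EuclideanSpace.real_norm_sq_eq]
  exact Finset.sum_mul_sq_le_sq_mul_sq _ _ _

/-- The square of the norm of the gradient is integrable. -/
theorem integrable_gradSq (φ : TestFun Ω) :
    Integrable fun x => ∑ i, partialDeriv i φ.1 x ^ 2 :=
  integrable_finsetSum _ fun i _ => CcFun.integrable_sq (testPartial Ω i φ)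

/-- Translating a test function by `z` changes it in `L²` by at most `|z| ‖∇φ‖`. -/
theorem lintegral_sq_translate_sub_le (φ : TestFun Ω) (z : Eucl N) :
    ∫⁻ x, ENNReal.ofReal ((φ.1 (x + z) - φ.1 x) ^ 2) ≤
      ENNReal.ofReal (‖z‖ ^ 2 * ∫ x, ∑ i, partialDeriv i φ.1 x ^ 2) := by
  have hφ : IsTest Ω φ.1 := φ.2
  set g : Eucl N → ℝ := fun x => ‖z‖ ^ 2 * ∑ i, partialDeriv i φ.1 x ^ 2 with hg
  have hgc : Continuous g := by
    have := fun i => hφ.continuous_partialDeriv i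
    fun_prop
  have hg0 : ∀ x, 0 ≤ g x := fun x => by positivity
  have hpt : ∀ x, ENNReal.ofReal ((φ.1 (x + z) - φ.1 x) ^ 2) ≤
      ∫⁻ s in Ioc (0 : ℝ) 1, ENNReal.ofReal (g (x + s • z)) := by
    intro x
    have hfc : Continuous fun s : ℝ => fderiv ℝ φ.1 (x + s • z) z := by
      have := hφ.smooth.continuous_fderiv (by simp)
      fun_prop
    have hgc' : Continuous fun s : ℝ => g (x + s • z) := by fun_prop
    have e : φ.1 (x + z) - φ.1 x = ∫ s in Ioc (0 : ℝ) 1, fderiv ℝ φ.1 (x + s • z) z := by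
      rw [← intervalIntegral.integral_of_le zero_le_one]
      have hder : ∀ s : ℝ, HasDerivAt (fun s : ℝ => φ.1 (x + s • z))
          (fderiv ℝ φ.1 (x + s • z) z) s := by
        intro s
        have h1 : HasDerivAt (fun s : ℝ => x + s • z) z s := by
          simpa using ((hasDerivAt_id s).smul_const z).const_add x
        exact (hφ.differentiable _).hasFDerivAt.comp_hasDerivAt s h1
      rw [intervalIntegral.integral_eq_sub_of_hasDerivAt (fun s _ => hder s)
        (hfc.intervalIntegrable _ _)]
      simp
    have hIoc : ∀ f : ℝ → ℝ, Continuous f → Integrable f (volume.restrict (Ioc (0 : ℝ) 1)) :=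
      fun f hf => (hf.integrableOn_Icc).mono_set Ioc_subset_Icc_self
    have hj := sq_integral_le (hIoc _ hfc) (hIoc _ (hfc.pow 2))
    rw [← ofReal_integral_eq_lintegral_ofReal (hIoc _ hgc')
      (Filter.Eventually.of_forall fun s => hg0 _), e]
    refine ENNReal.ofReal_le_ofReal (hj.trans ?_)
    have : (volume.restrict (Ioc (0 : ℝ) 1)).real univ = 1 := by simp
    rw [this, one_mul]
    exact integral_mono (hIoc _ (hfc.pow 2)) (hIoc _ hgc') fun s => sq_fderiv_apply_le _ _ _
  calc ∫⁻ x, ENNReal.ofReal ((φ.1 (x + z) - φ.1 x) ^ 2)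
      ≤ ∫⁻ x, ∫⁻ s in Ioc (0 : ℝ) 1, ENNReal.ofReal (g (x + s • z)) := lintegral_mono hpt
    _ = ∫⁻ s in Ioc (0 : ℝ) 1, ∫⁻ x, ENNReal.ofReal (g (x + s • z)) := by
        refine lintegral_lintegral_swap ?_
        have : Continuous fun p : Eucl N × ℝ => g (p.1 + p.2 • z) := by fun_prop
        exact (ENNReal.continuous_ofReal.comp this).measurable.aemeasurable
    _ = ∫⁻ s in Ioc (0 : ℝ) 1, ∫⁻ x, ENNReal.ofReal (g x) := by
        refine lintegral_congr fun s => ?_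
        exact lintegral_add_right_eq_self (fun x => ENNReal.ofReal (g x)) (s • z)
    _ = ∫⁻ x, ENNReal.ofReal (g x) := by simp
    _ = _ := by
        rw [← ofReal_integral_eq_lintegral_ofReal ((integrable_gradSq φ).const_mul _)
          (Filter.Eventually.of_forall hg0), integral_const_mul]

/-- The index of the cell of the grid of size `h` that contains `x`. -/
def cellIndex (h : ℝ) (x : Eucl N) (i : Fin N) : ℤ := ⌊x i / h⌋

/-- The half-open cube `∏ [k_i h, (k_i + 1) h[`. -/
def cell (h : ℝ) (k : Fin N → ℤ) : Set (Eucl N) := {x | cellIndex h x = k}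

theorem cell_eq {h : ℝ} (hh : 0 < h) (k : Fin N → ℤ) :
    cell h k = (fun x : Eucl N => x.ofLp) ⁻¹'
      (univ.pi fun i => Ico (k i * h : ℝ) ((k i + 1) * h)) := by
  ext x
  simp only [cell, cellIndex, mem_ofPred_eq, funext_iff, Int.floor_eq_iff, mem_preimage, mem_pi,
    mem_univ, true_imp_iff, mem_Ico, le_div_iff₀ hh, div_lt_iff₀ hh]

theorem measurableSet_cell {h : ℝ} (hh : 0 < h) (k : Fin N → ℤ) : MeasurableSet (cell h k) := by
  rw [cell_eq hh]
  exact (PiLp.volume_preserving_ofLp (Fin N)).measurable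
    (MeasurableSet.univ_pi fun _ => measurableSet_Ico)

theorem volume_cell {h : ℝ} (hh : 0 < h) (k : Fin N → ℤ) :
    volume (cell h k) = ENNReal.ofReal (h ^ N) := by
  rw [cell_eq hh]
  have := (PiLp.volume_preserving_ofLp (Fin N)).measure_preimage
    (MeasurableSet.univ_pi fun i => measurableSet_Ico
      (a := (k i * h : ℝ)) (b := (k i + 1) * h)).nullMeasurableSet
  rw [this, Real.volume_pi_Ico]
  have e : ∀ i, (k i + 1) * h - k i * h = h := fun i => by ring
  simp only [e, Finset.prod_const, Finset.card_univ, Fintype.card_fin]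
  rw [ENNReal.ofReal_pow hh.le]

/-- The cube `[-h, h]^N`. -/
def symCube (N : ℕ) (h : ℝ) : Set (Eucl N) :=
  (fun x : Eucl N => x.ofLp) ⁻¹' (univ.pi fun _ => Icc (-h) h)

theorem measurableSet_symCube (h : ℝ) : MeasurableSet (symCube N h) :=
  (PiLp.volume_preserving_ofLp (Fin N)).measurable
    (MeasurableSet.univ_pi fun _ => measurableSet_Icc)

theorem volume_symCube {h : ℝ} (hh : 0 < h) :
    volume (symCube N h) = ENNReal.ofReal (2 ^ N * h ^ N) := by
  have := (PiLp.volume_preserving_ofLp (Fin N)).measure_preimage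
    (MeasurableSet.univ_pi fun _ : Fin N => measurableSet_Icc
      (a := -h) (b := h)).nullMeasurableSet
  rw [symCube, this, volume_pi_pi]
  simp only [Real.volume_Icc, Finset.prod_const, Finset.card_univ, Fintype.card_fin]
  rw [← ENNReal.ofReal_pow (by linarith), ← mul_pow]
  ring_nf

theorem norm_sq_le_of_mem_symCube {h : ℝ} {z : Eucl N} (hz : z ∈ symCube N h) :
    ‖z‖ ^ 2 ≤ N * h ^ 2 := by
  rw [EuclideanSpace.real_norm_sq_eq]
  have : ∀ i ∈ Finset.univ, z i ^ 2 ≤ h ^ 2 := fun i _ => by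
    have := hz i (mem_univ i)
    exact sq_le_sq' this.1 this.2
  refine (Finset.sum_le_sum this).trans ?_
  simp

/-- The mean value of `φ` over the cell with index `k`. -/
def cellMean (h : ℝ) (φ : Eucl N → ℝ) (k : Fin N → ℤ) : ℝ :=
  (h ^ N)⁻¹ * ∫ y in cell h k, φ y

/-- The piecewise constant approximation by mean values over the cells of the grid of size `h`
is accurate to order `h ‖∇φ‖`. Two points of a cell differ by an element of `[-h, h]^N`, so the
estimate reduces to the one for translations. -/
theorem lintegral_sq_sub_cellMean_le (φ : TestFun Ω) {h : ℝ} (hh : 0 < h) :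
    ∫⁻ x, ENNReal.ofReal ((φ.1 x - cellMean h φ.1 (cellIndex h x)) ^ 2) ≤
      ENNReal.ofReal (2 ^ N * N * h ^ 2 * ∫ x, ∑ i, partialDeriv i φ.1 x ^ 2) := by
  have hφ : IsTest Ω φ.1 := φ.2
  have hφc := hφ.smooth.continuous
  set D := ∫ x, ∑ i, partialDeriv i φ.1 x ^ 2 with hD
  have hD0 : 0 ≤ D := integral_nonneg fun x => by positivity
  have hhN : 0 < h ^ N := by positivity
  have hpt : ∀ x, ENNReal.ofReal ((φ.1 x - cellMean h φ.1 (cellIndex h x)) ^ 2) ≤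
      ENNReal.ofReal (h ^ N)⁻¹ *
        ∫⁻ z in symCube N h, ENNReal.ofReal ((φ.1 (x + z) - φ.1 x) ^ 2) := by
    intro x
    set k := cellIndex h x with hk
    have hvol := volume_cell hh k
    have : IsFiniteMeasure (volume.restrict (cell h k)) :=
      ⟨by rw [Measure.restrict_apply_univ, hvol]; exact ENNReal.ofReal_lt_top⟩
    have hreal : (volume.restrict (cell h k)).real univ = h ^ N := by
      rw [measureReal_def, Measure.restrict_apply_univ, hvol, ENNReal.toReal_ofReal hhN.le]
    have hi0 : Integrable φ.1 (volume.restrict (cell h k)) :=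
      (hφc.integrable_of_hasCompactSupport hφ.compact).restrict
    have hi0' : Integrable (fun y => φ.1 y ^ 2) (volume.restrict (cell h k)) :=
      (CcFun.integrable_sq (testToCc Ω φ)).restrict
    have hi1 : Integrable (fun y => φ.1 y - φ.1 x) (volume.restrict (cell h k)) :=
      hi0.sub (integrable_const _)
    have hi2 : Integrable (fun y => (φ.1 y - φ.1 x) ^ 2) (volume.restrict (cell h k)) := by
      have e : (fun y => (φ.1 y - φ.1 x) ^ 2) =
          fun y => φ.1 y ^ 2 - 2 * φ.1 x * φ.1 y + φ.1 x ^ 2 := by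
        funext y; ring
      rw [e]
      exact (hi0'.sub (hi0.const_mul _)).add (integrable_const _)
    have e1 : φ.1 x - cellMean h φ.1 k = -((h ^ N)⁻¹ * ∫ y in cell h k, (φ.1 y - φ.1 x)) := by
      rw [integral_sub hi0 (integrable_const _), integral_const, hreal, cellMean, smul_eq_mul]
      field_simp
      ring
    have hj := sq_integral_le hi1 hi2
    rw [hreal] at hj
    have e2 : (φ.1 x - cellMean h φ.1 k) ^ 2 ≤
        (h ^ N)⁻¹ * ∫ y in cell h k, (φ.1 y - φ.1 x) ^ 2 := by
      rw [e1, neg_sq, mul_pow]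
      calc ((h ^ N)⁻¹) ^ 2 * (∫ y in cell h k, (φ.1 y - φ.1 x)) ^ 2
          ≤ ((h ^ N)⁻¹) ^ 2 * (h ^ N * ∫ y in cell h k, (φ.1 y - φ.1 x) ^ 2) := by gcongr
        _ = _ := by field_simp
    refine (ENNReal.ofReal_le_ofReal e2).trans ?_
    rw [ENNReal.ofReal_mul (by positivity)]
    gcongr
    rw [ofReal_integral_eq_lintegral_ofReal hi2
      (Filter.Eventually.of_forall fun y => sq_nonneg _)]
    -- the substitution `y = x + z`
    rw [← lintegral_indicator (measurableSet_cell hh k),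
      ← lintegral_indicator (measurableSet_symCube h),
      ← lintegral_add_left_eq_self _ x]
    refine lintegral_mono fun z => ?_
    by_cases hz : x + z ∈ cell h k
    · have hz' : z ∈ symCube N h := by
        have h1 : x ∈ cell h k := rfl
        rw [cell_eq hh] at h1 hz
        intro i _
        have h2 := h1 i (mem_univ i)
        have h3 := hz i (mem_univ i)
        simp only [mem_Ico, PiLp.add_apply] at h2 h3
        constructor <;> linarith
      rw [indicator_of_mem hz, indicator_of_mem hz']
    · rw [indicator_of_notMem hz]
      exact zero_le
  calc ∫⁻ x, ENNReal.ofReal ((φ.1 x - cellMean h φ.1 (cellIndex h x)) ^ 2)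
      ≤ ∫⁻ x, ENNReal.ofReal (h ^ N)⁻¹ *
        ∫⁻ z in symCube N h, ENNReal.ofReal ((φ.1 (x + z) - φ.1 x) ^ 2) := lintegral_mono hpt
    _ = ENNReal.ofReal (h ^ N)⁻¹ * ∫⁻ z in symCube N h, ∫⁻ x,
          ENNReal.ofReal ((φ.1 (x + z) - φ.1 x) ^ 2) := by
        rw [lintegral_const_mul' _ _ ENNReal.ofReal_ne_top, lintegral_lintegral_swap]
        have : Continuous fun p : Eucl N × Eucl N => (φ.1 (p.1 + p.2) - φ.1 p.1) ^ 2 := by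
          fun_prop
        exact (ENNReal.continuous_ofReal.comp this).measurable.aemeasurable
    _ ≤ ENNReal.ofReal (h ^ N)⁻¹ * ∫⁻ z in symCube N h, ENNReal.ofReal (N * h ^ 2 * D) := by
        refine mul_le_mul_right ?_ _
        refine setLIntegral_mono measurable_const fun z hz => ?_
        refine (lintegral_sq_translate_sub_le φ z).trans (ENNReal.ofReal_le_ofReal ?_)
        gcongr
        exact norm_sq_le_of_mem_symCube hz
    _ = _ := by
        rw [setLIntegral_const, volume_symCube hh, ← ENNReal.ofReal_mul (by positivity),
          ← ENNReal.ofReal_mul (by positivity)]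
        congr 1
        field_simp

/-- The indicator function of a cell, as an element of `L²(Ω)`. -/
def cellL2 (Ω : Set (Eucl N)) {h : ℝ} (hh : 0 < h) (k : Fin N → ℤ) : L2 Ω :=
  indicatorConstLp 2 (measurableSet_cell hh k)
    (((Measure.restrict_apply_le Ω (cell h k)).trans_lt
      (by rw [volume_cell hh]; exact ENNReal.ofReal_lt_top)).ne) (1 : ℝ)

theorem exists_finset_cellIndex_mem (hΩ : Bornology.IsBounded Ω) {h : ℝ} (hh : 0 < h) :
    ∃ F : Finset (Fin N → ℤ), ∀ x ∈ Ω, cellIndex h x ∈ F := by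
  obtain ⟨R, hR⟩ := hΩ.subset_closedBall 0
  refine ⟨Fintype.piFinset fun _ => Finset.Icc ⌊-R / h⌋ ⌊R / h⌋, fun x hx => ?_⟩
  rw [Fintype.mem_piFinset]
  intro i
  have h1 : |x i| ≤ R := by
    have := hR hx
    rw [mem_closedBall_zero_iff] at this
    exact (PiLp.norm_apply_le x i).trans this
  have h2 := abs_le.1 h1
  rw [Finset.mem_Icc]
  exact ⟨Int.floor_le_floor (by gcongr; exact h2.1), Int.floor_le_floor (by gcongr; exact h2.2)⟩

/-- Finite-dimensional subspaces of `L²(Ω)` approximate test functions uniformly on bounded sets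
of `H¹₀(Ω)`. -/
theorem exists_finiteDimensional_approx (hΩo : IsOpen Ω) (hΩ : Bornology.IsBounded Ω) {h : ℝ}
    (hh : 0 < h) :
    ∃ W : Submodule ℝ (L2 Ω), FiniteDimensional ℝ W ∧ ∀ φ : TestFun Ω, ∃ w ∈ W,
      ‖toL2 Ω (testToCc Ω φ) - w‖ ^ 2 ≤
        2 ^ N * N * h ^ 2 * ∫ x, ∑ i, partialDeriv i φ.1 x ^ 2 := by
  obtain ⟨F, hF⟩ := exists_finset_cellIndex_mem hΩ hh
  refine ⟨Submodule.span ℝ (cellL2 Ω hh '' (F : Set (Fin N → ℤ))),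
    FiniteDimensional.span_of_finite ℝ (F.finite_toSet.image _), fun φ => ?_⟩
  refine ⟨∑ k ∈ F, cellMean h φ.1 k • cellL2 Ω hh k, Submodule.sum_mem _ fun k hk =>
    Submodule.smul_mem _ _ (Submodule.subset_span ⟨k, hk, rfl⟩), ?_⟩
  set q := toL2 Ω (testToCc Ω φ) - ∑ k ∈ F, cellMean h φ.1 k • cellL2 Ω hh k with hq
  have hqx : ∀ᵐ x ∂(volume.restrict Ω), q x = φ.1 x - cellMean h φ.1 (cellIndex h x) := by
    have hsum : ∀ᵐ x ∂(volume.restrict Ω), (∑ k ∈ F, cellMean h φ.1 k • cellL2 Ω hh k : L2 Ω) x =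
        ∑ k ∈ F, cellMean h φ.1 k * (cell h k).indicator (fun _ => (1 : ℝ)) x := by
      have h2 : ∀ᵐ x ∂(volume.restrict Ω), ∀ k ∈ F, (cellMean h φ.1 k • cellL2 Ω hh k : L2 Ω) x =
          cellMean h φ.1 k * (cell h k).indicator (fun _ => (1 : ℝ)) x := by
        rw [Finset.eventually_all]
        intro k _
        filter_upwards [Lp.coeFn_smul (cellMean h φ.1 k) (cellL2 Ω hh k),
          (indicatorConstLp_coeFn : (cellL2 Ω hh k) =ᵐ[volume.restrict Ω] _)] with x h3 h4
        rw [h3, Pi.smul_apply, smul_eq_mul]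
        exact congrArg _ h4
      filter_upwards [h2, Lp.coeFn_finsetSum F
        (fun k => cellMean h φ.1 k • cellL2 Ω hh k)] with x h3 h4
      rw [h4, Finset.sum_apply]
      exact Finset.sum_congr rfl h3
    filter_upwards [hsum, Lp.coeFn_sub (toL2 Ω (testToCc Ω φ))
      (∑ k ∈ F, cellMean h φ.1 k • cellL2 Ω hh k), (CcFun.memLp (testToCc Ω φ)).coeFn_toLp,
      ae_restrict_mem hΩo.measurableSet] with x h1 h2 h3 hx
    rw [hq, h2, Pi.sub_apply, h1, Finset.sum_eq_single_of_mem _ (hF x hx)]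
    · have hxc : x ∈ cell h (cellIndex h x) := rfl
      rw [indicator_of_mem hxc, mul_one]
      exact congrArg (· - _) h3
    · intro k _ hk
      have hxc : x ∉ cell h k := fun h' => hk (Eq.symm h')
      rw [indicator_of_notMem hxc, mul_zero]
  have hn : ENNReal.ofReal (‖q‖ ^ 2) = ∫⁻ x in Ω, ENNReal.ofReal (q x ^ 2) := by
    have hi : Integrable (fun x => q x ^ 2) (volume.restrict Ω) := (Lp.memLp q).integrable_sq
    rw [← ofReal_integral_eq_lintegral_ofReal hi (Filter.Eventually.of_forall fun x => sq_nonneg _),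
      ← real_inner_self_eq_norm_sq, L2.inner_def]
    congr 1
    refine integral_congr_ae (Filter.Eventually.of_forall fun x => ?_)
    simp [sq]
  have hD0 : 0 ≤ ∫ x, ∑ i, partialDeriv i φ.1 x ^ 2 := integral_nonneg fun x => by positivity
  rw [← ENNReal.ofReal_le_ofReal_iff (by positivity), hn]
  calc ∫⁻ x in Ω, ENNReal.ofReal (q x ^ 2)
      = ∫⁻ x in Ω, ENNReal.ofReal ((φ.1 x - cellMean h φ.1 (cellIndex h x)) ^ 2) :=
        lintegral_congr_ae (by filter_upwards [hqx] with x hx; rw [hx])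
    _ ≤ ∫⁻ x, ENNReal.ofReal ((φ.1 x - cellMean h φ.1 (cellIndex h x)) ^ 2) :=
        setLIntegral_le_lintegral _ _
    _ ≤ _ := lintegral_sq_sub_cellMean_le φ hh

theorem integral_gradSq_eq (φ : TestFun Ω) :
    ∫ x, ∑ i, partialDeriv i φ.1 x ^ 2 = ∑ i, ‖(testPair Ω φ).2 i‖ ^ 2 := by
  have hi : ∀ i ∈ Finset.univ, Integrable fun x => partialDeriv i φ.1 x ^ 2 :=
    fun i _ => CcFun.integrable_sq (testPartial Ω i φ)
  rw [integral_finsetSum _ hi]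
  exact Finset.sum_congr rfl fun i _ => (norm_sq_toL2 (testPartial Ω i φ)).symm

/-- The embedding `H¹₀(Ω) → L²(Ω)`. -/
def embL2 (Ω : Set (Eucl N)) : H10 Ω →L[ℝ] L2 Ω :=
  (ContinuousLinearMap.fst ℝ (L2 Ω) (Fin N → L2 Ω)).comp (H10 Ω).subtypeL

/-- Rellich's theorem: for a bounded open set the embedding of `H¹₀(Ω)` in `L²(Ω)` is compact, as
a limit of operators of finite rank. -/
theorem isCompactOperator_embL2 (hΩo : IsOpen Ω) (hΩ : Bornology.IsBounded Ω) :
    IsCompactOperator (embL2 Ω) := by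
  set C : ℝ := 2 ^ N * N * N with hC
  have key : ∀ n : ℕ, ∃ T : H10 Ω →L[ℝ] L2 Ω, IsCompactOperator T ∧
      ‖embL2 Ω - T‖ ≤ √C * (1 / ((n : ℝ) + 1)) := by
    intro n
    have hh : (0 : ℝ) < 1 / ((n : ℝ) + 1) := by positivity
    set h : ℝ := 1 / ((n : ℝ) + 1)
    obtain ⟨W, hW, happ⟩ := exists_finiteDimensional_approx hΩo hΩ hh
    have hcomp : IsCompactOperator (W.orthogonalProjectionOnto.comp (embL2 Ω)) :=
      isCompactOperator_of_locallyCompactSpace_dom _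
    refine ⟨W.subtypeL.comp (W.orthogonalProjectionOnto.comp (embL2 Ω)),
      hcomp.clm_comp W.subtypeL, ?_⟩
    have hball : ∀ p : L2Pair Ω, p ∈ H10 Ω →
        ‖p.1 - (W.orthogonalProjectionOnto p.1 : L2 Ω)‖ ≤ √C * h * ‖p‖ := by
      have hcl : IsClosed {p : L2Pair Ω |
          ‖p.1 - (W.orthogonalProjectionOnto p.1 : L2 Ω)‖ ≤ √C * h * ‖p‖} :=
        isClosed_le (by fun_prop) (by fun_prop)
      have hsub : (H10 Ω : Set (L2Pair Ω)) ⊆ {p : L2Pair Ω |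
          ‖p.1 - (W.orthogonalProjectionOnto p.1 : L2 Ω)‖ ≤ √C * h * ‖p‖} := by
        rw [coe_H10]
        refine closure_minimal ?_ hcl
        rintro _ ⟨φ, rfl⟩
        obtain ⟨w, hw, hle⟩ := happ φ
        have h1 : ‖(testPair Ω φ).1 - (W.orthogonalProjectionOnto (testPair Ω φ).1 : L2 Ω)‖ ≤
            ‖(testPair Ω φ).1 - w‖ := by
          have := Submodule.starProjection_minimal (U := W) (testPair Ω φ).1
          rw [Submodule.starProjection_apply] at this
          rw [this]
          exact ciInf_le ⟨0, by rintro _ ⟨x, rfl⟩; positivity⟩ (⟨w, hw⟩ : W)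
        refine h1.trans (le_of_sq_le_sq ?_ (by positivity))
        refine hle.trans ?_
        rw [integral_gradSq_eq, mul_pow, mul_pow, Real.sq_sqrt (by positivity)]
        have h2 : ∑ i, ‖(testPair Ω φ).2 i‖ ^ 2 ≤ N * ‖testPair Ω φ‖ ^ 2 := by
          have : ∀ i ∈ Finset.univ, ‖(testPair Ω φ).2 i‖ ^ 2 ≤ ‖testPair Ω φ‖ ^ 2 := fun i _ => by
            gcongr
            exact (norm_le_pi_norm _ i).trans (norm_snd_le _)
          refine (Finset.sum_le_sum this).trans ?_
          simp
        calc 2 ^ N * N * h ^ 2 * ∑ i, ‖(testPair Ω φ).2 i‖ ^ 2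
            ≤ 2 ^ N * N * h ^ 2 * (N * ‖testPair Ω φ‖ ^ 2) := by gcongr
          _ = C * h ^ 2 * ‖testPair Ω φ‖ ^ 2 := by rw [hC]; ring
      exact fun p hp => hsub hp
    exact ContinuousLinearMap.opNorm_le_bound _ (by positivity) fun p => hball p p.2
  choose T hT hle using key
  refine isCompactOperator_of_tendsto (F := T) (l := Filter.atTop) ?_
    (Filter.Eventually.of_forall hT)
  rw [tendsto_iff_norm_sub_tendsto_zero]
  refine squeeze_zero (fun n => norm_nonneg _) (fun n => (norm_sub_rev _ _).trans_le (hle n)) ?_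
  simpa using tendsto_one_div_add_atTop_nhds_zero_nat.const_mul (√C)

end Rellich

/-! ### A deformation adapted to an atlas -/

section Geometry

theorem isBounded_box {N : ℕ} (a b : Fin N → ℝ) : Bornology.IsBounded (box a b) := by
  have h : box a b ⊆ WithLp.toLp 2 '' (univ.pi fun i => Icc (a i) (b i)) := fun x hx =>
    ⟨x.ofLp, fun i _ => ⟨(hx i).1.le, (hx i).2.le⟩, rfl⟩
  exact ((isCompact_univ_pi fun _ => isCompact_Icc).image
    (PiLp.continuous_toLp 2 _)).isBounded.subset h

theorem IsCuboid.isBounded {N : ℕ} {V : Set (Eucl N)} (hV : IsCuboid V) :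
    Bornology.IsBounded V := by
  obtain ⟨e, a, b, rfl⟩ := hV
  exact e.isometry.lipschitz.isBounded_image (isBounded_box a b)

section Cutoff

variable {E : Type*} [NormedAddCommGroup E] [NormedSpace ℝ E]

/-- A point of `V` at distance more than `δ` from the boundary is at distance at least `δ` from
the complement: a segment that leaves `V` meets the boundary. -/
theorem le_infDist_compl {V : Set E} {x : E} {δ : ℝ} (hne : Vᶜ.Nonempty) (hx : x ∈ V)
    (hd : δ < Metric.infDist x (frontier V)) : δ ≤ Metric.infDist x Vᶜ := by
  refine (Metric.le_infDist hne).2 fun y hy => ?_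
  by_contra! hlt
  have hseg : IsPreconnected (segment ℝ x y) := (convex_segment x y).isPreconnected
  obtain ⟨z, hz, hzf⟩ : (segment ℝ x y ∩ frontier V).Nonempty := by
    by_contra hempty
    rw [not_nonempty_iff_eq_empty] at hempty
    have hsub := hseg.subset_of_closure_inter_subset (u := interior V) isOpen_interior
      ⟨x, left_mem_segment ℝ x y, ?_⟩ ?_
    · exact hy (interior_subset (hsub (right_mem_segment ℝ x y)))
    · by_contra hxi
      have : x ∈ segment ℝ x y ∩ frontier V :=
        ⟨left_mem_segment ℝ x y, subset_closure hx, hxi⟩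
      rw [hempty] at this
      exact this
    · rintro z ⟨hz1, hz2⟩
      by_contra hzi
      have : z ∈ segment ℝ x y ∩ frontier V := ⟨hz2, closure_mono interior_subset hz1, hzi⟩
      rw [hempty] at this
      exact this
  have h1 : Metric.infDist x (frontier V) ≤ dist x z := Metric.infDist_le_dist_of_mem hzf
  have h2 : dist x z ≤ dist x y := by
    have := dist_add_dist_of_mem_segment hz
    linarith [dist_nonneg (x := z) (y := y)]
  linarith

/-- A smooth cutoff that equals one at distance at least `ρ / 2` from the complement of `V` and whose
nonzero set stays at distance at least `ρ / 4` from that complement. -/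
theorem exists_cutoff [FiniteDimensional ℝ E] {V : Set E} (hV : Bornology.IsBounded V) {ρ : ℝ}
    (hρ : 0 < ρ) :
    ∃ ψ : E → ℝ, ContDiff ℝ ∞ ψ ∧ HasCompactSupport ψ ∧ (∀ x, 0 ≤ ψ x ∧ ψ x ≤ 1) ∧
      (∀ x, ρ / 2 ≤ Metric.infDist x Vᶜ → ψ x = 1) ∧
      ∀ x, ψ x ≠ 0 → Metric.ball x (ρ / 4) ⊆ V := by
  have hc : Continuous fun x => Metric.infDist x Vᶜ := Metric.continuous_infDist_pt _
  obtain ⟨ψ, h1, h2, h3, h4⟩ := exists_contMDiff_zero_iff_one_iff_of_isClosed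
    (n := ⊤) (modelWithCornersSelf ℝ E) (s := {x | Metric.infDist x Vᶜ ≤ ρ / 4})
    (t := {x | ρ / 2 ≤ Metric.infDist x Vᶜ})
    (isClosed_le hc continuous_const) (isClosed_le continuous_const hc)
    (disjoint_left.2 fun x h h' => by
      simp only [mem_ofPred_eq] at h h'
      linarith)
  have hball : ∀ x, ψ x ≠ 0 → Metric.ball x (ρ / 4) ⊆ V := by
    intro x hx
    have : ¬ Metric.infDist x Vᶜ ≤ ρ / 4 := fun h => hx ((h3 x).1 h)
    exact (Metric.ball_subset_ball (not_le.1 this).le).trans Metric.ball_infDist_compl_subset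
  refine ⟨ψ, h1.contDiff, ?_, fun x => h2 ⟨x, rfl⟩, fun x hx => (h4 x).1 hx, hball⟩
  refine HasCompactSupport.of_support_subset_isCompact (Metric.isCompact_of_isClosed_isBounded
    isClosed_closure hV.closure) fun x hx => subset_closure (hball x hx ?_)
  exact Metric.mem_ball_self (by positivity)

end Cutoff

variable {d : ℕ}

/-- The direction of the vertical axis of the `j`-th chart of an atlas. -/
def Atlas.dir (A : Atlas d) (j : Fin A.s) : Eucl (d + 1) :=
  (A.r j).toRealAffineIsometryEquiv.linearIsometryEquiv.symm
    (EuclideanSpace.single (Fin.last d) 1)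

theorem Atlas.norm_dir (A : Atlas d) (j : Fin A.s) : ‖A.dir j‖ = 1 := by
  simp [Atlas.dir]

theorem Atlas.r_add_smul_dir (A : Atlas d) (j : Fin A.s) (x : Eucl (d + 1)) (τ : ℝ) :
    A.r j (x + τ • A.dir j) = A.r j x + τ • EuclideanSpace.single (Fin.last d) 1 := by
  have := (A.r j).toRealAffineIsometryEquiv.map_vadd x (τ • A.dir j)
  rw [IsometryEquiv.coeFn_toRealAffineIsometryEquiv] at this
  rw [vadd_eq_add, vadd_eq_add, map_smul] at this
  rw [add_comm x, this, add_comm (A.r j x), Atlas.dir, LinearIsometryEquiv.apply_symm_apply]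

theorem bar_add_smul_single_last (x : Eucl (d + 1)) (τ : ℝ) :
    bar (x + τ • EuclideanSpace.single (Fin.last d) 1) = bar x := by
  ext i
  simp [bar]

/-- Moving a point of a set of the class `C(𝒜)` downwards within a chart stays in the set. -/
theorem Atlas.IsGraphFamily.sub_smul_dir_mem {A : Atlas d} {Ω : Set (Eucl (d + 1))}
    {g : Fin A.s → Eucl d → ℝ} (hg : A.IsGraphFamily Ω g) (j : Fin A.s) {z : Eucl (d + 1)}
    {τ : ℝ} (hτ : 0 ≤ τ) (hz : z + τ • A.dir j ∈ Ω) (hzV : z ∈ A.V j)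
    (hzV' : z + τ • A.dir j ∈ A.V j) : z ∈ Ω := by
  obtain ⟨a, b, h⟩ := hg
  obtain ⟨h1, h2, -⟩ := h j
  have h3 : A.r j (z + τ • A.dir j) ∈ A.r j '' (Ω ∩ A.V j) := ⟨_, ⟨hz, hzV'⟩, rfl⟩
  have h4 : A.r j z ∈ box (a j) (b j) := h1 ▸ ⟨z, hzV, rfl⟩
  rw [h2, A.r_add_smul_dir, mem_ofPred_eq, bar_add_smul_single_last] at h3
  have h5 : A.r j z ∈ A.r j '' (Ω ∩ A.V j) := by
    rw [h2]
    refine ⟨(h4 _).1, ?_, h3.2.2⟩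
    have := h3.2.1
    simp only [PiLp.add_apply, PiLp.smul_apply, PiLp.single_apply, if_true,
      smul_eq_mul, mul_one] at this
    linarith
  obtain ⟨y, hy, hyz⟩ := h5
  rw [← (A.r j).injective hyz]
  exact hy.1

/-- A downward move by more than the distance of the graphs in a chart leads from a set of the
class `C(𝒜)` into another one. -/
theorem Atlas.IsGraphFamily.mem_of_add_smul_dir_mem {A : Atlas d} {Ω₁ Ω₂ : Set (Eucl (d + 1))}
    {g₁ g₂ : Fin A.s → Eucl d → ℝ} (hg₁ : A.IsGraphFamily Ω₁ g₁) (hg₂ : A.IsGraphFamily Ω₂ g₂)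
    (j : Fin A.s) {z : Eucl (d + 1)} {τ : ℝ}
    (hd : ∀ x ∈ A.r j '' A.V j, g₁ j (bar x) < g₂ j (bar x) + τ)
    (hz : z + τ • A.dir j ∈ Ω₁) (hzV : z ∈ A.V j)
    (hzV' : z + τ • A.dir j ∈ A.V j) : z ∈ Ω₂ := by
  obtain ⟨a, b, h⟩ := hg₁
  obtain ⟨a', b', h'⟩ := hg₂
  obtain ⟨h1, h2, -⟩ := h j
  obtain ⟨h1', h2', -⟩ := h' j
  have h3 : A.r j (z + τ • A.dir j) ∈ A.r j '' (Ω₁ ∩ A.V j) := ⟨_, ⟨hz, hzV'⟩, rfl⟩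
  have hzr : A.r j z ∈ A.r j '' A.V j := ⟨z, hzV, rfl⟩
  have h4 : A.r j z ∈ box (a' j) (b' j) := h1' ▸ hzr
  rw [h2, A.r_add_smul_dir, mem_ofPred_eq, bar_add_smul_single_last] at h3
  have h5 : A.r j z ∈ A.r j '' (Ω₂ ∩ A.V j) := by
    rw [h2']
    refine ⟨(h4 _).1, ?_, fun i => h4 i.castSucc⟩
    have h6 := h3.2.1
    have h7 := hd _ hzr
    simp only [PiLp.add_apply, PiLp.smul_apply, PiLp.single_apply, if_true,
      smul_eq_mul, mul_one] at h6
    linarith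
  obtain ⟨y, hy, hyz⟩ := h5
  rw [← (A.r j).injective hyz]
  exact hy.1

/-- The atlas distance bounds the distance of the graphs in every chart. -/
theorem Atlas.abs_graphFun_sub_le {A : Atlas d} {Ω₁ Ω₂ : Set (Eucl (d + 1))}
    (h₁ : ∃ g, A.IsGraphFamily Ω₁ g) (h₂ : ∃ g, A.IsGraphFamily Ω₂ g) (j : Fin A.s)
    {x : Eucl (d + 1)} (hx : x ∈ A.r j '' A.V j) :
    |A.graphFun Ω₁ j (bar x) - A.graphFun Ω₂ j (bar x)| ≤ A.dist Ω₁ Ω₂ := by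
  -- the graphs are bounded by the sides of the charts, so that the suprema are honest
  have hb : ∀ Ω, (∃ g, A.IsGraphFamily Ω g) → ∀ j, ∃ M, ∀ x ∈ A.r j '' A.V j,
      |A.graphFun Ω j (bar x)| ≤ M := by
    intro Ω hΩ j
    obtain ⟨a, b, h⟩ := A.graphFun_spec hΩ
    obtain ⟨h1, -, -, h4, h5⟩ := h j
    refine ⟨max |a j (Fin.last d)| |b j (Fin.last d)|, fun x hx => ?_⟩
    rw [h1] at hx
    have hbar : bar x ∈ closure (base (a j) (b j)) := subset_closure fun i => hx i.castSucc
    have hab := (hx (Fin.last d)).1.trans (hx (Fin.last d)).2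
    have hρ := A.ρ_pos
    refine abs_le_max_abs_abs ?_ ?_
    · rcases lt_or_ge (j : ℕ) A.s' with hj | hj
      · linarith [(h5 hj _ hbar).1]
      · rw [h4 hj _ hbar]
        exact hab.le
    · rcases lt_or_ge (j : ℕ) A.s' with hj | hj
      · linarith [(h5 hj _ hbar).2]
      · rw [h4 hj _ hbar]
  have hbdd : BddAbove (range fun x : (A.r j '' A.V j : Set (Eucl (d + 1))) =>
      |A.graphFun Ω₁ j (bar x.1) - A.graphFun Ω₂ j (bar x.1)|) := by
    obtain ⟨M₁, hM₁⟩ := hb Ω₁ h₁ j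
    obtain ⟨M₂, hM₂⟩ := hb Ω₂ h₂ j
    refine ⟨M₁ + M₂, ?_⟩
    rintro _ ⟨y, rfl⟩
    exact (abs_sub _ _).trans (add_le_add (hM₁ y y.2) (hM₂ y y.2))
  unfold Atlas.dist
  refine le_trans ?_ (le_ciSup (f := fun j : Fin A.s =>
    ⨆ x : (A.r j '' A.V j : Set (Eucl (d + 1))),
      |A.graphFun Ω₁ j (bar x.1) - A.graphFun Ω₂ j (bar x.1)|) (finite_range _).bddAbove j)
  exact le_ciSup hbdd ⟨x, hx⟩

theorem Atlas.dist_nonneg (A : Atlas d) (Ω₁ Ω₂ : Set (Eucl (d + 1))) : 0 ≤ A.dist Ω₁ Ω₂ :=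
  Real.iSup_nonneg fun _ => Real.iSup_nonneg fun _ => abs_nonneg _

theorem Atlas.dist_comm (A : Atlas d) (Ω₁ Ω₂ : Set (Eucl (d + 1))) :
    A.dist Ω₁ Ω₂ = A.dist Ω₂ Ω₁ := by
  unfold Atlas.dist
  simp only [abs_sub_comm]

/-- There is a smooth compactly supported vector field such that, whenever the atlas distance of
`Ω₁` and `Ω₂` is less than `ε` and `ε` is small, the complement of `Ω₂` is mapped to the complement
of `Ω₁` by `y ↦ y + ε Ψ(y)`. It is the sum of the vertical directions of the charts, localized by
cut-off functions: removing these displacements one at a time from a point `y + ε Ψ(y)` of `Ω₁`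
stays in `Ω₁`, and the last one, in a chart where the cut-off function equals one, leads to
`Ω₂`. -/
theorem Atlas.exists_field (A : Atlas d) :
    ∃ Ψ : Eucl (d + 1) → Eucl (d + 1), ContDiff ℝ ∞ Ψ ∧ HasCompactSupport Ψ ∧
      ∃ ε₀ > 0, ∀ ε, 0 < ε → ε < ε₀ → ∀ Ω₁ ∈ A.Class, ∀ Ω₂ ∈ A.Class, A.dist Ω₁ Ω₂ < ε →
        ∀ y, y + ε • Ψ y ∈ Ω₁ → y ∈ Ω₂ := by
  have hρ := A.ρ_pos
  choose ψ hψs hψc hψ01 hψ1 hψV using fun j =>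
    exists_cutoff (A.isCuboid j).isBounded hρ
  refine ⟨fun y => ∑ j, ψ j y • A.dir j, ?_, ?_, A.ρ / (4 * A.s), ?_, ?_⟩
  · exact ContDiff.sum fun j _ => (hψs j).smul contDiff_const
  · have : ∀ t : Finset (Fin A.s), HasCompactSupport fun y => ∑ j ∈ t, ψ j y • A.dir j := by
      intro t
      induction t using Finset.induction_on with
      | empty => exact HasCompactSupport.zero
      | insert j t hj ih =>
        simp only [Finset.sum_insert hj]
        exact HasCompactSupport.add ((hψc j).smul_right (f' := fun _ => A.dir j)) ih
    exact this _
  · have : (0 : ℝ) < A.s := by exact_mod_cast A.one_le_s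
    positivity
  intro ε hε hε0 Ω₁ h₁ Ω₂ h₂ hd y hy
  have hs : (0 : ℝ) < A.s := by exact_mod_cast A.one_le_s
  have hsε : A.s * ε < A.ρ / 4 := by
    rw [lt_div_iff₀ (by positivity)] at hε0
    linarith
  -- partial displacements are shorter than `ρ / 4`
  have hclose : ∀ t : Finset (Fin A.s), ‖ε • ∑ j ∈ t, ψ j y • A.dir j‖ < A.ρ / 4 := by
    intro t
    have h1 : ‖∑ j ∈ t, ψ j y • A.dir j‖ ≤ A.s := by
      refine (norm_sum_le _ _).trans ?_
      have : ∀ j ∈ t, ‖ψ j y • A.dir j‖ ≤ 1 := fun j _ => by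
        rw [norm_smul, A.norm_dir, mul_one, Real.norm_of_nonneg (hψ01 j y).1]
        exact (hψ01 j y).2
      refine (Finset.sum_le_card_nsmul _ _ _ this).trans ?_
      rw [nsmul_eq_mul, mul_one]
      exact_mod_cast (Finset.card_le_univ t).trans (by simp)
    rw [norm_smul, Real.norm_of_nonneg hε.le]
    nlinarith
  have hball : ∀ t : Finset (Fin A.s),
      y + ε • ∑ j ∈ t, ψ j y • A.dir j ∈ Metric.ball y (A.ρ / 4) := by
    intro t
    rw [Metric.mem_ball, dist_eq_norm, add_sub_cancel_left]
    exact hclose t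
  have g₁ := A.graphFun_spec h₁.2.2.2.2.2
  have g₂ := A.graphFun_spec h₂.2.2.2.2.2
  obtain ⟨j₀, hj₀⟩ : ∃ j, ψ j y = 1 := by
    obtain ⟨j, hj⟩ := mem_iUnion.1 (h₁.2.1 hy)
    have hne : (A.V j)ᶜ.Nonempty := by
      by_contra h
      rw [not_nonempty_iff_eq_empty, compl_empty_iff] at h
      exact NormedSpace.unbounded_univ ℝ (Eucl (d + 1)) (h ▸ (A.isCuboid j).isBounded)
    have h1 := le_infDist_compl hne hj.1 hj.2
    have h2 := Metric.infDist_le_infDist_add_dist (s := (A.V j)ᶜ)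
      (x := y + ε • ∑ j, ψ j y • A.dir j) (y := y)
    have h3 := Metric.mem_ball.1 (hball Finset.univ)
    exact ⟨j, hψ1 j y (by linarith)⟩
  have hind : ∀ t : Finset (Fin A.s), y + ε • ∑ j ∈ tᶜ, ψ j y • A.dir j ∈ Ω₁ := by
    intro t
    induction t using Finset.induction_on with
    | empty => simpa using hy
    | insert j t hj ih =>
      have hsplit : y + ε • ∑ i ∈ tᶜ, ψ i y • A.dir i =
          (y + ε • ∑ i ∈ (insert j t)ᶜ, ψ i y • A.dir i) + (ε * ψ j y) • A.dir j := by
        have : tᶜ = insert j (insert j t)ᶜ := by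
          ext i
          simp only [Finset.mem_compl, Finset.mem_insert]
          by_cases h : i = j
          · simp [h, hj]
          · simp [h]
        rw [this, Finset.sum_insert (by simp), smul_add, smul_smul, add_assoc,
          add_comm ((ε * ψ j y) • A.dir j)]
      by_cases h0 : ψ j y = 0
      · rw [hsplit, h0, mul_zero, zero_smul, add_zero] at ih
        exact ih
      · have hV := hψV j y h0
        refine g₁.sub_smul_dir_mem j (mul_nonneg hε.le (hψ01 j y).1) (hsplit ▸ ih)
          (hV (hball _)) ?_
        rw [← hsplit]
        exact hV (hball _)
  have hlast := hind {j₀}ᶜ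
  rw [compl_compl, Finset.sum_singleton, hj₀, one_smul] at hlast
  have hV := hψV j₀ y (by rw [hj₀]; exact one_ne_zero)
  refine g₁.mem_of_add_smul_dir_mem g₂ j₀ (τ := ε) ?_ hlast
    (hV (Metric.mem_ball_self (by positivity))) ?_
  · intro x hx
    have := A.abs_graphFun_sub_le h₁.2.2.2.2.2 h₂.2.2.2.2.2 j₀ hx
    linarith [(abs_le.1 this).2]
  · have := hball {j₀}
    rw [Finset.sum_singleton, hj₀, one_smul] at this
    exact hV this

end Geometry

/-! ### Small deformations of the space -/

section Deformation

variable {N : ℕ}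

/-- The determinant of a small perturbation of the identity matrix. -/
theorem exists_abs_det_one_add_sub_one_le (N : ℕ) :
    ∃ C > 0, ∃ δ > 0, ∀ (M : Fin N → Fin N → ℝ) (η : ℝ), 0 ≤ η → η < δ → (∀ i j, |M i j| ≤ η) →
      |Matrix.det (1 + Matrix.of M) - 1| ≤ C * η := by
  let F : (Fin N → Fin N → ℝ) → ℝ := fun M => Matrix.det (1 + Matrix.of M)
  have hF : DifferentiableAt ℝ F 0 := by
    have e : F = fun M => ∑ σ : Equiv.Perm (Fin N), ((Equiv.Perm.sign σ : ℤ) : ℝ) *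
        ∏ i, ((1 : Matrix (Fin N) (Fin N) ℝ) (σ i) i + M (σ i) i) := by
      funext M
      simp [F, Matrix.det_apply']
    rw [e]
    fun_prop
  obtain ⟨C, hC, hb⟩ := hF.isBigO_sub.exists_pos
  rw [Asymptotics.isBigOWith_iff, Metric.eventually_nhds_iff] at hb
  obtain ⟨δ, hδ, hb⟩ := hb
  refine ⟨C, hC, δ, hδ, fun M η h0 hη hM => ?_⟩
  have hn : ‖M‖ ≤ η := (pi_norm_le_iff_of_nonneg h0).2 fun i =>
    (pi_norm_le_iff_of_nonneg h0).2 fun j => hM i j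
  have h1 := hb (y := M) (by rw [dist_zero_right]; linarith)
  have h2 : F 0 = 1 := by
    have : (1 : Matrix (Fin N) (Fin N) ℝ) + Matrix.of 0 = 1 := by ext; simp
    simp only [F, this, Matrix.det_one]
  rw [h2, sub_zero, Real.norm_eq_abs] at h1
  exact h1.trans (by gcongr)

theorem IsTest.partialDeriv {Ω : Set (Eucl N)} {φ : Eucl N → ℝ} (h : IsTest Ω φ) (i : Fin N) :
    IsTest Ω (partialDeriv i φ) where
  smooth := (h.smooth.fderiv_right (m := ∞) (by simp)).clm_apply contDiff_const
  compact := h.hasCompactSupport_partialDeriv i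
  support := (tsupport_fderiv_apply_subset ℝ (EuclideanSpace.single i 1)).trans h.support

theorem IsTest.exists_bound {Ω : Set (Eucl N)} {φ : Eucl N → ℝ} (h : IsTest Ω φ) :
    ∃ K, ∀ x, |φ x| ≤ K :=
  h.compact.exists_bound_of_continuous h.smooth.continuous

/-- A diffeomorphism `S` of `ℝ^N` with Jacobian matrix `∂_i S_k = δ_ki + ε P_ki`, such that `P`
and its first derivatives are bounded by `K` and such that `S` changes integrals at most by a
factor `1 ± K ε`. -/
structure SmallDeformation (N : ℕ) (ε K : ℝ) where
  S : Eucl N ≃ₜ Eucl N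
  P : Fin N → Fin N → Eucl N → ℝ
  smooth : ContDiff ℝ ∞ S
  smooth_P : ∀ k i, ContDiff ℝ ∞ (P k i)
  partialDeriv_S : ∀ k i y,
    partialDeriv i (fun x => S x k) y = (if k = i then 1 else 0) + ε * P k i y
  abs_P_le : ∀ k i y, |P k i y| ≤ K
  abs_partialDeriv_P_le : ∀ k i j y, |partialDeriv j (P k i) y| ≤ K
  integral_comp_le : ∀ F : Eucl N → ℝ, Continuous F → HasCompactSupport F → (∀ x, 0 ≤ F x) →
    ∫ x, F (S x) ≤ (1 + K * ε) * ∫ x, F x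
  le_integral_comp : ∀ F : Eucl N → ℝ, Continuous F → HasCompactSupport F → (∀ x, 0 ≤ F x) →
    (1 - K * ε) * ∫ x, F x ≤ ∫ x, F (S x)

theorem det_eq_det_partialDeriv {S : Eucl N → Eucl N} {y : Eucl N} (hS : DifferentiableAt ℝ S y) :
    (fderiv ℝ S y).det =
      Matrix.det (Matrix.of fun k i => partialDeriv i (fun x => S x k) y) := by
  rw [ContinuousLinearMap.det,
    ← LinearMap.det_toMatrix (EuclideanSpace.basisFun (Fin N) ℝ).toBasis]
  congr 1
  ext k i
  have h : HasFDerivAt (fun x => S x k)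
      ((EuclideanSpace.proj k : Eucl N →L[ℝ] ℝ).comp (fderiv ℝ S y)) y :=
    (EuclideanSpace.proj k : Eucl N →L[ℝ] ℝ).hasFDerivAt.comp y hS.hasFDerivAt
  simp [LinearMap.toMatrix_apply, partialDeriv, h.fderiv]

/-- For a smooth compactly supported vector field `Ψ` and small `ε`, the map `y ↦ y + ε Ψ(y)` is a
small deformation. -/
theorem exists_smallDeformation {Ψ : Eucl N → Eucl N} (hΨ : ContDiff ℝ ∞ Ψ)
    (hc : HasCompactSupport Ψ) :
    ∃ K > 0, ∃ ε₀ > 0, ∀ ε, 0 < ε → ε < ε₀ →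
      ∃ D : SmallDeformation N ε K, ∀ y, D.S y = y + ε • Ψ y := by
  have htest : ∀ k, IsTest univ fun y => Ψ y k := fun k =>
    ⟨(EuclideanSpace.proj k : Eucl N →L[ℝ] ℝ).contDiff.comp hΨ,
      hc.comp_left (g := fun v : Eucl N => v k) rfl, subset_univ _⟩
  let P : Fin N → Fin N → Eucl N → ℝ := fun k i => partialDeriv i fun y => Ψ y k
  have hP : ∀ k i, IsTest univ (P k i) := fun k i => (htest k).partialDeriv i
  choose K₁ hK₁ using fun k i => (hP k i).exists_bound
  choose K₂ hK₂ using fun k i j => ((hP k i).partialDeriv j).exists_bound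
  obtain ⟨K₃, hK₃, hK₁', hK₂'⟩ : ∃ K₃ > 0, (∀ k i, K₁ k i ≤ K₃) ∧ ∀ k i j, K₂ k i j ≤ K₃ := by
    refine ⟨1 + ∑ k, ∑ i, |K₁ k i| + ∑ k, ∑ i, ∑ j, |K₂ k i j|, by positivity, ?_, ?_⟩
    · intro k i
      have h1 := Finset.single_le_sum (f := fun i => |K₁ k i|) (fun _ _ => abs_nonneg _)
        (Finset.mem_univ i)
      have h2 := Finset.single_le_sum (f := fun k => ∑ i, |K₁ k i|) (fun _ _ => by positivity)
        (Finset.mem_univ k)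
      have h3 : 0 ≤ ∑ k, ∑ i, ∑ j, |K₂ k i j| := by positivity
      have h4 := le_abs_self (K₁ k i)
      linarith
    · intro k i j
      have h0 := Finset.single_le_sum (f := fun j => |K₂ k i j|) (fun _ _ => abs_nonneg _)
        (Finset.mem_univ j)
      have h1 := Finset.single_le_sum (f := fun i => ∑ j, |K₂ k i j|) (fun _ _ => by positivity)
        (Finset.mem_univ i)
      have h2 := Finset.single_le_sum (f := fun k => ∑ i, ∑ j, |K₂ k i j|)
        (fun _ _ => by positivity) (Finset.mem_univ k)
      have h3 : 0 ≤ ∑ k, ∑ i, |K₁ k i| := by positivity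
      have h4 := le_abs_self (K₂ k i j)
      linarith
  obtain ⟨C, hC, δ, hδ, hdet⟩ := exists_abs_det_one_add_sub_one_le N
  obtain ⟨M, hM⟩ : ∃ M : NNReal, LipschitzWith M Ψ :=
    hΨ.lipschitzWith_of_hasCompactSupport hc (by simp)
  refine ⟨K₃ + 2 * C * K₃, by positivity,
    min (δ / K₃) (min (1 / (2 * C * K₃)) (1 / (M + 1))), by positivity, fun ε hε hε0 => ?_⟩
  obtain ⟨hε1, hε2⟩ := lt_min_iff.1 hε0
  obtain ⟨hε2, hε3⟩ := lt_min_iff.1 hε2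
  rw [lt_div_iff₀ (by positivity)] at hε1 hε2 hε3
  have hMε : (M : ℝ) * ε < 1 := by
    have := mul_nonneg M.2 hε.le
    nlinarith
  -- `y ↦ y + ε Ψ(y)` is a homeomorphism as a contractive perturbation of the identity
  have happ : ApproximatesLinearOn (fun y => y + ε • Ψ y)
      ((ContinuousLinearEquiv.refl ℝ (Eucl N) : Eucl N ≃L[ℝ] Eucl N) : Eucl N →L[ℝ] Eucl N)
      univ (M * ε.toNNReal) := by
    intro x _ y _
    have e : x + ε • Ψ x - (y + ε • Ψ y) -
      ((ContinuousLinearEquiv.refl ℝ (Eucl N) : Eucl N ≃L[ℝ] Eucl N) : Eucl N →L[ℝ] Eucl N)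
        (x - y) = ε • (Ψ x - Ψ y) := by
      simp [smul_sub]
      abel
    rw [e, norm_smul, Real.norm_of_nonneg hε.le]
    have := hM.dist_le_mul x y
    rw [dist_eq_norm, dist_eq_norm] at this
    calc ε * ‖Ψ x - Ψ y‖ ≤ ε * (M * ‖x - y‖) := by gcongr
      _ = ((M * ε.toNNReal : NNReal) : ℝ) * ‖x - y‖ := by
        rw [NNReal.coe_mul, Real.coe_toNNReal ε hε.le]
        ring
  have hsub : Subsingleton (Eucl N) ∨ (M * ε.toNNReal : NNReal) <
      ‖((ContinuousLinearEquiv.refl ℝ (Eucl N)).symm : Eucl N →L[ℝ] Eucl N)‖₊⁻¹ := by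
    rcases subsingleton_or_nontrivial (Eucl N) with h | h
    · exact Or.inl h
    · right
      have : ‖((ContinuousLinearEquiv.refl ℝ (Eucl N)).symm : Eucl N →L[ℝ] Eucl N)‖₊ = 1 := by
        exact ContinuousLinearMap.nnnorm_id
      rw [this, inv_one, ← NNReal.coe_lt_coe, NNReal.coe_mul, Real.coe_toNNReal ε hε.le]
      exact hMε
  let S : Eucl N ≃ₜ Eucl N := happ.toHomeomorph _ hsub
  have hSy : ∀ y, S y = y + ε • Ψ y := fun y => rfl
  have hSs : ContDiff ℝ ∞ S := contDiff_id.add (hΨ.const_smul ε)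
  have hSd : Differentiable ℝ S := hSs.differentiable (by simp)
  have hpS : ∀ k i y, partialDeriv i (fun x => S x k) y = (if k = i then 1 else 0) + ε * P k i y := by
    intro k i y
    have h1 : HasFDerivAt (fun x : Eucl N => x k) (EuclideanSpace.proj k : Eucl N →L[ℝ] ℝ) y :=
      (EuclideanSpace.proj k : Eucl N →L[ℝ] ℝ).hasFDerivAt
    have h2 := ((htest k).differentiable y).hasFDerivAt.const_mul ε
    have h3 : HasFDerivAt (fun x => S x k) _ y := h1.add h2
    unfold ReissnerMindlin.partialDeriv
    rw [h3.fderiv]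
    simp [P, ReissnerMindlin.partialDeriv]
  have hdetS : ∀ y, |(fderiv ℝ S y).det - 1| ≤ C * K₃ * ε := by
    intro y
    have e : (Matrix.of fun k i => partialDeriv i (fun x => S x k) y) =
        1 + Matrix.of fun k i => ε * P k i y := by
      ext k i
      rw [Matrix.of_apply, hpS, Matrix.add_apply, Matrix.of_apply, Matrix.one_apply]
    rw [det_eq_det_partialDeriv (hSd y), e]
    have := hdet (fun k i => ε * P k i y) (K₃ * ε) (by positivity) (by linarith) fun k i => by
      rw [abs_mul, abs_of_pos hε, mul_comm]
      have := (hK₁ k i y).trans (hK₁' k i)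
      gcongr
    linarith
  have hcε : C * K₃ * ε ≤ 1 / 2 := by linarith
  have hcε0 : 0 ≤ C * K₃ * ε := by positivity
  have hint : ∀ F : Eucl N → ℝ, Continuous F → HasCompactSupport F → (∀ x, 0 ≤ F x) →
      (1 - C * K₃ * ε) * ∫ x, F (S x) ≤ ∫ x, F x ∧
      ∫ x, F x ≤ (1 + C * K₃ * ε) * ∫ x, F (S x) := by
    intro F hF hFc hF0
    have hcv : ∫ x, F x = ∫ y, |(fderiv ℝ S y).det| * F (S y) := by
      have := integral_image_eq_integral_abs_det_fderiv_smul volume MeasurableSet.univ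
        (fun y _ => (hSd y).hasFDerivAt.hasFDerivWithinAt) S.injective.injOn F
      rw [image_univ, S.surjective.range_eq] at this
      simpa using this
    have hFS : Continuous fun y => F (S y) := hF.comp S.continuous
    have hFSc : HasCompactSupport fun y => F (S y) := hFc.comp_homeomorph S
    have i1 : Integrable fun y => F (S y) := hFS.integrable_of_hasCompactSupport hFSc
    have hdc : Continuous fun y => |(fderiv ℝ S y).det| :=
      (ContinuousLinearMap.continuous_det.comp (hSs.continuous_fderiv (by simp))).abs
    have i2 : Integrable fun y => |(fderiv ℝ S y).det| * F (S y) :=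
      (hdc.mul hFS).integrable_of_hasCompactSupport hFSc.mul_left
    rw [hcv, ← integral_const_mul, ← integral_const_mul]
    constructor
    · refine integral_mono (i1.const_mul _) i2 fun y => ?_
      have := abs_le.1 (hdetS y)
      have := le_abs_self (fderiv ℝ S y).det
      exact mul_le_mul_of_nonneg_right (by linarith) (hF0 _)
    · refine integral_mono i2 (i1.const_mul _) fun y => ?_
      have h1 := abs_le.1 (hdetS y)
      rw [abs_of_nonneg (by linarith : 0 ≤ (fderiv ℝ S y).det)]
      exact mul_le_mul_of_nonneg_right (by linarith) (hF0 _)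
  refine ⟨⟨S, P, hSs, fun k i => (hP k i).smooth, hpS, fun k i y => ?_, fun k i j y => ?_,
    fun F h1 h2 h3 => ?_, fun F h1 h2 h3 => ?_⟩, hSy⟩
  · exact ((hK₁ k i y).trans (hK₁' k i)).trans (le_add_of_nonneg_right (by positivity))
  · exact ((hK₂ k i j y).trans (hK₂' k i j)).trans (le_add_of_nonneg_right (by positivity))
  · obtain ⟨ha, hb⟩ := hint F h1 h2 h3
    have hI : 0 ≤ ∫ x, F x := integral_nonneg h3
    have hI' : 0 ≤ ∫ x, F (S x) := integral_nonneg fun x => h3 _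
    have hKε : 0 ≤ K₃ * ε := by positivity
    set c := C * K₃ * ε
    have e : (K₃ + 2 * C * K₃) * ε = K₃ * ε + 2 * c := by simp only [c]; ring
    rw [e]
    -- `1 ≤ (1 + 2 c) (1 - c)` for `0 ≤ c ≤ 1 / 2`
    have h4 : ∫ x, F (S x) ≤ (1 + 2 * c) * ((1 - c) * ∫ x, F (S x)) := by
      have : 0 ≤ c * (1 - 2 * c) * ∫ x, F (S x) :=
        mul_nonneg (mul_nonneg hcε0 (by linarith)) hI'
      linarith
    have h5 : (1 + 2 * c) * ((1 - c) * ∫ x, F (S x)) ≤ (1 + 2 * c) * ∫ x, F x := by gcongr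
    have h6 : 0 ≤ K₃ * ε * ∫ x, F x := by positivity
    linarith
  · obtain ⟨ha, hb⟩ := hint F h1 h2 h3
    have hI : 0 ≤ ∫ x, F x := integral_nonneg h3
    have hI' : 0 ≤ ∫ x, F (S x) := integral_nonneg fun x => h3 _
    have hKε : 0 ≤ K₃ * ε := by positivity
    set c := C * K₃ * ε
    have e : (K₃ + 2 * C * K₃) * ε = K₃ * ε + 2 * c := by simp only [c]; ring
    rw [e]
    -- `(1 - c) (1 + c) ≤ 1`
    have h4 : (1 - c) * ((1 + c) * ∫ x, F (S x)) ≤ ∫ x, F (S x) := by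
      have : 0 ≤ c ^ 2 * ∫ x, F (S x) := by positivity
      linarith
    have h5 : (1 - c) * ∫ x, F x ≤ (1 - c) * ((1 + c) * ∫ x, F (S x)) :=
      mul_le_mul_of_nonneg_left hb (by linarith)
    have h6 : 0 ≤ (K₃ * ε + c) * ∫ x, F x := by positivity
    linarith

end Deformation

/-! ### Transplantation of test functions -/

section Pointwise

variable {N : ℕ}

theorem sq_sum_mul_le {a b : Fin N → ℝ} {K : ℝ} (ha : ∀ i, |a i| ≤ K) :
    (∑ i, a i * b i) ^ 2 ≤ N * K ^ 2 * ∑ i, b i ^ 2 := by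
  refine (Finset.sum_mul_sq_le_sq_mul_sq _ _ _).trans ?_
  gcongr
  have : ∀ i ∈ Finset.univ, a i ^ 2 ≤ K ^ 2 := fun i _ =>
    sq_le_sq' (abs_le.1 (ha i)).1 (abs_le.1 (ha i)).2
  refine (Finset.sum_le_sum this).trans ?_
  simp

theorem sum_ite_add_mul (ε : ℝ) (P : Fin N → Fin N → ℝ) (x : Fin N → ℝ) (i : Fin N) :
    ∑ k, ((if k = i then 1 else 0) + ε * P k i) * x k = x i + ε * ∑ k, P k i * x k := by
  simp [add_mul, Finset.sum_add_distrib, Finset.mul_sum, mul_assoc]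

theorem sq_add_mul_le {ε : ℝ} (h0 : 0 ≤ ε) (h1 : ε ≤ 1) (a r : ℝ) :
    (a + ε * r) ^ 2 ≤ (1 + ε) * a ^ 2 + 2 * ε * r ^ 2 := by
  have e : (1 + ε) * a ^ 2 + 2 * ε * r ^ 2 - (a + ε * r) ^ 2 =
      ε * (a - r) ^ 2 + ε * (1 - ε) * r ^ 2 := by ring
  have : 0 ≤ ε * (a - r) ^ 2 + ε * (1 - ε) * r ^ 2 := by
    have : 0 ≤ 1 - ε := by linarith
    positivity
  linarith

theorem le_sq_add_mul {ε : ℝ} (h0 : 0 ≤ ε) (a r : ℝ) :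
    (1 - ε) * a ^ 2 - ε * r ^ 2 ≤ (a + ε * r) ^ 2 := by
  have e : (a + ε * r) ^ 2 - ((1 - ε) * a ^ 2 - ε * r ^ 2) =
      ε * (a + r) ^ 2 + (ε * r) ^ 2 := by ring
  have : 0 ≤ ε * (a + r) ^ 2 + (ε * r) ^ 2 := by positivity
  linarith

/-- The square of the first order part in `ε` of the gradient of a transplanted rotation. -/
theorem sq_remainder_le {K ε : ℝ} (h0 : 0 ≤ ε) (h1 : ε ≤ 1) {P : Fin N → Fin N → ℝ}
    {H b : Fin N → ℝ} {B : Fin N → Fin N → ℝ} (hP : ∀ k i, |P k i| ≤ K) (hH : ∀ k, |H k| ≤ K)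
    (i j : Fin N) :
    (∑ k, H k * b k + ∑ l, P l j * B i l + ∑ k, P k i * B k j
      + ε * ∑ k, P k i * ∑ l, P l j * B k l) ^ 2 ≤
      4 * (2 * (N * K ^ 2) + (N * K ^ 2) ^ 2) * (∑ k, b k ^ 2 + ∑ k, ∑ l, B k l ^ 2) := by
  set T₀ := ∑ k, b k ^ 2
  set T₁ := ∑ k, ∑ l, B k l ^ 2
  set M := N * K ^ 2
  have hT₀ : 0 ≤ T₀ := by positivity
  have hT₁ : 0 ≤ T₁ := by positivity
  have hM : 0 ≤ M := by positivity
  have x1 : (∑ k, H k * b k) ^ 2 ≤ M * T₀ := sq_sum_mul_le hH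
  have x2 : (∑ l, P l j * B i l) ^ 2 ≤ M * T₁ := by
    refine (sq_sum_mul_le fun l => hP l j).trans (mul_le_mul_of_nonneg_left ?_ hM)
    exact Finset.single_le_sum (f := fun k => ∑ l, B k l ^ 2) (fun _ _ => by positivity)
      (Finset.mem_univ i)
  have x3 : (∑ k, P k i * B k j) ^ 2 ≤ M * T₁ := by
    refine (sq_sum_mul_le fun k => hP k i).trans (mul_le_mul_of_nonneg_left ?_ hM)
    refine Finset.sum_le_sum fun k _ => ?_
    exact Finset.single_le_sum (f := fun l => B k l ^ 2) (fun _ _ => by positivity)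
      (Finset.mem_univ j)
  have x4 : (ε * ∑ k, P k i * ∑ l, P l j * B k l) ^ 2 ≤ M ^ 2 * T₁ := by
    have y1 : (∑ k, P k i * ∑ l, P l j * B k l) ^ 2 ≤ M * ∑ k, (∑ l, P l j * B k l) ^ 2 :=
      sq_sum_mul_le fun k => hP k i
    have y2 : ∑ k, (∑ l, P l j * B k l) ^ 2 ≤ ∑ k, M * ∑ l, B k l ^ 2 :=
      Finset.sum_le_sum fun k _ => sq_sum_mul_le fun l => hP l j
    rw [← Finset.mul_sum] at y2
    have y3 : M * ∑ k, (∑ l, P l j * B k l) ^ 2 ≤ M * (M * T₁) :=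
      mul_le_mul_of_nonneg_left y2 hM
    rw [mul_pow]
    have : ε ^ 2 ≤ 1 := pow_le_one₀ h0 h1
    nlinarith [sq_nonneg (∑ k, P k i * ∑ l, P l j * B k l)]
  set X₁ := ∑ k, H k * b k
  set X₂ := ∑ l, P l j * B i l
  set X₃ := ∑ k, P k i * B k j
  set X₄ := ε * ∑ k, P k i * ∑ l, P l j * B k l
  have h4 : (X₁ + X₂ + X₃ + X₄) ^ 2 ≤ 4 * (X₁ ^ 2 + X₂ ^ 2 + X₃ ^ 2 + X₄ ^ 2) := by
    nlinarith [sq_nonneg (X₁ - X₂), sq_nonneg (X₁ - X₃), sq_nonneg (X₁ - X₄),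
      sq_nonneg (X₂ - X₃), sq_nonneg (X₂ - X₄), sq_nonneg (X₃ - X₄)]
  have h5 : 0 ≤ (M + M ^ 2) * T₀ := by positivity
  linarith

/-- The gradient of a transplanted rotation at a point, in terms of the values `b` and the
gradient `B` of the rotation at the image point. -/
def pullGrad (ε : ℝ) (P : Fin N → Fin N → ℝ) (H : Fin N → Fin N → Fin N → ℝ) (b : Fin N → ℝ)
    (B : Fin N → Fin N → ℝ) (i j : Fin N) : ℝ :=
  ∑ k, (ε * H k i j * b k + ((if k = i then 1 else 0) + ε * P k i) *
    ∑ l, ((if l = j then 1 else 0) + ε * P l j) * B k l)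

theorem pullGrad_eq (ε : ℝ) (P : Fin N → Fin N → ℝ) (H : Fin N → Fin N → Fin N → ℝ)
    (b : Fin N → ℝ) (B : Fin N → Fin N → ℝ) (i j : Fin N) :
    pullGrad ε P H b B i j = B i j + ε * (∑ k, H k i j * b k + ∑ l, P l j * B i l
      + ∑ k, P k i * B k j + ε * ∑ k, P k i * ∑ l, P l j * B k l) := by
  unfold pullGrad
  simp only [sum_ite_add_mul, Finset.sum_add_distrib, mul_add]
  have e : ∑ k, P k i * (ε * ∑ l, P l j * B k l) = ε * ∑ k, P k i * ∑ l, P l j * B k l := by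
    rw [Finset.mul_sum]
    exact Finset.sum_congr rfl fun k _ => by ring
  rw [e]
  have e2 : ∑ k, ε * H k i j * b k = ε * ∑ k, H k i j * b k := by
    rw [Finset.mul_sum]
    exact Finset.sum_congr rfl fun k _ => by ring
  rw [e2]
  ring

/-- Pointwise bounds for the transplanted quantities. -/
theorem exists_pointwise_bound (N : ℕ) (K : ℝ) :
    ∃ C > 0, ∀ ε : ℝ, 0 ≤ ε → ε ≤ 1 → ∀ (P : Fin N → Fin N → ℝ)
      (H : Fin N → Fin N → Fin N → ℝ) (b : Fin N → ℝ) (B : Fin N → Fin N → ℝ),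
      (∀ k i, |P k i| ≤ K) → (∀ k i j, |H k i j| ≤ K) →
      ∑ i, ∑ j, pullGrad ε P H b B i j ^ 2 ≤
        ∑ i, ∑ j, B i j ^ 2 + C * ε * (∑ k, b k ^ 2 + ∑ i, ∑ j, B i j ^ 2) ∧
      (∑ i, pullGrad ε P H b B i i) ^ 2 ≤
        (∑ i, B i i) ^ 2 + C * ε * (∑ k, b k ^ 2 + ∑ i, ∑ j, B i j ^ 2) ∧
      ∑ i, (∑ k, ((if k = i then 1 else 0) + ε * P k i) * b k) ^ 2 ≤
        (1 + C * ε) * ∑ k, b k ^ 2 ∧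
      (1 - C * ε) * ∑ k, b k ^ 2 ≤
        ∑ i, (∑ k, ((if k = i then 1 else 0) + ε * P k i) * b k) ^ 2 := by
  set M : ℝ := N * K ^ 2 with hM
  have hM0 : 0 ≤ M := by positivity
  set L : ℝ := 4 * (2 * M + M ^ 2) with hL
  have hL0 : 0 ≤ L := by positivity
  refine ⟨1 + N + 2 * (N * N * L) + 2 * (N * M), by positivity, ?_⟩
  intro ε h0 h1 P H b B hP hH
  set T₀ := ∑ k, b k ^ 2 with hT₀
  set T₁ := ∑ k, ∑ l, B k l ^ 2 with hT₁
  have hT₀0 : 0 ≤ T₀ := by positivity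
  have hT₁0 : 0 ≤ T₁ := by positivity
  let Rm : Fin N → Fin N → ℝ := fun i j => ∑ k, H k i j * b k + ∑ l, P l j * B i l
      + ∑ k, P k i * B k j + ε * ∑ k, P k i * ∑ l, P l j * B k l
  have hR : ∀ i j, Rm i j ^ 2 ≤ L * (T₀ + T₁) := fun i j =>
    sq_remainder_le h0 h1 hP (fun k => hH k i j) i j
  have hpg : ∀ i j, pullGrad ε P H b B i j = B i j + ε * Rm i j := fun i j =>
    pullGrad_eq ε P H b B i j
  have hrot : ∑ i, (∑ k, P k i * b k) ^ 2 ≤ N * M * T₀ := by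
    have : ∀ i ∈ Finset.univ, (∑ k, P k i * b k) ^ 2 ≤ M * T₀ := fun i _ =>
      sq_sum_mul_le fun k => hP k i
    refine (Finset.sum_le_sum this).trans ?_
    simp [mul_assoc]
  have hNL : 0 ≤ N * N * L := by positivity
  have hNM : 0 ≤ N * M := by positivity
  refine ⟨?_, ?_, ?_, ?_⟩
  · have h2 : ∑ i, ∑ j, pullGrad ε P H b B i j ^ 2 ≤
        ∑ i, ∑ j, ((1 + ε) * B i j ^ 2 + 2 * ε * (L * (T₀ + T₁))) := by
      refine Finset.sum_le_sum fun i _ => Finset.sum_le_sum fun j _ => ?_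
      rw [hpg]
      refine (sq_add_mul_le h0 h1 _ _).trans ?_
      have := hR i j
      gcongr
    have e : ∑ i, ∑ j, ((1 + ε) * B i j ^ 2 + 2 * ε * (L * (T₀ + T₁))) =
        (1 + ε) * T₁ + 2 * ε * (N * N * L) * (T₀ + T₁) := by
      simp only [Finset.sum_add_distrib, ← Finset.mul_sum, Finset.sum_const, Finset.card_univ,
        Fintype.card_fin, nsmul_eq_mul]
      ring
    rw [e] at h2
    have h3 : 0 ≤ (N + 2 * (N * M)) * ε * (T₀ + T₁) := by positivity
    have h4 : 0 ≤ ε * T₀ := by positivity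
    linarith
  · have h2 : ∑ i, pullGrad ε P H b B i i = ∑ i, B i i + ε * ∑ i, Rm i i := by
      simp only [hpg, Finset.sum_add_distrib, Finset.mul_sum]
    rw [h2]
    refine (sq_add_mul_le h0 h1 _ _).trans ?_
    have h3 : (∑ i, Rm i i) ^ 2 ≤ N * N * L * (T₀ + T₁) := by
      refine (sq_sum_le_card_mul_sum_sq).trans ?_
      have : ∑ i, Rm i i ^ 2 ≤ ∑ _i : Fin N, L * (T₀ + T₁) :=
        Finset.sum_le_sum fun i _ => hR i i
      rw [Finset.sum_const, Finset.card_univ, Fintype.card_fin, nsmul_eq_mul] at this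
      rw [Finset.card_univ, Fintype.card_fin, mul_assoc, mul_assoc]
      gcongr
    have h4 : (∑ i, B i i) ^ 2 ≤ N * T₁ := by
      refine (sq_sum_le_card_mul_sum_sq).trans ?_
      rw [Finset.card_univ, Fintype.card_fin]
      gcongr
      refine Finset.sum_le_sum fun i _ => ?_
      exact Finset.single_le_sum (f := fun j => B i j ^ 2) (fun _ _ => by positivity)
        (Finset.mem_univ i)
    have h5 : ε * (∑ i, B i i) ^ 2 ≤ ε * (N * T₁) := by gcongr
    have h6 : 2 * ε * (∑ i, Rm i i) ^ 2 ≤ 2 * ε * (N * N * L * (T₀ + T₁)) := by gcongr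
    have h7 : 0 ≤ (1 + 2 * (N * M)) * ε * (T₀ + T₁) := by positivity
    have h8 : 0 ≤ N * ε * T₀ := by positivity
    linarith
  · simp only [sum_ite_add_mul]
    have h2 : ∑ i, (b i + ε * ∑ k, P k i * b k) ^ 2 ≤
        ∑ i, ((1 + ε) * b i ^ 2 + 2 * ε * (∑ k, P k i * b k) ^ 2) :=
      Finset.sum_le_sum fun i _ => sq_add_mul_le h0 h1 _ _
    rw [Finset.sum_add_distrib, ← Finset.mul_sum, ← Finset.mul_sum] at h2
    have h3 : 2 * ε * ∑ i, (∑ k, P k i * b k) ^ 2 ≤ 2 * ε * (N * M * T₀) := by gcongr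
    have h4 : 0 ≤ (N + 2 * (N * N * L)) * ε * T₀ := by positivity
    linarith
  · simp only [sum_ite_add_mul]
    have h2 : ∑ i, ((1 - ε) * b i ^ 2 - ε * (∑ k, P k i * b k) ^ 2) ≤
        ∑ i, (b i + ε * ∑ k, P k i * b k) ^ 2 :=
      Finset.sum_le_sum fun i _ => le_sq_add_mul h0 _ _
    rw [Finset.sum_sub_distrib, ← Finset.mul_sum, ← Finset.mul_sum] at h2
    have h3 : ε * ∑ i, (∑ k, P k i * b k) ^ 2 ≤ ε * (N * M * T₀) := by gcongr
    have h4 : 0 ≤ (N + 2 * (N * N * L)) * ε * T₀ := by positivity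
    have h5 : 0 ≤ N * M * ε * T₀ := by positivity
    linarith

end Pointwise

section Pullback

variable {N : ℕ} {Ω Ω₁ Ω₂ : Set (Eucl N)} {ε K : ℝ}

/-- Composition with a deformation that maps the complement of `Ω₂` to the complement of `Ω₁`. -/
def compTest (D : SmallDeformation N ε K) (h : ∀ y, D.S y ∈ Ω₁ → y ∈ Ω₂) :
    TestFun Ω₁ →ₗ[ℝ] TestFun Ω₂ where
  toFun f := ⟨fun y => f.1 (D.S y), f.2.smooth.comp D.smooth, f.2.compact.comp_homeomorph D.S, by
    have : tsupport (f.1 ∘ D.S) = D.S ⁻¹' tsupport f.1 := tsupport_comp_eq_preimage f.1 D.S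
    exact this.trans_subset fun y hy => h y (f.2.support hy)⟩
  map_add' _ _ := rfl
  map_smul' _ _ := rfl

/-- Multiplication of test functions by a smooth function. -/
def mulTest (Ω : Set (Eucl N)) {a : Eucl N → ℝ} (ha : ContDiff ℝ ∞ a) :
    TestFun Ω →ₗ[ℝ] TestFun Ω where
  toFun f := ⟨fun y => a y * f.1 y, ha.mul f.2.smooth, f.2.compact.mul_left,
    (tsupport_mul_subset_right).trans f.2.support⟩
  map_add' f g := by ext y; exact mul_add _ _ _
  map_smul' c f := by ext y; exact mul_left_comm _ _ _

theorem partialDeriv_mul {a f : Eucl N → ℝ} {y : Eucl N} (ha : DifferentiableAt ℝ a y)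
    (hf : DifferentiableAt ℝ f y) (j : Fin N) :
    partialDeriv j (fun y => a y * f y) y =
      partialDeriv j a y * f y + a y * partialDeriv j f y := by
  unfold partialDeriv
  have h : HasFDerivAt (fun y => a y * f y) _ y := ha.hasFDerivAt.mul hf.hasFDerivAt
  rw [h.fderiv]
  simp
  ring

theorem partialDeriv_comp {f : Eucl N → ℝ} {S : Eucl N → Eucl N} {y : Eucl N}
    (hf : DifferentiableAt ℝ f (S y)) (hS : DifferentiableAt ℝ S y) (j : Fin N) :
    partialDeriv j (fun y => f (S y)) y =
      ∑ l, partialDeriv j (fun x => S x l) y * partialDeriv l f (S y) := by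
  have h : ∀ l, partialDeriv j (fun x => S x l) y =
      (fderiv ℝ S y (EuclideanSpace.single j 1)) l := by
    intro l
    have h : HasFDerivAt (fun x => S x l)
        ((EuclideanSpace.proj l : Eucl N →L[ℝ] ℝ).comp (fderiv ℝ S y)) y :=
      (EuclideanSpace.proj l : Eucl N →L[ℝ] ℝ).hasFDerivAt.comp y hS.hasFDerivAt
    simp [partialDeriv, h.fderiv]
  simp only [h]
  rw [← fderiv_apply_eq_sum]
  unfold partialDeriv
  have h2 : HasFDerivAt (fun y => f (S y)) _ y := hf.hasFDerivAt.comp y hS.hasFDerivAt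
  rw [h2.fderiv]
  rfl

/-- The entry `∂_i S_k` of the Jacobian matrix of a small deformation. -/
def SmallDeformation.jac (D : SmallDeformation N ε K) (k i : Fin N) (y : Eucl N) : ℝ :=
  (if k = i then 1 else 0) + ε * D.P k i y

theorem SmallDeformation.contDiff_jac (D : SmallDeformation N ε K) (k i : Fin N) :
    ContDiff ℝ ∞ (D.jac k i) :=
  contDiff_const.add (contDiff_const.mul (D.smooth_P k i))

theorem SmallDeformation.partialDeriv_jac (D : SmallDeformation N ε K) (k i j : Fin N)
    (y : Eucl N) : partialDeriv j (D.jac k i) y = ε * partialDeriv j (D.P k i) y := by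
  have h := (((D.smooth_P k i).differentiable (by simp) y).hasFDerivAt.const_mul ε).const_add
    (if k = i then (1 : ℝ) else 0)
  have h' : HasFDerivAt (D.jac k i) _ y := h
  unfold partialDeriv
  rw [h'.fderiv]
  simp

/-- The transplantation of `(β, w)` by a deformation `S`: the displacement `w` is composed with `S`
and the rotation `β` is pulled back as a differential form, so that `∇w - β` is pulled back as a
differential form, too. -/
def pullback (D : SmallDeformation N ε K) (h : ∀ y, D.S y ∈ Ω₁ → y ∈ Ω₂) :
    TestState Ω₁ →ₗ[ℝ] TestState Ω₂ :=
  LinearMap.prodMap (LinearMap.pi fun i => ∑ k, mulTest Ω₂ (D.contDiff_jac k i) ∘ₗ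
    compTest D h ∘ₗ LinearMap.proj k) (compTest D h)

theorem pullback_fst (D : SmallDeformation N ε K) (h : ∀ y, D.S y ∈ Ω₁ → y ∈ Ω₂)
    (u : TestState Ω₁) (i : Fin N) : (pullback D h u).1 i =
      ∑ k, mulTest Ω₂ (D.contDiff_jac k i) (compTest D h (u.1 k)) := by
  simp [pullback]

theorem pullback_fst_apply (D : SmallDeformation N ε K) (h : ∀ y, D.S y ∈ Ω₁ → y ∈ Ω₂)
    (u : TestState Ω₁) (i : Fin N) (y : Eucl N) : ((pullback D h u).1 i).1 y =
      ∑ k, D.jac k i y * (u.1 k).1 (D.S y) := by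
  rw [pullback_fst, Submodule.coe_sum, Finset.sum_apply]
  rfl

theorem partialDeriv_compTest (D : SmallDeformation N ε K) (h : ∀ y, D.S y ∈ Ω₁ → y ∈ Ω₂)
    (f : TestFun Ω₁) (j : Fin N) (y : Eucl N) : partialDeriv j (compTest D h f).1 y =
      ∑ l, D.jac l j y * partialDeriv l f.1 (D.S y) := by
  have := partialDeriv_comp (S := D.S) (y := y) (IsTest.differentiable f.2 (D.S y))
    (D.smooth.differentiable (by simp) y) j
  simp only [D.partialDeriv_S] at this
  exact this

theorem partialDeriv_pullback_fst (D : SmallDeformation N ε K) (h : ∀ y, D.S y ∈ Ω₁ → y ∈ Ω₂)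
    (u : TestState Ω₁) (i j : Fin N) (y : Eucl N) :
    partialDeriv j ((pullback D h u).1 i).1 y =
      pullGrad ε (fun k i => D.P k i y) (fun k i j => partialDeriv j (D.P k i) y)
        (fun k => (u.1 k).1 (D.S y)) (fun k l => partialDeriv l (u.1 k).1 (D.S y)) i j := by
  rw [← testPartial_apply, pullback_fst, map_sum, Submodule.coe_sum, Finset.sum_apply, pullGrad]
  refine Finset.sum_congr rfl fun k _ => ?_
  rw [testPartial_apply]
  have := partialDeriv_mul (y := y) ((D.contDiff_jac k i).differentiable (by simp) y)
    (IsTest.differentiable (compTest D h (u.1 k)).2 y) j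
  rw [partialDeriv_compTest, D.partialDeriv_jac] at this
  exact this

/-- The square of a function, in `C_c(Ω)`. -/
def ccSq (f : CcFun Ω) : CcFun Ω :=
  ⟨fun x => f.1 x ^ 2, f.2.1.pow 2, by
    have : (fun x => f.1 x ^ 2) = f.1 * f.1 := by funext x; exact sq _
    rw [this]
    exact f.2.2.1.mul_left, by
    have : (fun x => f.1 x ^ 2) = f.1 * f.1 := by funext x; exact sq _
    rw [this]
    exact tsupport_mul_subset_right.trans f.2.2.2⟩

/-- The integral as a linear form on `C_c(Ω)`. -/
def ccInt (Ω : Set (Eucl N)) : CcFun Ω →ₗ[ℝ] ℝ where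
  toFun f := ∫ x, f.1 x
  map_add' f g := integral_add (f.2.1.integrable_of_hasCompactSupport f.2.2.1)
    (g.2.1.integrable_of_hasCompactSupport g.2.2.1)
  map_smul' c _ := integral_const_mul c _

theorem ccInt_ccSq (f : CcFun Ω) : ccInt Ω (ccSq f) = ‖toL2 Ω f‖ ^ 2 := (norm_sq_toL2 f).symm

theorem ccInt_nonneg {f : CcFun Ω} (h : ∀ x, 0 ≤ f.1 x) : 0 ≤ ccInt Ω f := integral_nonneg h

/-- The density `|∇β|²`. -/
def gradSq (u : TestState Ω) : CcFun Ω := ∑ i, ∑ j, ccSq (testPartial Ω j (u.1 i))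

/-- The density `(div β)²`. -/
def divSq (u : TestState Ω) : CcFun Ω := ccSq (∑ i, testPartial Ω i (u.1 i))

/-- The density `|∇w - β|²`. -/
def shearSq (u : TestState Ω) : CcFun Ω := ∑ i, ccSq (testPartial Ω i u.2 - testToCc Ω (u.1 i))

/-- The density `|β|²`. -/
def rotSq (u : TestState Ω) : CcFun Ω := ∑ i, ccSq (testToCc Ω (u.1 i))

/-- The density `w²`. -/
def dispSq (u : TestState Ω) : CcFun Ω := ccSq (testToCc Ω u.2)

theorem gradSq_apply (u : TestState Ω) (x : Eucl N) :
    (gradSq u).1 x = ∑ i, ∑ j, partialDeriv j (u.1 i).1 x ^ 2 := by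
  simp [gradSq, ccSq]

theorem divSq_apply (u : TestState Ω) (x : Eucl N) :
    (divSq u).1 x = (∑ i, partialDeriv i (u.1 i).1 x) ^ 2 := by
  simp [divSq, ccSq]

theorem shearSq_apply (u : TestState Ω) (x : Eucl N) :
    (shearSq u).1 x = ∑ i, (partialDeriv i u.2.1 x - (u.1 i).1 x) ^ 2 := by
  simp [shearSq, ccSq]

theorem rotSq_apply (u : TestState Ω) (x : Eucl N) :
    (rotSq u).1 x = ∑ i, (u.1 i).1 x ^ 2 := by
  simp [rotSq, ccSq]

theorem dispSq_apply (u : TestState Ω) (x : Eucl N) : (dispSq u).1 x = u.2.1 x ^ 2 := rfl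

theorem form_testState (lam μ k t : ℝ) (u : TestState Ω) :
    form lam μ k t (testStateAux Ω u) (testStateAux Ω u) =
      μ / 12 * ccInt Ω (gradSq u) + (μ + lam) / 12 * ccInt Ω (divSq u)
        + μ * k / t ^ 2 * ccInt Ω (shearSq u) := by
  simp only [gradSq, divSq, shearSq, map_sum, ccInt_ccSq, ← real_inner_self_eq_norm_sq, map_sub]
  rfl

theorem massForm_testState (t : ℝ) (u : TestState Ω) :
    massForm t (testStateAux Ω u) (testStateAux Ω u) =
      ccInt Ω (dispSq u) + t ^ 2 / 12 * ccInt Ω (rotSq u) := by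
  simp only [dispSq, rotSq, map_sum, ccInt_ccSq, ← real_inner_self_eq_norm_sq]
  rfl

theorem ccInt_rotSq_le {i₀ : Fin N} {R : ℝ} (hΩ : ∀ x ∈ Ω, |x i₀| ≤ R) (u : TestState Ω) :
    ccInt Ω (rotSq u) ≤ 4 * R ^ 2 * ccInt Ω (gradSq u) := by
  simp only [rotSq, gradSq, map_sum]
  rw [Finset.mul_sum]
  refine Finset.sum_le_sum fun i _ => (integral_sq_le_of_slab hΩ (u.1 i)).trans ?_
  gcongr
  exact Finset.single_le_sum (f := fun j => ccInt Ω (ccSq (testPartial Ω j (u.1 i))))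
    (fun j _ => ccInt_nonneg fun x => sq_nonneg _) (Finset.mem_univ i₀)

/-- Integration of pointwise upper bounds for transplanted quantities. -/
theorem ccInt_le_of_comp (D : SmallDeformation N ε K) {f : CcFun Ω₂} {g : CcFun Ω₁}
    (hg : ∀ x, 0 ≤ g.1 x) (hfg : ∀ y, f.1 y ≤ g.1 (D.S y)) :
    ccInt Ω₂ f ≤ (1 + K * ε) * ccInt Ω₁ g := by
  refine le_trans ?_ (D.integral_comp_le g.1 g.2.1 g.2.2.1 hg)
  exact integral_mono (f.2.1.integrable_of_hasCompactSupport f.2.2.1)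
    ((g.2.1.comp D.S.continuous).integrable_of_hasCompactSupport
      (g.2.2.1.comp_homeomorph D.S)) hfg

/-- Integration of pointwise lower bounds for transplanted quantities. -/
theorem le_ccInt_of_comp (D : SmallDeformation N ε K) {f : CcFun Ω₂} {g : CcFun Ω₁}
    (hg : ∀ x, 0 ≤ g.1 x) (hfg : ∀ y, g.1 (D.S y) ≤ f.1 y) :
    (1 - K * ε) * ccInt Ω₁ g ≤ ccInt Ω₂ f := by
  refine le_trans (D.le_integral_comp g.1 g.2.1 g.2.2.1 hg) ?_
  exact integral_mono ((g.2.1.comp D.S.continuous).integrable_of_hasCompactSupport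
      (g.2.2.1.comp_homeomorph D.S))
    (f.2.1.integrable_of_hasCompactSupport f.2.2.1) hfg

end Pullback

section TransplantBound

variable {N : ℕ}

/-- Transplantation by a small deformation changes the energy and the mass of test functions at
most by a factor `1 ± C ε`, uniformly in `k` and `t`. The second derivatives of the deformation
contribute a multiple of `∫ |β|²`, which the Poincaré inequality absorbs in `∫ |∇β|²`. -/
theorem exists_transplant_bound (i₀ : Fin N) (R : ℝ) {K lam μ : ℝ} (hK : 0 < K) (hlam : 0 < lam)
    (hμ : 0 < μ) :
    ∃ C > 0, ∃ ε₀ > 0, ∀ ε, 0 < ε → ε < ε₀ → ∀ (D : SmallDeformation N ε K) (Ω₁ Ω₂ : Set (Eucl N))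
      (_ : ∀ x ∈ Ω₁, |x i₀| ≤ R) (h : ∀ y, D.S y ∈ Ω₁ → y ∈ Ω₂) (k t : ℝ), 0 < k → 0 < t →
      ∀ u : TestState Ω₁,
        form lam μ k t (testStateAux Ω₂ (pullback D h u)) (testStateAux Ω₂ (pullback D h u)) ≤
          (1 + C * ε) * form lam μ k t (testStateAux Ω₁ u) (testStateAux Ω₁ u) ∧
        (1 - C * ε) * massForm t (testStateAux Ω₁ u) (testStateAux Ω₁ u) ≤
          massForm t (testStateAux Ω₂ (pullback D h u)) (testStateAux Ω₂ (pullback D h u)) := by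
  obtain ⟨C₀, hC₀, hpt⟩ := exists_pointwise_bound N K
  set c₁ := C₀ * (4 * R ^ 2 + 1) with hc₁
  have hc₁0 : C₀ ≤ c₁ := by nlinarith [sq_nonneg R]
  have hc₁p : 0 < c₁ := hC₀.trans_le hc₁0
  set C₁ := K + c₁ + K * c₁ with hC₁
  have hC₁0 : 0 < C₁ := by positivity
  refine ⟨C₁ * (1 + (μ + lam) / μ), by positivity, min 1 (1 / C₀), by positivity, ?_⟩
  intro ε hε hε0 D Ω₁ Ω₂ hΩ h k t hk ht u
  obtain ⟨hε1, hε2⟩ := lt_min_iff.1 hε0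
  rw [lt_div_iff₀ hC₀] at hε2
  have hKε : 0 ≤ K * ε := by positivity
  have hεε : ε ^ 2 ≤ ε := by nlinarith
  have hpt' := fun y (b : Fin N → ℝ) (B : Fin N → Fin N → ℝ) =>
    hpt ε hε.le hε1.le (fun k i => D.P k i y) (fun k i j => partialDeriv j (D.P k i) y) b B
      (fun k i => D.abs_P_le k i y) (fun k i j => D.abs_partialDeriv_P_le k i j y)
  have nG : ∀ x, 0 ≤ (gradSq u).1 x := fun x => by rw [gradSq_apply]; positivity
  have nV : ∀ x, 0 ≤ (divSq u).1 x := fun x => by rw [divSq_apply]; positivity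
  have nS : ∀ x, 0 ≤ (shearSq u).1 x := fun x => by rw [shearSq_apply]; positivity
  have nB : ∀ x, 0 ≤ (rotSq u).1 x := fun x => by rw [rotSq_apply]; positivity
  have nW : ∀ x, 0 ≤ (dispSq u).1 x := fun x => by rw [dispSq_apply]; positivity
  have hcoe : ∀ (f g : CcFun Ω₁) (c : ℝ) (x : Eucl N), (f + c • g).1 x = f.1 x + c * g.1 x :=
    fun _ _ _ _ => rfl
  have hcoe' : ∀ (f g : CcFun Ω₁) (x : Eucl N), (f + g).1 x = f.1 x + g.1 x :=
    fun _ _ _ => rfl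
  have hcoe'' : ∀ (f : CcFun Ω₁) (c : ℝ) (x : Eucl N), (c • f).1 x = c * f.1 x :=
    fun _ _ _ => rfl
  have b1 := ccInt_le_of_comp D (f := gradSq (pullback D h u))
    (g := gradSq u + (C₀ * ε) • (rotSq u + gradSq u))
    (fun x => by
      rw [hcoe, hcoe']
      exact add_nonneg (nG x) (mul_nonneg (by positivity) (add_nonneg (nB x) (nG x))))
    (fun y => by
      rw [hcoe, hcoe', gradSq_apply, gradSq_apply, rotSq_apply]
      simp only [partialDeriv_pullback_fst]
      exact (hpt' y _ _).1)
  have b2 := ccInt_le_of_comp D (f := divSq (pullback D h u))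
    (g := divSq u + (C₀ * ε) • (rotSq u + gradSq u))
    (fun x => by
      rw [hcoe, hcoe']
      exact add_nonneg (nV x) (mul_nonneg (by positivity) (add_nonneg (nB x) (nG x))))
    (fun y => by
      rw [hcoe, hcoe', gradSq_apply, divSq_apply, divSq_apply, rotSq_apply]
      simp only [partialDeriv_pullback_fst]
      exact (hpt' y _ _).2.1)
  have b3 := ccInt_le_of_comp D (f := shearSq (pullback D h u)) (g := (1 + C₀ * ε) • shearSq u)
    (fun x => by
      rw [hcoe'']
      exact mul_nonneg (by positivity) (nS x))
    (fun y => by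
      rw [hcoe'', shearSq_apply, shearSq_apply]
      have e : ∀ i, partialDeriv i (pullback D h u).2.1 y - ((pullback D h u).1 i).1 y =
          ∑ k, D.jac k i y * (partialDeriv k u.2.1 (D.S y) - (u.1 k).1 (D.S y)) := by
        intro i
        rw [pullback_fst_apply]
        have := partialDeriv_compTest D h u.2 i y
        simp only [mul_sub, Finset.sum_sub_distrib]
        rw [← this]
        rfl
      simp only [e]
      exact (hpt' y (fun k => partialDeriv k u.2.1 (D.S y) - (u.1 k).1 (D.S y)) 0).2.2.1)
  have b4 := le_ccInt_of_comp D (f := rotSq (pullback D h u)) (g := (1 - C₀ * ε) • rotSq u)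
    (fun x => by
      rw [hcoe'']
      exact mul_nonneg (by linarith) (nB x))
    (fun y => by
      rw [hcoe'', rotSq_apply, rotSq_apply]
      simp only [pullback_fst_apply]
      exact (hpt' y (fun k => (u.1 k).1 (D.S y)) 0).2.2.2)
  have b5 := le_ccInt_of_comp D (f := dispSq (pullback D h u)) (g := dispSq u) nW
    (fun y => le_of_eq rfl)
  simp only [map_add, map_smul, smul_eq_mul] at b1 b2 b3 b4
  have hP := ccInt_rotSq_le hΩ u
  have mG := ccInt_nonneg nG
  have mV := ccInt_nonneg nV
  have mS := ccInt_nonneg nS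
  have mB := ccInt_nonneg nB
  have mW := ccInt_nonneg nW
  rw [form_testState, form_testState, massForm_testState, massForm_testState]
  set G := ccInt Ω₁ (gradSq u)
  set V := ccInt Ω₁ (divSq u)
  set S := ccInt Ω₁ (shearSq u)
  set B := ccInt Ω₁ (rotSq u)
  set W := ccInt Ω₁ (dispSq u)
  have hcBG : C₀ * ε * (B + G) ≤ c₁ * ε * G := by
    have : C₀ * ε * B ≤ C₀ * ε * (4 * R ^ 2 * G) := by gcongr
    rw [hc₁]
    linarith
  have hKc : K * c₁ * ε ^ 2 ≤ K * c₁ * ε := by gcongr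
  have a1 : ccInt Ω₂ (gradSq (pullback D h u)) ≤ (1 + C₁ * ε) * G := by
    have h1 : (1 + K * ε) * (G + C₀ * ε * (B + G)) ≤ (1 + K * ε) * (G + c₁ * ε * G) := by gcongr
    have h2 : K * c₁ * ε ^ 2 * G ≤ K * c₁ * ε * G := by gcongr
    rw [hC₁]
    linarith
  have a2 : ccInt Ω₂ (divSq (pullback D h u)) ≤ (1 + C₁ * ε) * V + C₁ * ε * G := by
    have h1 : (1 + K * ε) * (V + C₀ * ε * (B + G)) ≤ (1 + K * ε) * (V + c₁ * ε * G) := by gcongr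
    have h2 : K * c₁ * ε ^ 2 * G ≤ K * c₁ * ε * G := by gcongr
    have h3 : 0 ≤ (c₁ + K * c₁) * ε * V + K * ε * G := by positivity
    rw [hC₁]
    linarith
  have a3 : ccInt Ω₂ (shearSq (pullback D h u)) ≤ (1 + C₁ * ε) * S := by
    have h1 : (1 + K * ε) * ((1 + C₀ * ε) * S) ≤ (1 + K * ε) * ((1 + c₁ * ε) * S) := by gcongr
    have h2 : K * c₁ * ε ^ 2 * S ≤ K * c₁ * ε * S := by gcongr
    rw [hC₁]
    linarith
  have hC₁K : (K + C₀) ≤ C₁ := by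
    have : 0 < K * c₁ := by positivity
    linarith
  set q := (μ + lam) / μ with hq
  have hq0 : 0 < q := by positivity
  have a4 : (1 - C₁ * (1 + q) * ε) * B ≤ ccInt Ω₂ (rotSq (pullback D h u)) := by
    have h1 : (1 - C₁ * (1 + q) * ε) * B ≤ (1 - K * ε) * ((1 - C₀ * ε) * B) := by
      have h2 : 0 ≤ (C₁ - (K + C₀)) * ε * B :=
        mul_nonneg (mul_nonneg (by linarith) hε.le) mB
      have h3 : 0 ≤ C₁ * q * ε * B + K * C₀ * ε ^ 2 * B := by positivity
      linarith
    exact h1.trans b4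
  have a5 : (1 - C₁ * (1 + q) * ε) * W ≤ ccInt Ω₂ (dispSq (pullback D h u)) := by
    have h1 : (1 - C₁ * (1 + q) * ε) * W ≤ (1 - K * ε) * W := by
      have h2 : 0 ≤ (C₁ - (K + C₀)) * ε * W :=
        mul_nonneg (mul_nonneg (by linarith) hε.le) mW
      have h3 : 0 ≤ C₁ * q * ε * W + C₀ * ε * W := by positivity
      linarith
    exact h1.trans b5
  constructor
  · have e1 : μ / 12 * ccInt Ω₂ (gradSq (pullback D h u)) ≤ μ / 12 * ((1 + C₁ * ε) * G) := by
      gcongr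
    have e2 : (μ + lam) / 12 * ccInt Ω₂ (divSq (pullback D h u)) ≤
        (μ + lam) / 12 * ((1 + C₁ * ε) * V + C₁ * ε * G) := by gcongr
    have e3 : μ * k / t ^ 2 * ccInt Ω₂ (shearSq (pullback D h u)) ≤
        μ * k / t ^ 2 * ((1 + C₁ * ε) * S) := by gcongr
    have e4 : (μ + lam) / 12 * (C₁ * ε * G) = C₁ * q * ε * (μ / 12 * G) := by
      rw [hq]
      field_simp
    have e5 : 0 ≤ C₁ * q * ε * ((μ + lam) / 12 * V + μ * k / t ^ 2 * S) := by positivity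
    linarith
  · have e1 : t ^ 2 / 12 * ((1 - C₁ * (1 + q) * ε) * B) ≤
        t ^ 2 / 12 * ccInt Ω₂ (rotSq (pullback D h u)) := by gcongr
    linarith

end TransplantBound

/-! ### The eigenvalue problem in Hilbert space -/

section Embeddings

variable {N : ℕ} {Ω : Set (Eucl N)}

/-- The component `β_i` of `(β, w)`. -/
def rotL (Ω : Set (Eucl N)) (i : Fin N) : State Ω →L[ℝ] L2 Ω :=
  (ContinuousLinearMap.fst ℝ (L2 Ω) (Fin N → L2 Ω)).comp
    ((ContinuousLinearMap.proj i).comp (ContinuousLinearMap.fst ℝ (Fin N → L2Pair Ω) (L2Pair Ω)))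

/-- The component `∂β_i/∂x_j` of `(β, w)`. -/
def rotGradL (Ω : Set (Eucl N)) (i j : Fin N) : State Ω →L[ℝ] L2 Ω :=
  (ContinuousLinearMap.proj j).comp ((ContinuousLinearMap.snd ℝ (L2 Ω) (Fin N → L2 Ω)).comp
    ((ContinuousLinearMap.proj i).comp (ContinuousLinearMap.fst ℝ (Fin N → L2Pair Ω) (L2Pair Ω))))

/-- The component `w` of `(β, w)`. -/
def dispL (Ω : Set (Eucl N)) : State Ω →L[ℝ] L2 Ω :=
  (ContinuousLinearMap.fst ℝ (L2 Ω) (Fin N → L2 Ω)).comp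
    (ContinuousLinearMap.snd ℝ (Fin N → L2Pair Ω) (L2Pair Ω))

/-- The component `∂w/∂x_j` of `(β, w)`. -/
def dispGradL (Ω : Set (Eucl N)) (j : Fin N) : State Ω →L[ℝ] L2 Ω :=
  (ContinuousLinearMap.proj j).comp ((ContinuousLinearMap.snd ℝ (L2 Ω) (Fin N → L2 Ω)).comp
    (ContinuousLinearMap.snd ℝ (Fin N → L2Pair Ω) (L2Pair Ω)))

/-- The index set of the terms of the energy: `∂β_i/∂x_j`, `div β` and `∂w/∂x_i - β_i`. -/
abbrev EnergyIndex (N : ℕ) : Type := (Fin N × Fin N) ⊕ Unit ⊕ Fin N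

/-- The map whose squared norm is the energy. -/
def energyEmb (lam μ k t : ℝ) (Ω : Set (Eucl N)) :
    energySpace Ω →L[ℝ] PiLp 2 (fun _ : EnergyIndex N => L2 Ω) :=
  ((PiLp.continuousLinearEquiv 2 ℝ (fun _ : EnergyIndex N => L2 Ω)).symm :
      (EnergyIndex N → L2 Ω) →L[ℝ] PiLp 2 (fun _ : EnergyIndex N => L2 Ω)).comp
    ((ContinuousLinearMap.pi (Sum.elim (fun p => √(μ / 12) • rotGradL Ω p.1 p.2)
      (Sum.elim (fun _ => √((μ + lam) / 12) • ∑ i, rotGradL Ω i i)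
        (fun i => √(μ * k / t ^ 2) • (dispGradL Ω i - rotL Ω i))))).comp (energySpace Ω).subtypeL)

/-- The map whose squared norm is the mass. -/
def massEmb (t : ℝ) (Ω : Set (Eucl N)) :
    energySpace Ω →L[ℝ] PiLp 2 (fun _ : Unit ⊕ Fin N => L2 Ω) :=
  ((PiLp.continuousLinearEquiv 2 ℝ (fun _ : Unit ⊕ Fin N => L2 Ω)).symm :
      (Unit ⊕ Fin N → L2 Ω) →L[ℝ] PiLp 2 (fun _ : Unit ⊕ Fin N => L2 Ω)).comp
    ((ContinuousLinearMap.pi (Sum.elim (fun _ => dispL Ω)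
      (fun i => √(t ^ 2 / 12) • rotL Ω i))).comp (energySpace Ω).subtypeL)

theorem inner_energyEmb {lam μ k t : ℝ} (hlam : 0 < lam) (hμ : 0 < μ) (hk : 0 < k)
    (u v : energySpace Ω) :
    inner ℝ (energyEmb lam μ k t Ω u) (energyEmb lam μ k t Ω v) =
      form lam μ k t (u : State Ω) (v : State Ω) := by
  have h1 : √(μ / 12) * √(μ / 12) = μ / 12 := Real.mul_self_sqrt (by positivity)
  have h2 : √((μ + lam) / 12) * √((μ + lam) / 12) = (μ + lam) / 12 :=
    Real.mul_self_sqrt (by positivity)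
  have h3 : √(μ * k / t ^ 2) * √(μ * k / t ^ 2) = μ * k / t ^ 2 :=
    Real.mul_self_sqrt (by positivity)
  rw [PiLp.inner_apply, Fintype.sum_sum_type, Fintype.sum_sum_type, Fintype.sum_prod_type]
  have e1 : ∀ i j, inner ℝ (energyEmb lam μ k t Ω u (Sum.inl (i, j)))
      (energyEmb lam μ k t Ω v (Sum.inl (i, j))) =
      μ / 12 * inner ℝ ((u.1.1 i).2 j) ((v.1.1 i).2 j) := by
    intro i j
    change inner ℝ (√(μ / 12) • (u.1.1 i).2 j) (√(μ / 12) • (v.1.1 i).2 j) = _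
    rw [inner_smul_left, inner_smul_right, ← mul_assoc]
    simp only [conj_trivial, h1]
  have e2 : ∀ x : Unit, inner ℝ (energyEmb lam μ k t Ω u (Sum.inr (Sum.inl x)))
      (energyEmb lam μ k t Ω v (Sum.inr (Sum.inl x))) =
      (μ + lam) / 12 * inner ℝ (∑ i, (u.1.1 i).2 i) (∑ i, (v.1.1 i).2 i) := by
    intro x
    have : ∀ w : State Ω, (∑ i, rotGradL Ω i i) w = ∑ i, (w.1 i).2 i := fun w => by
      rw [sum_apply]
      rfl
    change inner ℝ (√((μ + lam) / 12) • (∑ i, rotGradL Ω i i) u.1)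
      (√((μ + lam) / 12) • (∑ i, rotGradL Ω i i) v.1) = _
    rw [inner_smul_left, inner_smul_right, ← mul_assoc, this, this]
    simp only [conj_trivial, h2]
  have e3 : ∀ i, inner ℝ (energyEmb lam μ k t Ω u (Sum.inr (Sum.inr i)))
      (energyEmb lam μ k t Ω v (Sum.inr (Sum.inr i))) =
      μ * k / t ^ 2 * inner ℝ (u.1.2.2 i - (u.1.1 i).1) (v.1.2.2 i - (v.1.1 i).1) := by
    intro i
    change inner ℝ (√(μ * k / t ^ 2) • (u.1.2.2 i - (u.1.1 i).1))
      (√(μ * k / t ^ 2) • (v.1.2.2 i - (v.1.1 i).1)) = _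
    rw [inner_smul_left, inner_smul_right, ← mul_assoc]
    simp only [conj_trivial, h3]
  simp only [e1, e2, e3, form, Finset.univ_unique, Finset.sum_singleton, Finset.mul_sum]
  ring

theorem inner_massEmb (t : ℝ) (u v : energySpace Ω) :
    inner ℝ (massEmb t Ω u) (massEmb t Ω v) = massForm t (u : State Ω) (v : State Ω) := by
  have h1 : √(t ^ 2 / 12) * √(t ^ 2 / 12) = t ^ 2 / 12 := Real.mul_self_sqrt (by positivity)
  rw [PiLp.inner_apply, Fintype.sum_sum_type]
  have e1 : ∀ x : Unit, inner ℝ (massEmb t Ω u (Sum.inl x)) (massEmb t Ω v (Sum.inl x)) =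
      inner ℝ u.1.2.1 v.1.2.1 := fun _ => rfl
  have e2 : ∀ i, inner ℝ (massEmb t Ω u (Sum.inr i)) (massEmb t Ω v (Sum.inr i)) =
      t ^ 2 / 12 * inner ℝ (u.1.1 i).1 (v.1.1 i).1 := by
    intro i
    change inner ℝ (√(t ^ 2 / 12) • (u.1.1 i).1) (√(t ^ 2 / 12) • (v.1.1 i).1) = _
    rw [inner_smul_left, inner_smul_right, ← mul_assoc]
    simp only [conj_trivial, h1]
  simp only [e1, e2, massForm, Finset.univ_unique, Finset.sum_singleton, Finset.mul_sum]

theorem norm_sq_energyEmb {lam μ k t : ℝ} (hlam : 0 < lam) (hμ : 0 < μ) (hk : 0 < k)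
    (u : energySpace Ω) :
    ‖energyEmb lam μ k t Ω u‖ ^ 2 = form lam μ k t (u : State Ω) (u : State Ω) := by
  rw [← real_inner_self_eq_norm_sq, inner_energyEmb hlam hμ hk]

theorem norm_sq_massEmb (t : ℝ) (u : energySpace Ω) :
    ‖massEmb t Ω u‖ ^ 2 = massForm t (u : State Ω) (u : State Ω) := by
  rw [← real_inner_self_eq_norm_sq, inner_massEmb]

/-- The Poincaré inequality in `H¹₀(Ω)`. -/
theorem norm_fst_le_of_mem_H10 {i₀ : Fin N} {R : ℝ} (hR : 0 ≤ R) (hΩ : ∀ x ∈ Ω, |x i₀| ≤ R)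
    {p : L2Pair Ω} (hp : p ∈ H10 Ω) : ‖p.1‖ ≤ 2 * R * ‖p.2 i₀‖ := by
  have hsub : (H10 Ω : Set (L2Pair Ω)) ⊆ {p | ‖p.1‖ ≤ 2 * R * ‖p.2 i₀‖} := by
    rw [coe_H10]
    refine closure_minimal ?_ (isClosed_le (by fun_prop) (by fun_prop))
    rintro _ ⟨φ, rfl⟩
    change ‖(testPair Ω φ).1‖ ≤ 2 * R * ‖(testPair Ω φ).2 i₀‖
    refine le_of_sq_le_sq ?_ (by positivity)
    have h1 : ‖(testPair Ω φ).1‖ ^ 2 = ∫ x, φ.1 x ^ 2 := norm_sq_toL2 (testToCc Ω φ)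
    have h2 : ‖(testPair Ω φ).2 i₀‖ ^ 2 = ∫ x, partialDeriv i₀ φ.1 x ^ 2 :=
      norm_sq_toL2 (testPartial Ω i₀ φ)
    rw [mul_pow, h1, h2]
    refine (integral_sq_le_of_slab hΩ φ).trans_eq ?_
    ring
  exact hsub hp

/-- The energy is coercive on the energy space. -/
theorem exists_norm_le_energyEmb {μ k t : ℝ} (lam : ℝ) (hμ : 0 < μ) (hk : 0 < k)
    (ht : 0 < t) {i₀ : Fin N} {R : ℝ} (hR : 0 ≤ R) (hΩ : ∀ x ∈ Ω, |x i₀| ≤ R) :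
    ∃ C : ℝ, 0 ≤ C ∧ ∀ u : energySpace Ω, ‖u‖ ≤ C * ‖energyEmb lam μ k t Ω u‖ := by
  set a := (√(μ / 12))⁻¹ with ha
  set g := (√(μ * k / t ^ 2))⁻¹ with hg
  have ha0 : 0 ≤ a := by positivity
  have hg0 : 0 ≤ g := by positivity
  set c := a + 2 * R * a + (g + 2 * R * a) + 2 * R * (g + 2 * R * a) with hc
  have hc0 : 0 ≤ c := by positivity
  refine ⟨c, hc0, fun u => ?_⟩
  set q := ‖energyEmb lam μ k t Ω u‖
  have hq0 : 0 ≤ q := norm_nonneg _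
  have hcomp : ∀ x, ‖energyEmb lam μ k t Ω u x‖ ≤ q := fun x => PiLp.norm_apply_le _ x
  have h1 : ∀ i j, ‖(u.1.1 i).2 j‖ ≤ a * q := by
    intro i j
    have h : ‖√(μ / 12) • (u.1.1 i).2 j‖ ≤ q := hcomp (Sum.inl (i, j))
    rw [norm_smul, Real.norm_of_nonneg (Real.sqrt_nonneg _)] at h
    rw [ha, inv_mul_eq_div, le_div_iff₀ (by positivity), mul_comm]
    exact h
  have h2 : ∀ i, ‖(u.1.1 i).1‖ ≤ 2 * R * (a * q) := fun i => by
    refine (norm_fst_le_of_mem_H10 hR hΩ (u.2.1 i (mem_univ i))).trans ?_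
    have := h1 i i₀
    gcongr
  have h3 : ∀ i, ‖u.1.2.2 i - (u.1.1 i).1‖ ≤ g * q := by
    intro i
    have h : ‖√(μ * k / t ^ 2) • (u.1.2.2 i - (u.1.1 i).1)‖ ≤ q := hcomp (Sum.inr (Sum.inr i))
    rw [norm_smul, Real.norm_of_nonneg (Real.sqrt_nonneg _)] at h
    rw [hg, inv_mul_eq_div, le_div_iff₀ (by positivity), mul_comm]
    exact h
  have h4 : ∀ i, ‖u.1.2.2 i‖ ≤ (g + 2 * R * a) * q := by
    intro i
    have := norm_add_le (u.1.2.2 i - (u.1.1 i).1) (u.1.1 i).1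
    rw [sub_add_cancel] at this
    linarith [h2 i, h3 i]
  have h5 : ‖u.1.2.1‖ ≤ 2 * R * ((g + 2 * R * a) * q) := by
    refine (norm_fst_le_of_mem_H10 hR hΩ u.2.2).trans ?_
    have := h4 i₀
    gcongr
  have t1 : 0 ≤ a * q := by positivity
  have t2 : 0 ≤ 2 * R * (a * q) := by positivity
  have t3 : 0 ≤ (g + 2 * R * a) * q := by positivity
  have t4 : 0 ≤ 2 * R * ((g + 2 * R * a) * q) := by positivity
  have hcq : c * q = a * q + 2 * R * (a * q) + (g + 2 * R * a) * q +
      2 * R * ((g + 2 * R * a) * q) := by rw [hc]; ring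
  have hcq0 : 0 ≤ c * q := by positivity
  change ‖(u : State Ω)‖ ≤ c * q
  refine max_le ((pi_norm_le_iff_of_nonneg hcq0).2 fun i => max_le ?_
    ((pi_norm_le_iff_of_nonneg hcq0).2 fun j => ?_)) (max_le ?_
    ((pi_norm_le_iff_of_nonneg hcq0).2 fun j => ?_))
  · linarith [h2 i]
  · linarith [h1 i j]
  · linarith [h5]
  · linarith [h4 j]

/-- A map into a finite product is compact if its components are. -/
theorem isCompactOperator_toLp_pi {ι M F : Type*} [Fintype ι] [Zero M] [TopologicalSpace M]
    [NormedAddCommGroup F] {f : ι → M → F} (hf : ∀ i, IsCompactOperator (f i)) :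
    IsCompactOperator fun x => WithLp.toLp 2 fun i => f i x := by
  choose S hS hfS using hf
  refine ⟨WithLp.toLp 2 '' univ.pi S,
    (isCompact_univ_pi hS).image (PiLp.continuous_toLp 2 _), ?_⟩
  filter_upwards [Filter.iInter_mem.2 hfS] with x hx
  exact ⟨_, fun i _ => mem_iInter.1 hx i, rfl⟩

theorem isCompactOperator_massEmb (hΩo : IsOpen Ω) (hΩ : Bornology.IsBounded Ω) (t : ℝ) :
    IsCompactOperator (massEmb t Ω) := by
  have hemb := isCompactOperator_embL2 hΩo hΩ
  let p₁ : energySpace Ω →L[ℝ] H10 Ω :=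
    ((ContinuousLinearMap.snd ℝ (Fin N → L2Pair Ω) (L2Pair Ω)).comp
      (energySpace Ω).subtypeL).codRestrict (H10 Ω) fun u => u.2.2
  let p₂ : Fin N → energySpace Ω →L[ℝ] H10 Ω := fun i =>
    ((ContinuousLinearMap.proj i).comp ((ContinuousLinearMap.fst ℝ (Fin N → L2Pair Ω)
      (L2Pair Ω)).comp (energySpace Ω).subtypeL)).codRestrict (H10 Ω) fun u => u.2.1 i (mem_univ i)
  have h1 : IsCompactOperator fun u : energySpace Ω => dispL Ω u := hemb.comp_clm p₁
  have h2 : ∀ i, IsCompactOperator fun u : energySpace Ω => √(t ^ 2 / 12) • rotL Ω i u := fun i =>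
    (hemb.comp_clm (p₂ i)).smul (√(t ^ 2 / 12))
  have h3 := isCompactOperator_toLp_pi (f := fun x : Unit ⊕ Fin N =>
    Sum.elim (fun _ (u : energySpace Ω) => dispL Ω u)
      (fun i (u : energySpace Ω) => √(t ^ 2 / 12) • rotL Ω i u) x) (by
    rintro (x | i)
    · exact h1
    · exact h2 i)
  convert h3 using 1
  funext u
  ext x
  rcases x with x | i <;> rfl

/-- The eigenvalue counting condition in the definition of `eigenvalue`, in Hilbert space terms. -/
theorem rank_span_eigenvector {lam μ k t : ℝ} (hlam : 0 < lam) (hμ : 0 < μ) (hk : 0 < k) (Λ : ℝ) :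
    Module.rank ℝ (Submodule.span ℝ {u : State Ω | ∃ γ ≤ Λ, IsEigenvector lam μ k t γ u}) =
      Module.rank ℝ (Submodule.span ℝ
        (eigenvectorSet (energyEmb lam μ k t Ω) (massEmb t Ω) Λ)) := by
  have h : {u : State Ω | ∃ γ ≤ Λ, IsEigenvector lam μ k t γ u} =
      (energySpace Ω).subtype '' eigenvectorSet (energyEmb lam μ k t Ω) (massEmb t Ω) Λ := by
    ext u
    constructor
    · rintro ⟨γ, hγ, hu, hu0, h⟩
      refine ⟨⟨u, hu⟩, ⟨fun h0 => hu0 (congrArg Subtype.val h0), γ, hγ, fun v => ?_⟩, rfl⟩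
      rw [inner_energyEmb hlam hμ hk, inner_massEmb]
      exact h v v.2
    · rintro ⟨u, ⟨hu0, γ, hγ, h⟩, rfl⟩
      refine ⟨γ, hγ, u.2, fun h0 => hu0 (Subtype.ext h0), fun v hv => ?_⟩
      have := h ⟨v, hv⟩
      rw [inner_energyEmb hlam hμ hk, inner_massEmb] at this
      exact this
  rw [h, Submodule.span_image]
  exact (LinearEquiv.rank_eq (Submodule.equivMapOfInjective _
    (Submodule.injective_subtype _) _)).symm

instance : CompleteSpace (energySpace Ω) := by
  refine IsComplete.completeSpace_coe (IsClosed.isComplete ?_)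
  rw [coe_energySpace]
  exact isClosed_closure

/-- All eigenvalues are positive. -/
theorem pos_of_mem_eigenvalueSet {lam μ k t : ℝ} (hlam : 0 < lam) (hμ : 0 < μ) (hk : 0 < k)
    (ht : 0 < t) {i₀ : Fin N} {R : ℝ} (hR : 0 ≤ R) (hΩ : ∀ x ∈ Ω, |x i₀| ≤ R) {n : ℕ} (hn : 1 ≤ n)
    {Λ : ℝ} (hΛ : (n : Cardinal) ≤ Module.rank ℝ (Submodule.span ℝ
      {u : State Ω | ∃ γ ≤ Λ, IsEigenvector lam μ k t γ u})) : 0 < Λ := by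
  rw [rank_span_eigenvector hlam hμ hk] at hΛ
  obtain ⟨C, hC0, hC⟩ := exists_norm_le_energyEmb (Ω := Ω) lam hμ hk ht hR hΩ
  by_contra! hneg
  have hbot : Submodule.span ℝ (eigenvectorSet (energyEmb lam μ k t Ω) (massEmb t Ω) Λ) = ⊥ := by
    rw [Submodule.eq_bot_iff]
    intro u hu
    have h1 := norm_sq_le_of_mem_span_eigenvectorSet hu
    have h2 : ‖energyEmb lam μ k t Ω u‖ ^ 2 ≤ 0 :=
      h1.trans (mul_nonpos_of_nonpos_of_nonneg hneg (sq_nonneg _))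
    have h3 : ‖energyEmb lam μ k t Ω u‖ = 0 := pow_eq_zero_iff (two_ne_zero) |>.1
      (le_antisymm h2 (sq_nonneg _))
    have h4 := hC u
    rw [h3, mul_zero] at h4
    exact norm_le_zero_iff.1 h4
  rw [hbot, rank_bot] at hΛ
  have : (n : Cardinal) = 0 := le_antisymm hΛ (zero_le)
  rw [Nat.cast_eq_zero] at this
  omega

/-- Transfer of the eigenvalue counting condition by a small deformation. -/
theorem le_rank_of_deformation {lam μ k t : ℝ} (hlam : 0 < lam) (hμ : 0 < μ) (hk : 0 < k)
    (ht : 0 < t) {i₀ : Fin N} {R : ℝ} (hR : 0 ≤ R) {Ω₁ Ω₂ : Set (Eucl N)}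
    (hΩ₁ : ∀ x ∈ Ω₁, |x i₀| ≤ R) (hΩ₂ : ∀ x ∈ Ω₂, |x i₀| ≤ R) (hΩ₂o : IsOpen Ω₂)
    (hΩ₂b : Bornology.IsBounded Ω₂) {a b : ℝ} (ha : 0 < a) (hb : 0 < b)
    (Ψ : TestState Ω₁ →ₗ[ℝ] TestState Ω₂)
    (hΨa : ∀ u, form lam μ k t (testStateAux Ω₂ (Ψ u)) (testStateAux Ω₂ (Ψ u)) ≤
      a * form lam μ k t (testStateAux Ω₁ u) (testStateAux Ω₁ u))
    (hΨb : ∀ u, b * massForm t (testStateAux Ω₁ u) (testStateAux Ω₁ u) ≤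
      massForm t (testStateAux Ω₂ (Ψ u)) (testStateAux Ω₂ (Ψ u)))
    {Λ : ℝ} (hΛ : 0 < Λ) {n : ℕ} (hn : (n : Cardinal) ≤ Module.rank ℝ (Submodule.span ℝ
      {u : State Ω₁ | ∃ γ ≤ Λ, IsEigenvector lam μ k t γ u})) :
    (n : Cardinal) ≤ Module.rank ℝ (Submodule.span ℝ
      {u : State Ω₂ | ∃ γ ≤ a / b * Λ, IsEigenvector lam μ k t γ u}) := by
  rw [rank_span_eigenvector hlam hμ hk] at hn ⊢
  obtain ⟨C₁, hC₁0, hC₁⟩ := exists_norm_le_energyEmb (Ω := Ω₁) lam hμ hk ht hR hΩ₁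
  obtain ⟨C₂, hC₂0, hC₂⟩ := exists_norm_le_energyEmb (Ω := Ω₂) lam hμ hk ht hR hΩ₂
  set J₁ := energyEmb lam μ k t Ω₁
  set J₂ := energyEmb lam μ k t Ω₂
  have hJ₁ : Function.Injective J₁ := by
    rw [injective_iff_map_eq_zero]
    intro u hu
    have := hC₁ u
    rw [hu, norm_zero, mul_zero] at this
    exact norm_le_zero_iff.1 this
  have hJ₂ : AntilipschitzWith C₂.toNNReal J₂ :=
    AddMonoidHomClass.antilipschitz_of_bound J₂ fun u => by
      rw [Real.coe_toNNReal _ hC₂0]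
      exact hC₂ u
  -- the transplantation of test functions is bounded, hence extends to the energy space
  let f : TestState Ω₁ →ₗ[ℝ] energySpace Ω₂ := testState Ω₂ ∘ₗ Ψ
  have hfa : ∀ u, ‖J₂ (f u)‖ ^ 2 ≤ a * ‖J₁ (testState Ω₁ u)‖ ^ 2 := fun u => by
    rw [norm_sq_energyEmb hlam hμ hk, norm_sq_energyEmb hlam hμ hk]
    exact hΨa u
  have hfb : ∀ u, b * ‖massEmb t Ω₁ (testState Ω₁ u)‖ ^ 2 ≤ ‖massEmb t Ω₂ (f u)‖ ^ 2 := fun u => by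
    rw [norm_sq_massEmb, norm_sq_massEmb]
    exact hΨb u
  have hbound : ∃ C, ∀ u, ‖f u‖ ≤ C * ‖testState Ω₁ u‖ := by
    refine ⟨C₂ * (√a * ‖J₁‖), fun u => (hC₂ (f u)).trans ?_⟩
    rw [mul_assoc]
    refine mul_le_mul_of_nonneg_left ?_ hC₂0
    refine le_of_sq_le_sq ((hfa u).trans ?_) (by positivity)
    rw [mul_pow, mul_pow, Real.sq_sqrt ha.le, mul_assoc, ← mul_pow]
    gcongr
    exact J₁.le_opNorm _
  let Φ : energySpace Ω₁ →L[ℝ] energySpace Ω₂ := f.extendOfNorm (testState Ω₁)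
  have hΦ : ∀ u, Φ (testState Ω₁ u) = f u :=
    LinearMap.extendOfNorm_eq denseRange_testState hbound
  have hΦa : ∀ u, ‖J₂ (Φ u)‖ ^ 2 ≤ a * ‖J₁ u‖ ^ 2 := fun u =>
    denseRange_testState.induction_on (p := fun u => ‖J₂ (Φ u)‖ ^ 2 ≤ a * ‖J₁ u‖ ^ 2) u
      (isClosed_le (by fun_prop) (by fun_prop)) fun v => by
        rw [hΦ]
        exact hfa v
  have hΦb : ∀ u, b * ‖massEmb t Ω₁ u‖ ^ 2 ≤ ‖massEmb t Ω₂ (Φ u)‖ ^ 2 := fun u =>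
    denseRange_testState.induction_on
      (p := fun u => b * ‖massEmb t Ω₁ u‖ ^ 2 ≤ ‖massEmb t Ω₂ (Φ u)‖ ^ 2) u
      (isClosed_le (by fun_prop) (by fun_prop)) fun v => by
        rw [hΦ]
        exact hfb v
  exact le_rank_span_eigenvectorSet_of_map hJ₁ hJ₂ (isCompactOperator_massEmb hΩ₂o hΩ₂b t)
    (Φ : energySpace Ω₁ →ₗ[ℝ] energySpace Ω₂) ha hb hΦa hΦb hΛ hn

end Embeddings

/-! ### Comparison of eigenvalues on two sets of an atlas class -/

section Stability

variable {d : ℕ}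

/-- All sets of an atlas class lie in a common ball. -/
theorem Atlas.exists_bound (A : Atlas d) :
    ∃ R : ℝ, 0 ≤ R ∧ ∀ Ω ∈ A.Class, Bornology.IsBounded Ω ∧ ∀ x ∈ Ω, ∀ i, |x i| ≤ R := by
  have hb : Bornology.IsBounded (⋃ j, A.V j) :=
    Bornology.isBounded_iUnion.2 fun j => (A.isCuboid j).isBounded
  obtain ⟨R, hR⟩ := hb.subset_closedBall 0
  refine ⟨max R 0, le_max_right _ _, fun Ω hΩ => ?_⟩
  have hsub : Ω ⊆ ⋃ j, A.V j := hΩ.2.1.trans (iUnion_mono fun j x hx => hx.1)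
  refine ⟨hb.subset hsub, fun x hx i => ?_⟩
  have := hR (hsub hx)
  rw [mem_closedBall_zero_iff] at this
  exact (PiLp.norm_apply_le x i).trans (this.trans (le_max_left _ _))

/-- One-sided comparison of the eigenvalues of two sets of an atlas class. -/
theorem Atlas.exists_eigenvalue_le (A : Atlas d) {lam μ : ℝ} (hlam : 0 < lam) (hμ : 0 < μ) :
    ∃ C > 0, ∃ ε₀ > 0, ∀ ε, 0 < ε → ε < ε₀ → ∀ (k : ℝ), 0 < k → ∀ (n : ℕ), 1 ≤ n →
      ∀ (t : ℝ), 0 < t → ∀ Ω₁ ∈ A.Class, ∀ Ω₂ ∈ A.Class, A.dist Ω₁ Ω₂ < ε →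
        eigenvalue lam μ k n t Ω₂ ≤ (1 + C * ε) * eigenvalue lam μ k n t Ω₁ := by
  obtain ⟨Ψ, hΨ, hΨc, ε₁, hε₁, hmem⟩ := A.exists_field
  obtain ⟨K, hK, ε₂, hε₂, hdef⟩ := exists_smallDeformation hΨ hΨc
  obtain ⟨R, hR, hbd⟩ := A.exists_bound
  obtain ⟨C, hC, ε₃, hε₃, hbound⟩ :=
    exists_transplant_bound (Fin.last d) R hK hlam hμ
  refine ⟨4 * C, by positivity, min (min ε₁ ε₂) (min ε₃ (1 / (2 * C))), by positivity, ?_⟩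
  intro ε hε hε0 k hk n hn t ht
  obtain ⟨h12, h34⟩ := lt_min_iff.1 hε0
  obtain ⟨hε1, hε2⟩ := lt_min_iff.1 h12
  obtain ⟨hε3, hε4⟩ := lt_min_iff.1 h34
  rw [lt_div_iff₀ (by positivity)] at hε4
  have hCε : 0 < C * ε := by positivity
  let 𝒮 : Set (Eucl (d + 1)) → Set ℝ := fun Ω => {Λ : ℝ | (n : Cardinal) ≤
    Module.rank ℝ (Submodule.span ℝ {u : State Ω | ∃ γ ≤ Λ, IsEigenvector lam μ k t γ u})}
  have hpos : ∀ Ω ∈ A.Class, ∀ Λ ∈ 𝒮 Ω, 0 < Λ := fun Ω hΩ Λ hΛ =>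
    pos_of_mem_eigenvalueSet (i₀ := Fin.last d) hlam hμ hk ht hR
      (fun x hx => (hbd Ω hΩ).2 x hx _) hn hΛ
  have key : ∀ Ω₁ ∈ A.Class, ∀ Ω₂ ∈ A.Class, A.dist Ω₁ Ω₂ < ε → ∀ Λ ∈ 𝒮 Ω₁,
      (1 + 4 * C * ε) * Λ ∈ 𝒮 Ω₂ := by
    intro Ω₁ h₁ Ω₂ h₂ hd Λ hΛ
    obtain ⟨D, hD⟩ := hdef ε hε hε2
    have h : ∀ y, D.S y ∈ Ω₁ → y ∈ Ω₂ := fun y hy =>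
      hmem ε hε hε1 Ω₁ h₁ Ω₂ h₂ hd y (hD y ▸ hy)
    have hb := hbound ε hε hε3 D Ω₁ Ω₂ (fun x hx => (hbd Ω₁ h₁).2 x hx _) h k t hk ht
    have hΛ0 := hpos Ω₁ h₁ Λ hΛ
    have hrank := le_rank_of_deformation (i₀ := Fin.last d) hlam hμ hk ht hR
      (fun x hx => (hbd Ω₁ h₁).2 x hx _) (fun x hx => (hbd Ω₂ h₂).2 x hx _) h₂.1 (hbd Ω₂ h₂).1
      (a := 1 + C * ε) (b := 1 - C * ε) (by linarith) (by linarith) (pullback D h)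
      (fun u => (hb u).1) (fun u => (hb u).2) hΛ0 hΛ
    refine hrank.trans (Submodule.rank_mono (Submodule.span_mono ?_))
    rintro u ⟨γ, hγ, hu⟩
    refine ⟨γ, hγ.trans ?_, hu⟩
    -- `(1 + x) / (1 - x) ≤ 1 + 4 x` for `0 ≤ x ≤ 1 / 2`
    have : (1 + C * ε) / (1 - C * ε) ≤ 1 + 4 * C * ε := by
      rw [div_le_iff₀ (by linarith)]
      have : 0 ≤ C * ε * (1 - 2 * (C * ε)) := mul_nonneg hCε.le (by linarith)
      linarith
    gcongr
  intro Ω₁ h₁ Ω₂ h₂ hd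
  change sInf (𝒮 Ω₂) ≤ (1 + 4 * C * ε) * sInf (𝒮 Ω₁)
  have hfac : 0 < 1 + 4 * C * ε := by positivity
  rcases (𝒮 Ω₁).eq_empty_or_nonempty with he | hne
  · -- by symmetry, the two sets of levels are empty at the same time
    have he₂ : 𝒮 Ω₂ = ∅ := by
      rw [eq_empty_iff_forall_notMem]
      intro Λ hΛ
      have := key Ω₂ h₂ Ω₁ h₁ (A.dist_comm Ω₁ Ω₂ ▸ hd) Λ hΛ
      rw [he] at this
      exact this
    rw [he, he₂, Real.sInf_empty, mul_zero]
  · rw [mul_comm, ← div_le_iff₀ hfac]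
    refine le_csInf hne fun Λ hΛ => ?_
    rw [div_le_iff₀ hfac, mul_comm]
    exact csInf_le ⟨0, fun Λ' hΛ' => (hpos Ω₂ h₂ Λ' hΛ').le⟩ (key Ω₁ h₁ Ω₂ h₂ hd Λ hΛ)

theorem eigenvalue_nonneg_of_mem_class {A : Atlas d} {lam μ k t : ℝ} (hlam : 0 < lam)
    (hμ : 0 < μ) (hk : 0 < k) (ht : 0 < t) {n : ℕ} (hn : 1 ≤ n) {Ω : Set (Eucl (d + 1))}
    (hΩ : Ω ∈ A.Class) : 0 ≤ eigenvalue lam μ k n t Ω := by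
  obtain ⟨R, hR, hbd⟩ := A.exists_bound
  exact Real.sInf_nonneg fun Λ hΛ => (pos_of_mem_eigenvalueSet (i₀ := Fin.last d) hlam hμ hk ht hR
    (fun x hx => (hbd Ω hΩ).2 x hx _) hn hΛ).le

end Stability

end ReissnerMindlin

end

theorem mainTheorem2 (d : ℕ) (A : ReissnerMindlin.Atlas d) (lam μ : ℝ)
    (hlam : 0 < lam) (hμ : 0 < μ) :
    ∃ c : ℝ, 0 < c ∧
      ∀ (k : ℝ), 0 < k → ∀ (n : ℕ), 1 ≤ n → ∀ (t : ℝ), 0 < t →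
      ∀ Ω₁ ∈ A.Class, ∀ Ω₂ ∈ A.Class, A.dist Ω₁ Ω₂ < c⁻¹ →
        |ReissnerMindlin.eigenvalue lam μ k n t Ω₁ - ReissnerMindlin.eigenvalue lam μ k n t Ω₂| ≤
          c * max (ReissnerMindlin.eigenvalue lam μ k n t Ω₁)
            (ReissnerMindlin.eigenvalue lam μ k n t Ω₂) * A.dist Ω₁ Ω₂ := by
  obtain ⟨C, hC, ε₀, hε₀, h⟩ := A.exists_eigenvalue_le hlam hμ
  refine ⟨max C (1 / ε₀), lt_max_of_lt_left hC, fun k hk n hn t ht Ω₁ h₁ Ω₂ h₂ hd => ?_⟩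
  set c := max C (1 / ε₀) with hc
  have hc0 : 0 < c := lt_max_of_lt_left hC
  have hdε : A.dist Ω₁ Ω₂ < ε₀ := hd.trans_le (by
    rw [inv_le_comm₀ hc0 hε₀, ← one_div]
    exact le_max_right _ _)
  have hd0 := A.dist_nonneg Ω₁ Ω₂
  -- the one-sided estimates hold for every `ε` above the atlas distance, hence also in the limit
  have key : ∀ Ω ∈ A.Class, ∀ Ω' ∈ A.Class, A.dist Ω Ω' = A.dist Ω₁ Ω₂ →
      ReissnerMindlin.eigenvalue lam μ k n t Ω' ≤
        (1 + C * A.dist Ω₁ Ω₂) * ReissnerMindlin.eigenvalue lam μ k n t Ω := by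
    intro Ω hΩ Ω' hΩ' he
    have hlim : Filter.Tendsto (fun ε => (1 + C * ε) * ReissnerMindlin.eigenvalue lam μ k n t Ω)
        (nhdsWithin (A.dist Ω₁ Ω₂) (Ioi (A.dist Ω₁ Ω₂)))
        (nhds ((1 + C * A.dist Ω₁ Ω₂) * ReissnerMindlin.eigenvalue lam μ k n t Ω)) :=
      (Continuous.tendsto (by fun_prop) _).mono_left nhdsWithin_le_nhds
    refine ge_of_tendsto hlim ?_
    filter_upwards [Ioo_mem_nhdsGT hdε] with ε hε
    exact h ε (hd0.trans_lt hε.1) hε.2 k hk n hn t ht Ω hΩ Ω' hΩ' (he ▸ hε.1)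
  have k1 := key Ω₁ h₁ Ω₂ h₂ rfl
  have k2 := key Ω₂ h₂ Ω₁ h₁ (A.dist_comm Ω₂ Ω₁)
  have n1 := ReissnerMindlin.eigenvalue_nonneg_of_mem_class hlam hμ hk ht hn h₁
  have hCc : C * A.dist Ω₁ Ω₂ ≤ c * A.dist Ω₁ Ω₂ :=
    mul_le_mul_of_nonneg_right (le_max_left _ _) hd0
  set γ₁ := ReissnerMindlin.eigenvalue lam μ k n t Ω₁
  set γ₂ := ReissnerMindlin.eigenvalue lam μ k n t Ω₂
  have hm : 0 ≤ max γ₁ γ₂ := n1.trans (le_max_left _ _)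
  have hle : ∀ γ, γ ≤ max γ₁ γ₂ →
      C * A.dist Ω₁ Ω₂ * γ ≤ c * max γ₁ γ₂ * A.dist Ω₁ Ω₂ := by
    intro γ hγ
    calc C * A.dist Ω₁ Ω₂ * γ ≤ C * A.dist Ω₁ Ω₂ * max γ₁ γ₂ := by gcongr
      _ ≤ c * A.dist Ω₁ Ω₂ * max γ₁ γ₂ := by gcongr
      _ = _ := by ring
  rw [abs_le]
  constructor
  · linarith [hle γ₁ (le_max_left _ _)]
  · linarith [hle γ₂ (le_max_right _ _)]
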